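/- Let $a_n>0$ and $b_n\in\mathbb R$ ($n\ge 0$) be bounded and let $H$ be the Jacobi operator in $\ell^2(\mathbb Z_+)$, $(Hu)_n=a_{n-1}u_{n-1}+b_nu_n+a_nu_{n+1}$ (with $u_{-1}=0$). Let $H_0$ be the Jacobi operator with $a_n=1/2$, $b_n=0$. Assume $$\sum_{n=0}^\infty\big(|a_n-1/2|+|b_n|\big)<\infty\quad\text{and}\quad \sum_{n=0}^\infty\rho_n^2<\infty,\qquad \rho_n:=\sum_{m=n}^\infty\big(|a_m-1/2|+|b_m|\big).$$ Notation. For $z\in\mathbb C\setminus[-1,1]$ put $\zeta(z)=z-\sqrt{z^2-1}$, with the branch $\sqrt{z^2-1}>0$ for $z>1$. Let $\{f_n(z)\}_{n\ge -1}$ be the Jost solution: the solution of $a_{n-1}f_{n-1}+b_nf_n+a_nf_{n+1}=zf_n$, $n\ge 0$ (with $a_{-1}:=1/2$), such that $f_n(z)=\zeta(z)^n(1+O(\rho_n))$ as $n\to\infty$. Let $\omega(z)=-\tfrac12f_{-1}(z)$, $\omega_0(z)=-(2\zeta(z))^{-1}$, let $\Omega(z)=\omega(z)/\omega_0(z)$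 be the Jost function, and let $\Omega(\lambda\pm i0)$, $\lambda\in(-1,1)$, be the limits of $\Omega(z)$ as $z\to\lambda$, $\pm\operatorname{Im}z>0$. Let $P_n$ be the polynomials with $a_{n-1}P_{n-1}+b_nP_n+a_nP_{n+1}=\lambda P_n$, $P_{-1}=0$, $P_0=1$, and $P_n^{(0)}$ the corresponding polynomials for $H_0$. For $\lambda\in(-1,1)$ put $$w(\lambda)=\tfrac2\pi\sqrt{1-\lambda^2}\,|\Omega(\lambda+i0)|^{-2},\qquad w_0(\lambda)=\tfrac2\pi\sqrt{1-\lambda^2}.$$ Let $F,F_0:\ell^2(\mathbb Z_+)\to L^2(-1,1)$ be the bounded operators with $Fe_n=\sqrt{w}\,P_n$ and $F_0e_n=\sqrt{w_0}\,P^{(0)}_n$ for all $n$, where $e_n$ is the canonical basis, and let $\Sigma_\pm$ be the operator of multiplication by $\Omega(\lambda\pm i0)/|\Omega(\lambda\pm i0)|$ in $L^2(-1,1)$. Theorem. All these objects are well defined: for every $z\in\mathbb C\setminus[-1,1]$ the Jost solution exists and is unique, the limits $\Omega(\lambda\pm i0)$, $\lambda\in(-1,1)$, exist and are non-zero, and the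 bounded operators $F,F_0,\Sigma_\pm$ exist. The wave operators, that is, the strong limits $$W_\pm(H,H_0)=\operatorname*{s-lim}_{t\to\pm\infty}e^{iHt}e^{-iH_0t},$$ exist, and $$W_\pm(H,H_0)=F^*\,\Sigma_\pm\,F_0 .$$ -/

import Mathlib

open Filter Topology MeasureTheory

/-- The space `ℓ²(ℤ₊)` of complex square-summable sequences. -/
abbrev Ell2 : Type := lp (fun _ : ℕ => ℂ) 2

/-- The space `L²(-1,1)` with respect to Lebesgue measure. -/
abbrev L2Interval : Type := Lp ℂ 2 (volume.restrict (Set.Ioo (-1 : ℝ) 1))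

/-- Coefficients of a bounded semi-infinite Jacobi matrix: off-diagonal entries `a n > 0`, real
diagonal entries `b n`. -/
structure JacobiMatrix where
  a : ℕ → ℝ
  b : ℕ → ℝ
  a_pos : ∀ n, 0 < a n
  a_bdd : ∃ C, ∀ n, |a n| ≤ C
  b_bdd : ∃ C, ∀ n, |b n| ≤ C

namespace JacobiMatrix

/-- The free Jacobi matrix `a n = 1/2`, `b n = 0`. -/
noncomputable def free : JacobiMatrix where
  a := fun _ => 1 / 2
  b := fun _ => 0
  a_pos := fun _ => by norm_num
  a_bdd := ⟨1 / 2, fun _ => by norm_num⟩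
  b_bdd := ⟨0, fun _ => by norm_num⟩

variable (J : JacobiMatrix)

/-- The action `u ↦ (a (n-1) u (n-1) + b n u n + a n u (n+1))ₙ` of the matrix on sequences, where
the first term is absent for `n = 0`. -/
def act (u : ℕ → ℂ) : ℕ → ℂ
  | 0 => (J.b 0 : ℂ) * u 0 + (J.a 0 : ℂ) * u 1
  | n + 1 => (J.a n : ℂ) * u n + (J.b (n + 1) : ℂ) * u (n + 1) + (J.a (n + 1) : ℂ) * u (n + 2)

theorem act_memlp (u : ℕ → ℂ) (hu : Memℓp (E := fun _ : ℕ => ℂ) u 2) :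
    Memℓp (E := fun _ : ℕ => ℂ) (J.act u) 2 := by
  have hp : (0 : ℝ) < (2 : ENNReal).toReal := by norm_num
  obtain ⟨A, hA⟩ := J.a_bdd
  obtain ⟨B, hB⟩ := J.b_bdd
  have key : ∀ (c : ℕ → ℝ) (C : ℝ) (v : ℕ → ℂ), (∀ n, |c n| ≤ C) →
      Memℓp (E := fun _ : ℕ => ℂ) v 2 →
      Memℓp (E := fun _ : ℕ => ℂ) (fun n => (c n : ℂ) * v n) 2 := by
    intro c C v hc hv
    have hv' : Memℓp (E := fun _ : ℕ => ℂ) ((C : ℂ) • v) 2 := hv.const_smul (C : ℂ)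
    rw [memℓp_gen_iff hp] at hv' ⊢
    refine Summable.of_nonneg_of_le (fun n => by positivity) (fun n => ?_) hv'
    refine Real.rpow_le_rpow (norm_nonneg _) ?_ hp.le
    have h : |c n| ≤ |C| := (hc n).trans (le_abs_self C)
    simpa using mul_le_mul_of_nonneg_right h (norm_nonneg (v n))
  have hshift : Memℓp (E := fun _ : ℕ => ℂ) (fun n => u (n + 1)) 2 := by
    rw [memℓp_gen_iff hp] at hu ⊢
    exact (summable_nat_add_iff 1).2 hu
  have h1 : Memℓp (E := fun _ : ℕ => ℂ)
      (fun n => Nat.casesOn n (0 : ℂ) fun m => (J.a m : ℂ) * u m) 2 := by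
    have h := key J.a A u hA hu
    rw [memℓp_gen_iff hp] at h ⊢
    exact (summable_nat_add_iff 1).1 h
  have h2 := key J.b B u hB hu
  have h3 := key J.a A _ hA hshift
  have h := (h1.add h2).add h3
  have e : J.act u = ((fun n => Nat.casesOn n (0 : ℂ) fun m => (J.a m : ℂ) * u m) +
      fun n => (J.b n : ℂ) * u n) + fun n => (J.a n : ℂ) * u (n + 1) := by
    funext n
    cases n <;> simp [act]
  rw [e]
  exact h

/-- The Jacobi matrix as a linear map of `ℓ²(ℤ₊)`. -/
def opLinear : Ell2 →ₗ[ℂ] Ell2 where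
  toFun u := ⟨J.act u, J.act_memlp u u.2⟩
  map_add' u v := by
    ext n
    change J.act (fun k => u k + v k) n = J.act u n + J.act v n
    cases n <;> simp only [act] <;> ring
  map_smul' c u := by
    ext n
    change J.act (fun k => c * u k) n = c * J.act u n
    cases n <;> simp only [act] <;> ring

/-- The Jacobi operator `H`, a bounded operator in `ℓ²(ℤ₊)`. -/
noncomputable def op : Ell2 →L[ℂ] Ell2 :=
  ContinuousLinearMap.ofSeqClosedGraph (g := J.opLinear) (by
    have hc : ∀ n : ℕ, Continuous fun u : Ell2 => u n := fun n =>
      (lp.lipschitzWith_one_eval (E := fun _ : ℕ => ℂ) 2 n).continuous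
    intro u x y hx hy
    ext n
    refine tendsto_nhds_unique (((hc n).tendsto y).comp hy) ?_
    have ht : ∀ m, Tendsto (fun k => u k m) atTop (𝓝 (x m)) :=
      fun m => ((hc m).tendsto x).comp hx
    cases n with
    | zero => exact ((ht 0).const_mul _).add ((ht 1).const_mul _)
    | succ n =>
      have h1 := ((ht n).const_mul (J.a n : ℂ)).add ((ht (n + 1)).const_mul (J.b (n + 1) : ℂ))
      exact h1.add ((ht (n + 2)).const_mul (J.a (n + 1) : ℂ)))

theorem op_apply (u : Ell2) (n : ℕ) : J.op u n = J.act u n := rfl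

/-- The short-range (trace class) condition `∑ (|a n - 1/2| + |b n|) < ∞`. -/
def TraceCondition : Prop :=
  Summable fun n => |J.a n - 1 / 2| + |J.b n|

/-- The tails `ρ n = ∑_{m ≥ n} (|a m - 1/2| + |b m|)`. -/
noncomputable def rho (n : ℕ) : ℝ :=
  ∑' m : ℕ, (|J.a (n + m) - 1 / 2| + |J.b (n + m)|)

/-- The orthonormal polynomials: `P 0 = 1`, `b 0 P 0 + a 0 P 1 = x P 0` and
`a n P n + b (n+1) P (n+1) + a (n+1) P (n+2) = x P (n+1)`. -/
noncomputable def P : ℕ → ℝ → ℝ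
  | 0, _ => 1
  | 1, x => (x - J.b 0) / J.a 0
  | n + 2, x => ((x - J.b (n + 1)) * P (n + 1) x - J.a n * P n x) / J.a (n + 1)

end JacobiMatrix

/-- The domain `Π = ℂ \ [-1,1]`. -/
def cutPlane : Set ℂ := ((fun x : ℝ => (x : ℂ)) '' Set.Icc (-1 : ℝ) 1)ᶜ

/-- The branch of `√(z² - 1)` that is analytic on `ℂ \ [-1,1]` and positive for `z > 1`, written
through principal square roots as `√(z - 1) √(z + 1)`. -/
noncomputable def sqrtBranch (z : ℂ) : ℂ :=
  (z - 1) ^ (1 / 2 : ℂ) * (z + 1) ^ (1 / 2 : ℂ)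

/-- `ζ(z) = z - √(z² - 1)`. -/
noncomputable def zetaMap (z : ℂ) : ℂ := z - sqrtBranch z

namespace JacobiMatrix

variable (J : JacobiMatrix)

/-- `f` is the Jost solution at `z ∈ ℂ \ [-1,1]`. A sequence indexed by `n = -1, 0, 1, …` is coded
with a shift: `f k` stands for the term with index `k - 1`. The conditions are the Jacobi equation
`a (n-1) f (n-1) + b n f n + a n f (n+1) = z f n` for all `n ≥ 0`, with the convention that the
coefficient with index `-1` is `1/2`, and `f n = ζ(z) ^ n (1 + O(ρ n))` as `n → ∞`. -/
def IsJostSolution (z : ℂ) (f : ℕ → ℂ) : Prop :=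
  (1 / 2 * f 0 + (J.b 0 : ℂ) * f 1 + (J.a 0 : ℂ) * f 2 = z * f 1) ∧
  (∀ n : ℕ, (J.a n : ℂ) * f (n + 1) + (J.b (n + 1) : ℂ) * f (n + 2)
      + (J.a (n + 1) : ℂ) * f (n + 3) = z * f (n + 2)) ∧
  (fun n : ℕ => f (n + 1) / zetaMap z ^ n - 1) =O[atTop] J.rho

open Classical in
/-- The Jost solution at `z` (with the shifted indexing above). -/
noncomputable def jostSolution (z : ℂ) : ℕ → ℂ :=
  if h : ∃ f, J.IsJostSolution z f then h.choose else 0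

/-- The Wronskian `ω(z) = a n (P n f (n+1) - P (n+1) f n)` of the regular solution
(`P (-1) = 0`, `P 0 = 1`) and the Jost solution, evaluated at `n = -1`: it equals
`-f (-1) / 2`. -/
noncomputable def omega (z : ℂ) : ℂ :=
  1 / 2 * (0 * J.jostSolution z 1 - 1 * J.jostSolution z 0)

/-- The Jost function `Ω(z) = ω(z) / ω₀(z)`, where `ω₀(z) = -(2 ζ(z))⁻¹`. -/
noncomputable def jostFunction (z : ℂ) : ℂ :=
  J.omega z / (-(2 * zetaMap z)⁻¹)

/-- `Ω(x + i0)`: the limit of `Ω(z)` as `z → x` with `Im z > 0`. -/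
noncomputable def jostPlus (x : ℝ) : ℂ :=
  limUnder (𝓝[{z : ℂ | 0 < z.im}] (x : ℂ)) J.jostFunction

/-- `Ω(x - i0)`: the limit of `Ω(z)` as `z → x` with `Im z < 0`. -/
noncomputable def jostMinus (x : ℝ) : ℂ :=
  limUnder (𝓝[{z : ℂ | z.im < 0}] (x : ℂ)) J.jostFunction

/-- The weight function `w(x) = 2 π⁻¹ √(1 - x²) |Ω(x + i0)|⁻²` on `(-1,1)`. -/
noncomputable def weight (x : ℝ) : ℝ :=
  2 / Real.pi * √(1 - x ^ 2) * (‖J.jostPlus x‖ ^ 2)⁻¹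

/-- `ψ n (x) = √(w x) P n (x)`. -/
noncomputable def psi (n : ℕ) (x : ℝ) : ℝ := √(J.weight x) * J.P n x

/-- `σ₊(x) = Ω(x + i0) / |Ω(x + i0)|`. -/
noncomputable def sigmaPlus (x : ℝ) : ℂ := J.jostPlus x / (‖J.jostPlus x‖ : ℂ)

/-- `σ₋(x) = Ω(x - i0) / |Ω(x - i0)|`. -/
noncomputable def sigmaMinus (x : ℝ) : ℂ := J.jostMinus x / (‖J.jostMinus x‖ : ℂ)

end JacobiMatrix

/-- `ψ⁽⁰⁾ n (x) = √(w₀ x) P⁽⁰⁾ n (x)`, where `w₀(x) = 2 π⁻¹ √(1 - x²)` and the `P⁽⁰⁾ n` are the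
orthonormal polynomials of the free Jacobi matrix (normalized Chebyshev polynomials of the second
kind). -/
noncomputable def psiFree (n : ℕ) (x : ℝ) : ℝ :=
  √(2 / Real.pi * √(1 - x ^ 2)) * JacobiMatrix.free.P n x

/-- `F` is the bounded operator `ℓ²(ℤ₊) → L²(-1,1)` with `F eₙ = φ n` for all `n`. There is at most
one, because the span of the vectors `eₙ` is dense. -/
def IsExpansionMap (φ : ℕ → ℝ → ℝ) (F : Ell2 →L[ℂ] L2Interval) : Prop :=
  ∀ n : ℕ, F (lp.single 2 n (1 : ℂ)) =ᵐ[volume.restrict (Set.Ioo (-1 : ℝ) 1)]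
    fun x => (φ n x : ℂ)

/-- `S` is the operator of multiplication by the function `σ` in `L²(-1,1)`. -/
def IsMultiplicationBy (σ : ℝ → ℂ) (S : L2Interval →L[ℂ] L2Interval) : Prop :=
  ∀ g : L2Interval, S g =ᵐ[volume.restrict (Set.Ioo (-1 : ℝ) 1)] fun x => σ x * g x

/-- `W` is the strong limit of `exp(i H t) exp(-i H₀ t)` as `t` tends to the filter `l`. -/
def IsWaveOperator (l : Filter ℝ) (H H₀ W : Ell2 →L[ℂ] Ell2) : Prop :=
  ∀ u : Ell2, Tendsto
    (fun t : ℝ => NormedSpace.exp ((Complex.I * (t : ℂ)) • H)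
      (NormedSpace.exp ((-(Complex.I * (t : ℂ))) • H₀) u)) l (𝓝 (W u))

/-! Everything rests on one decomposition of the eigenfunctions. For `x` in `(-1,1)` and `s = ±1`
(the two sides of the cut) let `ζ = zetaBd s x`, a point of the unit circle, `Ω = jostOmega ζ` and
`σ = Ω/|Ω|`. The Jost solution `ζⁿ pₙ`, with `pₙ = 1 + O(ρₙ)`, and its conjugate solve the same real
recurrence and have Wronskian proportional to `ζ - ζ̄ ≠ 0`. Hence `Ω ≠ 0`, and `Pₙ` is an explicit
combination of the two (`P_eq_jost`). Multiplying by `σ √w` and putting `κ = √w₀/(ζ - ζ̄)` gives `σ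
ψₙ = κ (ζⁿ⁺¹ pₙ - σ² ζ̄ⁿ⁺¹ p̄ₙ) = ψ⁽⁰⁾ₙ - (σ² - 1) κ ζ̄ⁿ⁺¹ + rₙ`, where `rₙ = O(ρₙ)` uniformly on
compact subsets of `(-1,1)` (`phase_mul_psi`, `exists_remainder_bound`).

The proof works with the adjoints `G = F*` and `A₀ = F₀*`, which send `g` to its coefficients `∫ ψₙ
g` and `∫ ψ⁽⁰⁾ₙ g`. Apply the decomposition to `e^{-itx} g` with `s t → +∞`. The remainder is a
Hilbert–Schmidt operator because `∑ ρₙ² < ∞`, so the Riemann–Lebesgue lemma and domination make it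
vanish. The middle term vanishes because the phase of `ζ̄ⁿ⁺¹ e^{-itx}` has derivative of modulus
`(n+1)/√(1-x²) + |t|`: there is no stationary point, and one integration by parts gives `O(1/(n+1))`
uniformly in `t` (`tendsto_wave_evol`). Thus `G σ e^{-itx} g - A₀ e^{-itx} g → 0`
(`tendsto_analysis_sub`). Since `G` and `A₀` carry multiplication by `x` to `H` and `H₀`, `e^{itH}`
is unitary and `A₀ F₀ = 1`, this limit is the formula for the wave operators
(`isWaveOperator_of_analysis`).

No spectral resolution of `H` is used; the boundedness of `F` comes from the same limit. On `[-c,c]`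
the decomposition shows that the expansion `A` is bounded. The norm of `A h` is constant along the
evolution, while for large `t` it is compared with that of a free contraction, so `‖A h‖ ≤ ‖h‖` for
every `c < 1` (`norm_local_analysis_le`). Testing on `ψₙ` itself gives `ψₙ ∈ L²`, and `c → 1` gives
`G`.

The Jost solution comes from a backward recursion controlled on the whole closed unit disc minus
`±1`, so its boundary values follow by continuity. -/

section BackwardRecursion

/-! ### Backward recursions with summable perturbations. -/

variable {E : Type*} [NormedAddCommGroup E] [NormedSpace ℂ E]

/-- The product `T n (T (n + 1) (⋯ (T (n + k - 1) e)))`. -/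
def backwardIter (T : ℕ → E →L[ℂ] E) (e : E) : ℕ → ℕ → E
  | _, 0 => e
  | n, k + 1 => T n (backwardIter T e (n + 1) k)

/-- The solution of `x n = T n (x (n + 1))` that tends to `e`. -/
noncomputable def backwardSol (T : ℕ → E →L[ℂ] E) (e : E) (n : ℕ) : E :=
  e + ∑' k, (backwardIter T e n (k + 1) - backwardIter T e n k)

variable {T : ℕ → E →L[ℂ] E} {e : E} {ε : ℕ → ℝ}

theorem prod_one_add_le_exp_tsum (h0 : ∀ n, 0 ≤ ε n) (hs : Summable ε) (n k : ℕ) :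
    ∏ j ∈ Finset.range k, (1 + ε (n + j)) ≤ Real.exp (∑' m, ε m) := by
  calc ∏ j ∈ Finset.range k, (1 + ε (n + j))
      ≤ ∏ j ∈ Finset.range k, Real.exp (ε (n + j)) :=
        Finset.prod_le_prod (fun j _ => by linarith [h0 (n + j)])
          fun j _ => by linarith [Real.add_one_le_exp (ε (n + j))]
    _ = Real.exp (∑ j ∈ Finset.range k, ε (n + j)) := (Real.exp_sum _ _).symm
    _ ≤ Real.exp (∑' m, ε m) := by
        refine Real.exp_le_exp.2 ?_
        have h1 : Summable fun j => ε (n + j) := by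
          simpa [add_comm] using (summable_nat_add_iff n).2 hs
        refine (h1.sum_le_tsum _ fun j _ => h0 _).trans ?_
        exact h1.tsum_le_tsum_of_inj (n + ·) (add_right_injective n) (fun c _ => h0 c)
          (fun j => le_rfl) hs

/-- Consecutive iterates differ only in the innermost factor, by `T (n + k) e - e`. The `k` outer
factors amplify this by at most `∏ (1 + ε) ≤ exp (∑ ε)`. This makes the telescoping series of
`backwardSol` converge at the rate of the tails of `ε`. -/
theorem norm_backwardIter_succ_sub_le (h0 : ∀ n, 0 ≤ ε n) (hs : Summable ε)
    (hT : ∀ n v, ‖T n v‖ ≤ (1 + ε n) * ‖v‖) (he : ∀ n, ‖T n e - e‖ ≤ ε n) (n k : ℕ) :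
    ‖backwardIter T e n (k + 1) - backwardIter T e n k‖ ≤
      Real.exp (∑' m, ε m) * ε (n + k) := by
  have key : ∀ k n, ‖backwardIter T e n (k + 1) - backwardIter T e n k‖ ≤
      (∏ j ∈ Finset.range k, (1 + ε (n + j))) * ε (n + k) := by
    intro k
    induction k with
    | zero => intro n; simpa [backwardIter] using he n
    | succ k ih =>
      intro n
      have h1 : backwardIter T e n (k + 1 + 1) - backwardIter T e n (k + 1) =
          T n (backwardIter T e (n + 1) (k + 1) - backwardIter T e (n + 1) k) := by
        rw [map_sub]; rfl
      rw [h1, Finset.prod_range_succ']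
      refine (hT _ _).trans ?_
      have h2 := mul_le_mul_of_nonneg_left (ih (n + 1)) (by linarith [h0 n] : 0 ≤ 1 + ε n)
      refine h2.trans_eq ?_
      have h3 : ∀ j, n + 1 + j = n + (j + 1) := fun j => by ring
      simp only [h3, add_zero]
      ring
  exact (key k n).trans
    (mul_le_mul_of_nonneg_right (prod_one_add_le_exp_tsum h0 hs n k) (h0 _))

theorem summable_shift (hs : Summable ε) (n : ℕ) : Summable fun k => ε (n + k) := by
  simpa [add_comm] using (summable_nat_add_iff n).2 hs

theorem norm_backwardSol_sub_le (h0 : ∀ n, 0 ≤ ε n) (hs : Summable ε)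
    (hT : ∀ n v, ‖T n v‖ ≤ (1 + ε n) * ‖v‖) (he : ∀ n, ‖T n e - e‖ ≤ ε n) (n : ℕ) :
    ‖backwardSol T e n - e‖ ≤ Real.exp (∑' m, ε m) * ∑' k, ε (n + k) := by
  rw [backwardSol, add_sub_cancel_left, ← tsum_mul_left]
  exact tsum_of_norm_bounded ((summable_shift hs n).mul_left _).hasSum
    (norm_backwardIter_succ_sub_le h0 hs hT he n)

theorem tendsto_backwardIter [CompleteSpace E] (h0 : ∀ n, 0 ≤ ε n) (hs : Summable ε)
    (hT : ∀ n v, ‖T n v‖ ≤ (1 + ε n) * ‖v‖) (he : ∀ n, ‖T n e - e‖ ≤ ε n) (n : ℕ) :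
    Tendsto (backwardIter T e n) atTop (𝓝 (backwardSol T e n)) := by
  have hsum : Summable fun k => backwardIter T e n (k + 1) - backwardIter T e n k :=
    Summable.of_norm_bounded ((summable_shift hs n).mul_left _)
      (norm_backwardIter_succ_sub_le h0 hs hT he n)
  have h := hsum.hasSum.tendsto_sum_nat.const_add e
  refine h.congr fun N => ?_
  rw [Finset.sum_range_sub]
  simp [backwardIter]

theorem backwardSol_eq [CompleteSpace E] (h0 : ∀ n, 0 ≤ ε n) (hs : Summable ε)
    (hT : ∀ n v, ‖T n v‖ ≤ (1 + ε n) * ‖v‖) (he : ∀ n, ‖T n e - e‖ ≤ ε n) (n : ℕ) :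
    backwardSol T e n = T n (backwardSol T e (n + 1)) := by
  have h1 := (tendsto_backwardIter h0 hs hT he n).comp (tendsto_add_atTop_nat 1)
  have h2 := ((T n).continuous.tendsto _).comp (tendsto_backwardIter h0 hs hT he (n + 1))
  exact tendsto_nhds_unique h1 h2

/-- `y n` is a product of `k` factors, bounded uniformly in `k`, applied to `y (n + k)`; let `k →
∞`. No rate of decay is needed, which gives uniqueness of the Jost solution from its mere limit. -/
theorem eq_zero_of_backward_of_tendsto_zero (h0 : ∀ n, 0 ≤ ε n) (hs : Summable ε)
    (hT : ∀ n v, ‖T n v‖ ≤ (1 + ε n) * ‖v‖) {y : ℕ → E} (hy : ∀ n, y n = T n (y (n + 1)))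
    (hlim : Tendsto y atTop (𝓝 0)) (n : ℕ) : y n = 0 := by
  have key : ∀ k n, ‖y n‖ ≤ (∏ j ∈ Finset.range k, (1 + ε (n + j))) * ‖y (n + k)‖ := by
    intro k
    induction k with
    | zero => intro n; simp
    | succ k ih =>
      intro n
      rw [Finset.prod_range_succ']
      have h1 : ‖y n‖ ≤ (1 + ε n) * ‖y (n + 1)‖ := by
        conv_lhs => rw [hy n]
        exact hT _ _
      refine h1.trans ?_
      have h2 := mul_le_mul_of_nonneg_left (ih (n + 1)) (by linarith [h0 n] : 0 ≤ 1 + ε n)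
      refine h2.trans_eq ?_
      have h3 : ∀ j, n + 1 + j = n + (j + 1) := fun j => by ring
      simp only [h3, add_zero]
      ring
  have hb : ∀ k, ‖y n‖ ≤ Real.exp (∑' m, ε m) * ‖y (n + k)‖ := fun k =>
    (key k n).trans
      (mul_le_mul_of_nonneg_right (prod_one_add_le_exp_tsum h0 hs n k) (norm_nonneg _))
  have hl : Tendsto (fun k => Real.exp (∑' m, ε m) * ‖y (n + k)‖) atTop (𝓝 0) := by
    have h1 : Tendsto (fun k => y (n + k)) atTop (𝓝 0) := by
      simpa [Function.comp_def, add_comm] using hlim.comp (tendsto_add_atTop_nat n)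
    simpa using h1.norm.const_mul (Real.exp (∑' m, ε m))
  exact norm_le_zero_iff.1 (ge_of_tendsto' hl hb)

/-- The terms of the telescoping series are continuous and have a summable majorant independent of
the parameter. -/
theorem continuousOn_backwardSol [CompleteSpace E] {S : Type*} [TopologicalSpace S] {s : Set S}
    {T : S → ℕ → E →L[ℂ] E} (h0 : ∀ n, 0 ≤ ε n) (hs : Summable ε)
    (hT : ∀ x ∈ s, ∀ n v, ‖T x n v‖ ≤ (1 + ε n) * ‖v‖)
    (he : ∀ x ∈ s, ∀ n, ‖T x n e - e‖ ≤ ε n)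
    (hc : ∀ n (g : S → E), ContinuousOn g s → ContinuousOn (fun x => T x n (g x)) s) (n : ℕ) :
    ContinuousOn (fun x => backwardSol (T x) e n) s := by
  have hi : ∀ k n, ContinuousOn (fun x => backwardIter (T x) e n k) s := by
    intro k
    induction k with
    | zero => intro n; exact continuousOn_const
    | succ k ih => intro n; exact hc n _ (ih (n + 1))
  refine continuousOn_const.add (continuousOn_tsum (fun k => (hi (k + 1) n).sub (hi k n))
    ((summable_shift hs n).mul_left (Real.exp (∑' m, ε m))) fun k x hx => ?_)
  exact norm_backwardIter_succ_sub_le h0 hs (hT x hx) (he x hx) n k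

end BackwardRecursion

/-! ### The Jost solution and the Jost function in the variable `ζ`. -/

namespace JacobiMatrix

variable (J : JacobiMatrix)

/-- The one-step perturbation `|a n - 1/2| + |b n|`. -/
noncomputable def pert (n : ℕ) : ℝ := |J.a n - 1 / 2| + |J.b n|

theorem pert_nonneg (n : ℕ) : 0 ≤ J.pert n := by unfold pert; positivity

theorem rho_eq (n : ℕ) : J.rho n = ∑' m, J.pert (n + m) := rfl

theorem rho_nonneg (n : ℕ) : 0 ≤ J.rho n := tsum_nonneg fun _ => J.pert_nonneg _

/-- The value `p n = (X + D) / (2 a n)` in terms of `(Y, D)`, where `X = Y - D / (1 - ζ²)`. -/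
noncomputable def stepP (k : ℕ) (ζ : ℂ) (y : ℂ × ℂ) : ℂ :=
  (y.1 - (1 - ζ ^ 2)⁻¹ * y.2 + y.2) / (2 * J.a k)

/-- The new second component. -/
noncomputable def stepD (k : ℕ) (ζ : ℂ) (y : ℂ × ℂ) : ℂ :=
  (ζ ^ 2 - 2 * J.b k * ζ) * J.stepP k ζ y
    - 2 * J.a k * ζ ^ 2 * (y.1 - (1 - ζ ^ 2)⁻¹ * y.2)

/-- The backward transfer map of the Jacobi equation in the coordinates `(Y, D)` in which the free
one is `diag (1, ζ²)`. -/
noncomputable def jostStep (ζ : ℂ) (k : ℕ) : ℂ × ℂ →L[ℂ] ℂ × ℂ where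
  toFun y := (J.stepP k ζ y + (1 - ζ ^ 2)⁻¹ * J.stepD k ζ y, J.stepD k ζ y)
  map_add' x y := by
    ext <;> simp only [stepP, stepD, Prod.fst_add, Prod.snd_add] <;> ring
  map_smul' c y := by
    ext <;> simp only [stepP, stepD, Prod.smul_fst, Prod.smul_snd, smul_eq_mul,
      RingHom.id_apply] <;> ring
  cont := by
    simp only [stepD, stepP]
    fun_prop

theorem jostStep_apply (ζ : ℂ) (k : ℕ) (y : ℂ × ℂ) : J.jostStep ζ k y =
    (J.stepP k ζ y + (1 - ζ ^ 2)⁻¹ * J.stepD k ζ y, J.stepD k ζ y) := rfl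

theorem exists_inv_bound (hTr : J.TraceCondition) : ∃ M : ℝ, 1 ≤ M ∧ ∀ k, (2 * J.a k)⁻¹ ≤ M := by
  have h1 : Tendsto J.pert atTop (𝓝 0) := hTr.tendsto_atTop_zero
  have h2 : ∀ᶠ k in atTop, (2 * J.a k)⁻¹ ≤ 2 := by
    filter_upwards [h1.eventually (gt_mem_nhds (show (0 : ℝ) < 1 / 4 by norm_num))] with k hk
    have h3 : |J.a k - 1 / 2| < 1 / 4 := lt_of_le_of_lt (le_add_of_nonneg_right (abs_nonneg _)) hk
    have h4 := (abs_lt.1 h3).1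
    rw [inv_le_comm₀ (by linarith) (by norm_num)]
    linarith
  obtain ⟨N, hN⟩ := eventually_atTop.1 h2
  -- The `2` serves the tail, where `|a k - 1/2| < 1/4`; the finite sum majorizes each of the
  -- remaining terms.
  refine ⟨2 + ∑ k ∈ Finset.range N, (2 * J.a k)⁻¹, ?_, fun k => ?_⟩
  · have : 0 ≤ ∑ k ∈ Finset.range N, (2 * J.a k)⁻¹ :=
      Finset.sum_nonneg fun k _ => by have := J.a_pos k; positivity
    linarith
  · have hpos : ∀ k ∈ Finset.range N, 0 ≤ (2 * J.a k)⁻¹ :=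
      fun k _ => by have := J.a_pos k; positivity
    by_cases hk : k < N
    · have := Finset.single_le_sum hpos (Finset.mem_range.2 hk)
      linarith
    · have := hN k (not_lt.1 hk)
      have := Finset.sum_nonneg hpos
      linarith

/-- The region in which the Jost solution is controlled. -/
def jostRegion (L : ℝ) : Set ℂ := {ζ | ‖ζ‖ ≤ 1 ∧ ζ ^ 2 ≠ 1 ∧ ‖(1 - ζ ^ 2)⁻¹‖ ≤ L}

/-- For `pₙ = ζ⁻ⁿ fₙ` the coordinates are `Dₙ = (ζ² - 2 bₙ ζ) pₙ - 2 aₙ ζ² pₙ₊₁` and `Yₙ = pₙ +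
Dₙ/(1 - ζ²)`. The Jacobi equation reads `2 aₙ pₙ = pₙ₊₁ + Dₙ₊₁`, and for the free matrix `Yₙ =
Yₙ₊₁`, `Dₙ = ζ² Dₙ₊₁`. This diagonal map does not expand the sup norm even for `|ζ| = 1`, which is
what permits boundary values; the deviation from it is controlled by `1 - 2 a` and `b`. -/
theorem exists_jostStep_bound (hTr : J.TraceCondition) (L : ℝ) : ∃ C, 0 ≤ C ∧
    ∀ ζ ∈ jostRegion L, ∀ k y, ‖J.jostStep ζ k y - (y.1, ζ ^ 2 * y.2)‖ ≤ C * J.pert k * ‖y‖ := by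
  obtain ⟨M, hM1, hM⟩ := J.exists_inv_bound hTr
  -- For negative `L` the region is empty.
  by_cases hL : 0 ≤ L
  swap
  · refine ⟨0, le_rfl, fun ζ hζ => absurd ((norm_nonneg _).trans hζ.2.2) hL⟩
  set A : ℝ := 2 * M * (2 + L) with hA
  set B : ℝ := A + A + 2 * (1 + L) with hB
  have hA0 : 0 ≤ A := by positivity
  have hB0 : 0 ≤ B := by positivity
  refine ⟨A + (1 + L) * B, by positivity, fun ζ hζ k y => ?_⟩
  obtain ⟨hζ1, hζ2, hζ3⟩ := hζ
  set c : ℂ := (1 - ζ ^ 2)⁻¹ with hc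
  have hc1 : c * (1 - ζ ^ 2) = 1 := inv_mul_cancel₀ (sub_ne_zero.2 (Ne.symm hζ2))
  have ha := J.a_pos k
  have haC : (2 * (J.a k : ℂ)) ≠ 0 := by
    have : (J.a k : ℂ) ≠ 0 := by exact_mod_cast ha.ne'
    simpa using this
  set p : ℂ := J.stepP k ζ y with hp
  set d : ℂ := J.stepD k ζ y with hd
  have hy1 : ‖y.1‖ ≤ ‖y‖ := norm_fst_le y
  have hy2 : ‖y.2‖ ≤ ‖y‖ := norm_snd_le y
  have hX : ‖y.1 - c * y.2‖ ≤ (1 + L) * ‖y‖ := by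
    refine (norm_sub_le _ _).trans ?_
    rw [norm_mul]
    nlinarith [mul_le_mul hζ3 hy2 (norm_nonneg _) hL]
  have hXD : ‖y.1 - c * y.2 + y.2‖ ≤ (2 + L) * ‖y‖ := by
    refine (norm_add_le _ _).trans ?_
    linarith
  have hinv : ‖(2 * (J.a k : ℂ))⁻¹‖ ≤ M := by
    have : (2 * (J.a k : ℂ))⁻¹ = (((2 * J.a k)⁻¹ : ℝ) : ℂ) := by push_cast; ring
    rw [this, Complex.norm_real, Real.norm_of_nonneg (by positivity)]
    exact hM k
  have hpe : p = (2 * (J.a k : ℂ))⁻¹ * (y.1 - c * y.2 + y.2) := by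
    rw [hp, stepP, div_eq_inv_mul]
  have hpn : ‖p‖ ≤ A / 2 * ‖y‖ := by
    rw [hpe, norm_mul]
    have := mul_le_mul hinv hXD (norm_nonneg _) (by linarith)
    refine this.trans_eq ?_
    rw [hA]; ring
  have hda : ‖(1 - 2 * (J.a k : ℂ))‖ ≤ 2 * J.pert k := by
    have h1 : (1 - 2 * (J.a k : ℂ)) = ((-2 * (J.a k - 1 / 2) : ℝ) : ℂ) := by push_cast; ring
    rw [h1, Complex.norm_real, Real.norm_eq_abs, abs_mul]
    have : J.pert k = |J.a k - 1 / 2| + |J.b k| := rfl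
    have := abs_nonneg (J.b k)
    norm_num
    linarith
  have hdb : ‖2 * (J.b k : ℂ) * ζ‖ ≤ 2 * J.pert k := by
    rw [norm_mul, norm_mul, Complex.norm_real, Real.norm_eq_abs]
    have : J.pert k = |J.a k - 1 / 2| + |J.b k| := rfl
    have := abs_nonneg (J.b k)
    have := abs_nonneg (J.a k - 1 / 2)
    norm_num
    nlinarith [norm_nonneg ζ]
  have hpk := J.pert_nonneg k
  have hy := norm_nonneg y
  have hΔ : ‖p - (y.1 - c * y.2 + y.2)‖ ≤ A * J.pert k * ‖y‖ := by
    have h1 : p - (y.1 - c * y.2 + y.2) = (1 - 2 * (J.a k : ℂ)) * p := by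
      rw [hpe]; linear_combination (y.1 - c * y.2 + y.2) * inv_mul_cancel₀ haC
    rw [h1, norm_mul]
    have := mul_le_mul hda hpn (norm_nonneg _) (by positivity)
    refine this.trans_eq ?_
    ring
  have hz2 : ‖ζ ^ 2‖ ≤ 1 := by rw [norm_pow]; exact pow_le_one₀ (norm_nonneg _) hζ1
  have hD : ‖d - ζ ^ 2 * y.2‖ ≤ B * J.pert k * ‖y‖ := by
    have h1 : d - ζ ^ 2 * y.2 = ζ ^ 2 * (p - (y.1 - c * y.2 + y.2)) - 2 * (J.b k : ℂ) * ζ * p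
        + ζ ^ 2 * ((1 - 2 * (J.a k : ℂ)) * (y.1 - c * y.2)) := by
      rw [hd, stepD, ← hp, ← hc]; ring
    rw [h1]
    refine (norm_add_le _ _).trans ((add_le_add_left (norm_sub_le _ _) _).trans ?_)
    have e1 : ‖ζ ^ 2 * (p - (y.1 - c * y.2 + y.2))‖ ≤ A * J.pert k * ‖y‖ := by
      rw [norm_mul]
      exact (mul_le_of_le_one_left (norm_nonneg _) hz2).trans hΔ
    have e2 : ‖2 * (J.b k : ℂ) * ζ * p‖ ≤ A * J.pert k * ‖y‖ := by
      rw [norm_mul]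
      refine (mul_le_mul hdb hpn (norm_nonneg _) (by positivity)).trans_eq (by ring)
    have e3 : ‖ζ ^ 2 * ((1 - 2 * (J.a k : ℂ)) * (y.1 - c * y.2))‖ ≤
        2 * (1 + L) * J.pert k * ‖y‖ := by
      rw [norm_mul]
      refine (mul_le_of_le_one_left (norm_nonneg _) hz2).trans ?_
      rw [norm_mul]
      refine (mul_le_mul hda hX (norm_nonneg _) (by positivity)).trans_eq (by ring)
    rw [hB]
    linarith
  have hY : ‖p + c * d - y.1‖ ≤ (A + L * B) * J.pert k * ‖y‖ := by
    have h1 : p + c * d - y.1 = (p - (y.1 - c * y.2 + y.2)) + c * (d - ζ ^ 2 * y.2) := by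
      linear_combination -y.2 * hc1
    rw [h1]
    refine (norm_add_le _ _).trans ?_
    rw [norm_mul]
    have := mul_le_mul hζ3 hD (norm_nonneg _) hL
    linarith
  have hfin : 0 ≤ B * J.pert k * ‖y‖ := by positivity
  have hfin2 : 0 ≤ (A + L * B) * J.pert k * ‖y‖ := by positivity
  rw [jostStep_apply, Prod.norm_def]
  refine max_le ?_ ?_
  · change ‖p + c * d - y.1‖ ≤ _
    linarith
  · change ‖d - ζ ^ 2 * y.2‖ ≤ _
    linarith

/-- The vector `(Y, D)` of the Jost solution. -/
noncomputable def jostVec (ζ : ℂ) (n : ℕ) : ℂ × ℂ := backwardSol (J.jostStep ζ) (1, 0) n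

/-- The normalized Jost solution `p n = ζ⁻ⁿ f n`, `n ≥ 0`. -/
noncomputable def jostP (ζ : ℂ) (n : ℕ) : ℂ :=
  (J.jostVec ζ n).1 - (1 - ζ ^ 2)⁻¹ * (J.jostVec ζ n).2

/-- The Jost function in terms of `ζ`. -/
noncomputable def jostOmega (ζ : ℂ) : ℂ :=
  (1 + ζ ^ 2 - 2 * J.b 0 * ζ) * J.jostP ζ 0 - 2 * J.a 0 * ζ ^ 2 * J.jostP ζ 1

theorem exists_backward_hyp (hTr : J.TraceCondition) (L : ℝ) : ∃ C, 0 ≤ C ∧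
    (∀ ζ ∈ jostRegion L, ∀ n v, ‖J.jostStep ζ n v‖ ≤ (1 + C * J.pert n) * ‖v‖) ∧
    (∀ ζ ∈ jostRegion L, ∀ n, ‖J.jostStep ζ n (1, 0) - (1, 0)‖ ≤ C * J.pert n) := by
  obtain ⟨C, hC, h⟩ := J.exists_jostStep_bound hTr L
  refine ⟨C, hC, fun ζ hζ n v => ?_, fun ζ hζ n => ?_⟩
  · have h1 := h ζ hζ n v
    have h2 : ‖(v.1, ζ ^ 2 * v.2)‖ ≤ ‖v‖ := by
      rw [Prod.norm_def]
      refine max_le (norm_fst_le v) ?_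
      rw [norm_mul, norm_pow]
      exact (mul_le_of_le_one_left (norm_nonneg _) (pow_le_one₀ (norm_nonneg _) hζ.1)).trans
        (norm_snd_le v)
    have h3 := norm_add_le (J.jostStep ζ n v - (v.1, ζ ^ 2 * v.2)) (v.1, ζ ^ 2 * v.2)
    rw [sub_add_cancel] at h3
    linarith
  · have h1 := h ζ hζ n (1, 0)
    simpa [Prod.norm_def] using h1

theorem mem_jostRegion {ζ : ℂ} (h1 : ‖ζ‖ ≤ 1) (h2 : ζ ^ 2 ≠ 1) :
    ζ ∈ jostRegion ‖(1 - ζ ^ 2)⁻¹‖ := ⟨h1, h2, le_rfl⟩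

theorem summable_mul_pert (hTr : J.TraceCondition) (C : ℝ) : Summable fun n => C * J.pert n :=
  Summable.mul_left C hTr

theorem jostVec_eq (hTr : J.TraceCondition) {ζ : ℂ} (h1 : ‖ζ‖ ≤ 1) (h2 : ζ ^ 2 ≠ 1) (n : ℕ) :
    J.jostVec ζ n = J.jostStep ζ n (J.jostVec ζ (n + 1)) := by
  obtain ⟨C, hC, hT, he⟩ := J.exists_backward_hyp hTr ‖(1 - ζ ^ 2)⁻¹‖
  exact backwardSol_eq (fun n => mul_nonneg hC (J.pert_nonneg n)) (J.summable_mul_pert hTr C)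
    (hT ζ (mem_jostRegion h1 h2)) (he ζ (mem_jostRegion h1 h2)) n

/-- The constant depends on `ζ` only through `L`, so the estimate is uniform on compact subsets of
`(-1,1)` after passing to boundary values. The factor `1 + |L|` pays for recovering `p = Y - D/(1 -
ζ²)`. -/
theorem exists_norm_jostP_sub_one_le (hTr : J.TraceCondition) (L : ℝ) : ∃ C, 0 ≤ C ∧
    ∀ ζ ∈ jostRegion L, ∀ n, ‖J.jostVec ζ n - (1, 0)‖ ≤ C * J.rho n ∧
      ‖J.jostP ζ n - 1‖ ≤ C * J.rho n := by
  obtain ⟨C, hC, hT, he⟩ := J.exists_backward_hyp hTr L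
  set K := Real.exp (∑' m, C * J.pert m) * C with hK
  have hK0 : 0 ≤ K := by positivity
  refine ⟨(1 + |L|) * K, by positivity, fun ζ hζ n => ?_⟩
  have h := norm_backwardSol_sub_le (fun n => mul_nonneg hC (J.pert_nonneg n))
    (J.summable_mul_pert hTr C) (hT ζ hζ) (he ζ hζ) n
  rw [tsum_mul_left (f := fun k => J.pert (n + k)), ← rho_eq, ← mul_assoc, ← hK] at h
  change ‖J.jostVec ζ n - (1, 0)‖ ≤ _ at h
  have hr : 0 ≤ K * J.rho n := mul_nonneg hK0 (J.rho_nonneg n)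
  have hL : 0 ≤ |L| * (K * J.rho n) := by positivity
  refine ⟨by nlinarith, ?_⟩
  have h1 := (norm_fst_le (J.jostVec ζ n - (1, 0))).trans h
  have h2 := (norm_snd_le (J.jostVec ζ n - (1, 0))).trans h
  simp only [Prod.fst_sub, Prod.snd_sub, sub_zero] at h1 h2
  have h3 : J.jostP ζ n - 1 = ((J.jostVec ζ n).1 - 1) - (1 - ζ ^ 2)⁻¹ * (J.jostVec ζ n).2 := by
    rw [jostP]; ring
  rw [h3]
  refine (norm_sub_le _ _).trans ?_
  rw [norm_mul]
  have := mul_le_mul (hζ.2.2.trans (le_abs_self L)) h2 (norm_nonneg _) (abs_nonneg _)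
  linarith

theorem tendsto_rho : Tendsto J.rho atTop (𝓝 0) := by
  have h := tendsto_sum_nat_add J.pert
  refine h.congr fun n => ?_
  rw [rho_eq]
  simp only [add_comm]

theorem tendsto_jostP (hTr : J.TraceCondition) {ζ : ℂ} (h1 : ‖ζ‖ ≤ 1) (h2 : ζ ^ 2 ≠ 1) :
    Tendsto (J.jostP ζ) atTop (𝓝 1) := by
  obtain ⟨C, _, h⟩ := J.exists_norm_jostP_sub_one_le hTr ‖(1 - ζ ^ 2)⁻¹‖
  have h3 : Tendsto (fun n => C * J.rho n) atTop (𝓝 0) := by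
    simpa using J.tendsto_rho.const_mul C
  exact tendsto_iff_norm_sub_tendsto_zero.2 (squeeze_zero (fun _ => norm_nonneg _)
    (fun n => (h ζ (mem_jostRegion h1 h2) n).2) h3)

theorem tendsto_jostVec (hTr : J.TraceCondition) {ζ : ℂ} (h1 : ‖ζ‖ ≤ 1) (h2 : ζ ^ 2 ≠ 1) :
    Tendsto (J.jostVec ζ) atTop (𝓝 (1, 0)) := by
  obtain ⟨C, _, h⟩ := J.exists_norm_jostP_sub_one_le hTr ‖(1 - ζ ^ 2)⁻¹‖
  have h3 : Tendsto (fun n => C * J.rho n) atTop (𝓝 0) := by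
    simpa using J.tendsto_rho.const_mul C
  exact tendsto_iff_norm_sub_tendsto_zero.2 (squeeze_zero (fun _ => norm_nonneg _)
    (fun n => (h ζ (mem_jostRegion h1 h2) n).1) h3)

/-- The first-order system is turned back into the three-term recurrence: its second component at `n
+ 1` is `Dₙ₊₁` expressed through `pₙ₊₁` and `pₙ₊₂`, and `2 aₙ pₙ = pₙ₊₁ + Dₙ₊₁`. -/
theorem jostP_rec (hTr : J.TraceCondition) {ζ : ℂ} (h1 : ‖ζ‖ ≤ 1) (h2 : ζ ^ 2 ≠ 1) (n : ℕ) :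
    2 * J.a n * J.jostP ζ n = (1 + ζ ^ 2 - 2 * J.b (n + 1) * ζ) * J.jostP ζ (n + 1)
      - 2 * J.a (n + 1) * ζ ^ 2 * J.jostP ζ (n + 2) := by
  have ha : (2 * (J.a n : ℂ)) ≠ 0 := by
    have : (J.a n : ℂ) ≠ 0 := by exact_mod_cast (J.a_pos n).ne'
    simpa using this
  have key : ∀ n, J.jostP ζ n = J.stepP n ζ (J.jostVec ζ (n + 1)) := fun n => by
    rw [jostP, J.jostVec_eq hTr h1 h2 n, jostStep_apply]; ring
  have h3 : (J.jostVec ζ (n + 1)).2 = (ζ ^ 2 - 2 * J.b (n + 1) * ζ) * J.jostP ζ (n + 1)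
      - 2 * J.a (n + 1) * ζ ^ 2 * J.jostP ζ (n + 2) := by
    rw [key (n + 1)]
    conv_lhs => rw [J.jostVec_eq hTr h1 h2 (n + 1), jostStep_apply]
    rfl
  have h4 : 2 * J.a n * J.jostP ζ n = J.jostP ζ (n + 1) + (J.jostVec ζ (n + 1)).2 := by
    rw [key n, stepP, mul_div_cancel₀ _ ha]
    rfl
  rw [h4, h3]; ring

theorem tendsto_a (hTr : J.TraceCondition) : Tendsto J.a atTop (𝓝 (1 / 2)) := by
  have h1 : Tendsto J.pert atTop (𝓝 0) := hTr.tendsto_atTop_zero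
  refine tendsto_iff_norm_sub_tendsto_zero.2 (squeeze_zero (fun _ => norm_nonneg _) (fun n => ?_) h1)
  exact le_add_of_nonneg_right (abs_nonneg _)

theorem tendsto_b (hTr : J.TraceCondition) : Tendsto J.b atTop (𝓝 0) := by
  have h1 : Tendsto J.pert atTop (𝓝 0) := hTr.tendsto_atTop_zero
  refine tendsto_iff_norm_sub_tendsto_zero.2 (squeeze_zero (fun _ => norm_nonneg _) (fun n => ?_) h1)
  rw [sub_zero]
  exact le_add_of_nonneg_left (abs_nonneg _)

/-- A normalized solution tending to `1` is the Jost solution. -/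
theorem eq_jostP (hTr : J.TraceCondition) {ζ : ℂ} (h1 : ‖ζ‖ ≤ 1) (h2 : ζ ^ 2 ≠ 1) {p : ℕ → ℂ}
    (hp : ∀ n, 2 * J.a n * p n = (1 + ζ ^ 2 - 2 * J.b (n + 1) * ζ) * p (n + 1)
      - 2 * J.a (n + 1) * ζ ^ 2 * p (n + 2)) (hlim : Tendsto p atTop (𝓝 1)) : p = J.jostP ζ := by
  obtain ⟨C, hC, hT, he⟩ := J.exists_backward_hyp hTr ‖(1 - ζ ^ 2)⁻¹‖
  set c : ℂ := (1 - ζ ^ 2)⁻¹ with hc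
  -- The given solution is lifted to the coordinates `(Y, D)`. There `D` tends to `ζ² - 2 · (1/2) ·
  -- ζ² = 0`, so the lift has the same limit `(1, 0)` as `jostVec`, and the difference of the two is
  -- a null backward solution.
  set D : ℕ → ℂ := fun n => (ζ ^ 2 - 2 * J.b n * ζ) * p n - 2 * J.a n * ζ ^ 2 * p (n + 1) with hD
  set y : ℕ → ℂ × ℂ := fun n => (p n + c * D n, D n) with hy
  have hDl : Tendsto D atTop (𝓝 0) := by
    have ha : Tendsto (fun n => (J.a n : ℂ)) atTop (𝓝 ((1 / 2 : ℝ) : ℂ)) :=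
      (Complex.continuous_ofReal.tendsto _).comp (J.tendsto_a hTr)
    have hb : Tendsto (fun n => (J.b n : ℂ)) atTop (𝓝 ((0 : ℝ) : ℂ)) :=
      (Complex.continuous_ofReal.tendsto _).comp (J.tendsto_b hTr)
    have h := ((tendsto_const_nhds (x := ζ ^ 2)).sub ((hb.const_mul 2).mul_const ζ)).mul hlim
    have h' := ((ha.const_mul 2).mul_const (ζ ^ 2)).mul (hlim.comp (tendsto_add_atTop_nat 1))
    have h'' := h.sub h'
    have e0 : (0 : ℂ) = (ζ ^ 2 - 2 * ((0 : ℝ) : ℂ) * ζ) * 1 - 2 * ((1 / 2 : ℝ) : ℂ) * ζ ^ 2 * 1 := by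
      push_cast; ring
    rw [e0]
    exact h''
  have hyl : Tendsto y atTop (𝓝 (1, 0)) := by
    have : Tendsto (fun n => p n + c * D n) atTop (𝓝 1) := by
      simpa using hlim.add (hDl.const_mul c)
    exact this.prodMk_nhds hDl
  have hyT : ∀ n, y n = J.jostStep ζ n (y (n + 1)) := by
    intro n
    have ha : (2 * (J.a n : ℂ)) ≠ 0 := by
      have : (J.a n : ℂ) ≠ 0 := by exact_mod_cast (J.a_pos n).ne'
      simpa using this
    have e1 : J.stepP n ζ (y (n + 1)) = p n := by
      rw [stepP, div_eq_iff ha]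
      simp only [hy, hD, ← hc]
      linear_combination -hp n
    have e2 : J.stepD n ζ (y (n + 1)) = D n := by
      rw [stepD, e1]
      simp only [hy, hD, ← hc]
      ring
    rw [jostStep_apply, e1, e2]
  have hz : ∀ n, y n - J.jostVec ζ n = 0 := by
    refine eq_zero_of_backward_of_tendsto_zero (fun n => mul_nonneg hC (J.pert_nonneg n))
      (J.summable_mul_pert hTr C) (hT ζ (mem_jostRegion h1 h2)) (fun n => ?_) ?_
    · rw [map_sub, ← hyT n, ← J.jostVec_eq hTr h1 h2 n]
    · simpa using hyl.sub (J.tendsto_jostVec hTr h1 h2)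
  funext n
  rw [jostP, ← sub_eq_zero.1 (hz n), ← hc]
  simp [hy]

/-- The closed unit disc without `±1`. -/
def puncturedDisc : Set ℂ := {ζ | ‖ζ‖ ≤ 1 ∧ ζ ^ 2 ≠ 1}

/-- Continuity is local, and near `ζ₀` the factor `(1 - ζ²)⁻¹` is bounded, so one of the regions
with uniform estimates is a neighbourhood of `ζ₀` in the punctured disc. Points of the unit circle
are included. -/
theorem continuousOn_jostVec (hTr : J.TraceCondition) (n : ℕ) :
    ContinuousOn (fun ζ => J.jostVec ζ n) puncturedDisc := by
  intro ζ₀ h₀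
  set L := ‖(1 - ζ₀ ^ 2)⁻¹‖ + 1 with hL
  obtain ⟨C, hC, hT, he⟩ := J.exists_backward_hyp hTr L
  have hne : ∀ ζ ∈ jostRegion L, (1 - ζ ^ 2) ≠ 0 := fun ζ hζ => sub_ne_zero.2 (Ne.symm hζ.2.1)
  have hcont : ContinuousOn (fun ζ => J.jostVec ζ n) (jostRegion L) := by
    refine continuousOn_backwardSol (fun n => mul_nonneg hC (J.pert_nonneg n))
      (J.summable_mul_pert hTr C) hT he (fun k g hg => ?_) n
    have hinv : ContinuousOn (fun ζ : ℂ => (1 - ζ ^ 2)⁻¹) (jostRegion L) :=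
      ContinuousOn.inv₀ (by fun_prop) hne
    simp only [jostStep_apply, stepD, stepP]
    fun_prop
  have hmem : ζ₀ ∈ jostRegion L := ⟨h₀.1, h₀.2, by linarith⟩
  refine (hcont ζ₀ hmem).mono_of_mem_nhdsWithin ?_
  have hne0 : (1 - ζ₀ ^ 2) ≠ 0 := hne ζ₀ hmem
  have hca : ContinuousAt (fun ζ : ℂ => ‖(1 - ζ ^ 2)⁻¹‖) ζ₀ :=
    (ContinuousAt.inv₀ (f := fun ζ : ℂ => 1 - ζ ^ 2) (by fun_prop) hne0).norm
  have hev : ∀ᶠ ζ in 𝓝 ζ₀, ‖(1 - ζ ^ 2)⁻¹‖ < L :=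
    hca.eventually (gt_mem_nhds (by linarith))
  filter_upwards [nhdsWithin_le_nhds hev, self_mem_nhdsWithin] with ζ h1 h2
  exact ⟨h2.1, h2.2, h1.le⟩

theorem continuousOn_jostP (hTr : J.TraceCondition) (n : ℕ) :
    ContinuousOn (fun ζ => J.jostP ζ n) puncturedDisc := by
  have hv := J.continuousOn_jostVec hTr n
  have hinv : ContinuousOn (fun ζ : ℂ => (1 - ζ ^ 2)⁻¹) puncturedDisc :=
    ContinuousOn.inv₀ (by fun_prop) fun ζ hζ => sub_ne_zero.2 (Ne.symm hζ.2)
  unfold jostP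
  fun_prop

theorem continuousOn_jostOmega (hTr : J.TraceCondition) :
    ContinuousOn J.jostOmega puncturedDisc := by
  have h0 := J.continuousOn_jostP hTr 0
  have h1 := J.continuousOn_jostP hTr 1
  unfold jostOmega
  fun_prop

/-- The coefficients are real, so the conjugate sequence solves the recurrence at `ζ̄` and tends to
`1`; uniqueness applies. -/
theorem jostP_conj (hTr : J.TraceCondition) {ζ : ℂ} (h1 : ‖ζ‖ ≤ 1) (h2 : ζ ^ 2 ≠ 1) (n : ℕ) :
    J.jostP (starRingEnd ℂ ζ) n = starRingEnd ℂ (J.jostP ζ n) := by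
  have h2' : (starRingEnd ℂ ζ) ^ 2 ≠ 1 := fun h => h2 (by
    have := congrArg (starRingEnd ℂ) h
    simpa using this)
  have h := J.eq_jostP hTr (ζ := starRingEnd ℂ ζ) (by simpa using h1) h2'
    (p := fun n => starRingEnd ℂ (J.jostP ζ n)) (fun n => ?_) ?_
  · exact (congrFun h n).symm
  · have := congrArg (starRingEnd ℂ) (J.jostP_rec hTr h1 h2 n)
    simpa [Complex.conj_ofNat] using this
  · simpa [Function.comp_def] using
      (Complex.continuous_conj.tendsto _).comp (J.tendsto_jostP hTr h1 h2)

theorem jostOmega_conj (hTr : J.TraceCondition) {ζ : ℂ} (h1 : ‖ζ‖ ≤ 1) (h2 : ζ ^ 2 ≠ 1) :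
    J.jostOmega (starRingEnd ℂ ζ) = starRingEnd ℂ (J.jostOmega ζ) := by
  simp [jostOmega, J.jostP_conj hTr h1 h2, Complex.conj_ofNat]

end JacobiMatrix

/-! ### The branch of the square root and `|ζ(z)| < 1`. -/

theorem cpow_half_sq (w : ℂ) : (w ^ (1 / 2 : ℂ)) ^ 2 = w := by
  simp [one_div]

theorem cpow_half_re_nonneg (w : ℂ) : 0 ≤ (w ^ (1 / 2 : ℂ)).re := by
  by_cases hw : w = 0
  · subst hw; simp
  rw [Complex.cpow_def_of_ne_zero hw, Complex.exp_re]
  have h1 : (Complex.log w * (1 / 2)).im = w.arg / 2 := by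
    have : Complex.log w * (1 / 2) = ((1 / 2 : ℝ) : ℂ) * Complex.log w := by push_cast; ring
    rw [this, Complex.im_ofReal_mul, Complex.log_im]; ring
  rw [h1]
  refine mul_nonneg (Real.exp_pos _).le (Real.cos_nonneg_of_mem_Icc ⟨?_, ?_⟩)
  · linarith [Complex.neg_pi_lt_arg w]
  · linarith [Complex.arg_le_pi w]

theorem cpow_half_im_nonneg {w : ℂ} (h : 0 ≤ w.im) : 0 ≤ (w ^ (1 / 2 : ℂ)).im := by
  by_cases hw : w = 0
  · subst hw; simp
  rw [Complex.cpow_def_of_ne_zero hw, Complex.exp_im]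
  have h1 : (Complex.log w * (1 / 2)).im = w.arg / 2 := by
    have : Complex.log w * (1 / 2) = ((1 / 2 : ℝ) : ℂ) * Complex.log w := by push_cast; ring
    rw [this, Complex.im_ofReal_mul, Complex.log_im]; ring
  rw [h1]
  refine mul_nonneg (Real.exp_pos _).le (Real.sin_nonneg_of_nonneg_of_le_pi ?_ ?_)
  · linarith [Complex.arg_nonneg_iff.2 h]
  · linarith [Complex.arg_le_pi w, Real.pi_pos]

theorem sqrtBranch_sq (z : ℂ) : sqrtBranch z ^ 2 = z ^ 2 - 1 := by
  rw [sqrtBranch, mul_pow, cpow_half_sq, cpow_half_sq]; ring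

theorem re_im_of_sq {A w : ℂ} (h : A ^ 2 = w) :
    A.re * A.re - A.im * A.im = w.re ∧ 2 * (A.re * A.im) = w.im := by
  subst h
  constructor
  · simp [pow_two]
  · simp [pow_two]; ring

/-- Off the real axis both roots have positive real part and imaginary parts of the sign of `Im z`.
On the real axis outside `[-1,1]` they are both real or both imaginary. Positivity of this inner
product says that `√(z+1) - √(z-1)` is shorter than `√(z+1) + √(z-1)`. -/
theorem cpow_half_inner_pos {z : ℂ} (hz : z ∈ cutPlane) :
    0 < ((z - 1) ^ (1 / 2 : ℂ)).re * ((z + 1) ^ (1 / 2 : ℂ)).re +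
      ((z - 1) ^ (1 / 2 : ℂ)).im * ((z + 1) ^ (1 / 2 : ℂ)).im := by
  obtain ⟨h1, h2⟩ := re_im_of_sq (cpow_half_sq (z - 1))
  obtain ⟨h3, h4⟩ := re_im_of_sq (cpow_half_sq (z + 1))
  have hA := cpow_half_re_nonneg (z - 1)
  have hB := cpow_half_re_nonneg (z + 1)
  have hA' := cpow_half_im_nonneg (w := z - 1)
  have hB' := cpow_half_im_nonneg (w := z + 1)
  set A := (z - 1) ^ (1 / 2 : ℂ)
  set B := (z + 1) ^ (1 / 2 : ℂ)
  simp only [Complex.sub_re, Complex.sub_im, Complex.add_re, Complex.add_im, Complex.one_re,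
    Complex.one_im, sub_zero, add_zero] at h1 h2 h3 h4 hA' hB'
  by_cases hzi : z.im = 0
  · have hzr : z.re < -1 ∨ 1 < z.re := by
      by_contra hcon
      push Not at hcon
      exact hz ⟨z.re, ⟨hcon.1, hcon.2⟩, Complex.ext (by simp) (by simp [hzi])⟩
    rw [hzi] at h2 h4 hA' hB'
    have hA'' := hA' le_rfl
    have hB'' := hB' le_rfl
    have h2' : A.re * A.im = 0 := by linarith
    have h4' : B.re * B.im = 0 := by linarith
    rcases hzr with h | h
    · have a0 : A.re = 0 := by
        rcases mul_eq_zero.1 h2' with h5 | h5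
        · exact h5
        · rw [h5] at h1; nlinarith
      have b0 : B.re = 0 := by
        rcases mul_eq_zero.1 h4' with h5 | h5
        · exact h5
        · rw [h5] at h3; nlinarith
      rw [a0] at h1 ⊢; rw [b0] at h3 ⊢
      have a1 : 0 < A.im := lt_of_le_of_ne hA'' fun h6 => by rw [← h6] at h1; linarith
      have b1 : 0 < B.im := lt_of_le_of_ne hB'' fun h6 => by rw [← h6] at h3; linarith
      nlinarith [mul_pos a1 b1]
    · have a0 : A.im = 0 := by
        rcases mul_eq_zero.1 h2' with h5 | h5
        · rw [h5] at h1; nlinarith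
        · exact h5
      have b0 : B.im = 0 := by
        rcases mul_eq_zero.1 h4' with h5 | h5
        · rw [h5] at h3; nlinarith
        · exact h5
      rw [a0] at h1 ⊢; rw [b0] at h3 ⊢
      have a1 : 0 < A.re := lt_of_le_of_ne hA fun h6 => by rw [← h6] at h1; linarith
      have b1 : 0 < B.re := lt_of_le_of_ne hB fun h6 => by rw [← h6] at h3; linarith
      nlinarith [mul_pos a1 b1]
  · have a1 : 0 < A.re := lt_of_le_of_ne hA fun h6 => hzi (by rw [← h2, ← h6]; ring)
    have b1 : 0 < B.re := lt_of_le_of_ne hB fun h6 => hzi (by rw [← h4, ← h6]; ring)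
    have hp : 0 < (A.re * A.im) * (B.re * B.im) := by
      have e1 : A.re * A.im = z.im / 2 := by linarith
      have e2 : B.re * B.im = z.im / 2 := by linarith
      rw [e1, e2]
      exact mul_self_pos.2 (div_ne_zero hzi two_ne_zero)
    have h5 : 0 < A.im * B.im := by
      have e : (A.re * A.im) * (B.re * B.im) = (A.re * B.re) * (A.im * B.im) := by ring
      rw [e] at hp
      exact (mul_pos_iff_of_pos_left (mul_pos a1 b1)).1 hp
    nlinarith [mul_pos a1 b1]

theorem sqrtBranch_im_pos {z : ℂ} (hz : 0 < z.im) : 0 < (sqrtBranch z).im := by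
  obtain ⟨-, h2⟩ := re_im_of_sq (cpow_half_sq (z - 1))
  obtain ⟨-, h4⟩ := re_im_of_sq (cpow_half_sq (z + 1))
  have hA := cpow_half_re_nonneg (z - 1)
  have hB := cpow_half_re_nonneg (z + 1)
  rw [sqrtBranch, Complex.mul_im]
  set A := (z - 1) ^ (1 / 2 : ℂ)
  set B := (z + 1) ^ (1 / 2 : ℂ)
  simp only [Complex.sub_im, Complex.add_im, Complex.one_im, sub_zero, add_zero] at h2 h4
  have a1 : 0 < A.re := lt_of_le_of_ne hA fun h6 => hz.ne' (by rw [← h2, ← h6]; ring)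
  have b1 : 0 < B.re := lt_of_le_of_ne hB fun h6 => hz.ne' (by rw [← h4, ← h6]; ring)
  have a2 : 0 < A.im := by
    by_contra h; push Not at h; nlinarith
  have b2 : 0 < B.im := by
    by_contra h; push Not at h; nlinarith
  positivity

theorem sqrtBranch_im_neg {z : ℂ} (hz : z.im < 0) : (sqrtBranch z).im < 0 := by
  obtain ⟨-, h2⟩ := re_im_of_sq (cpow_half_sq (z - 1))
  obtain ⟨-, h4⟩ := re_im_of_sq (cpow_half_sq (z + 1))
  have hA := cpow_half_re_nonneg (z - 1)
  have hB := cpow_half_re_nonneg (z + 1)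
  rw [sqrtBranch, Complex.mul_im]
  set A := (z - 1) ^ (1 / 2 : ℂ)
  set B := (z + 1) ^ (1 / 2 : ℂ)
  simp only [Complex.sub_im, Complex.add_im, Complex.one_im, sub_zero, add_zero] at h2 h4
  have a1 : 0 < A.re := lt_of_le_of_ne hA fun h6 => hz.ne (by rw [← h2, ← h6]; ring)
  have b1 : 0 < B.re := lt_of_le_of_ne hB fun h6 => hz.ne (by rw [← h4, ← h6]; ring)
  have a2 : A.im < 0 := by
    by_contra h; push Not at h; nlinarith
  have b2 : B.im < 0 := by
    by_contra h; push Not at h; nlinarith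
  nlinarith

theorem zetaMap_mul (z : ℂ) : zetaMap z * (z + sqrtBranch z) = 1 := by
  rw [zetaMap]
  linear_combination -sqrtBranch_sq z

theorem zetaMap_ne_zero (z : ℂ) : zetaMap z ≠ 0 := left_ne_zero_of_mul_eq_one (zetaMap_mul z)

theorem two_mul_zetaMap (z : ℂ) : 2 * z * zetaMap z = 1 + zetaMap z ^ 2 := by
  have := zetaMap_mul z
  rw [zetaMap] at *
  linear_combination this

/-- `ζ` and `ζ⁻¹ = z + √(z² - 1)` are half the squares of `√(z+1) ∓ √(z-1)`, so `|ζ| < |ζ⁻¹|`. -/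
theorem norm_zetaMap_lt_one {z : ℂ} (hz : z ∈ cutPlane) : ‖zetaMap z‖ < 1 := by
  have hkey := cpow_half_inner_pos hz
  have hA := cpow_half_sq (z - 1)
  have hB := cpow_half_sq (z + 1)
  have hm := zetaMap_mul z
  have e1 : zetaMap z = ((z + 1) ^ (1 / 2 : ℂ) - (z - 1) ^ (1 / 2 : ℂ)) ^ 2 / 2 := by
    rw [zetaMap, sqrtBranch]; linear_combination (-1 / 2 : ℂ) * hA - (1 / 2 : ℂ) * hB
  have e2 : z + sqrtBranch z = ((z + 1) ^ (1 / 2 : ℂ) + (z - 1) ^ (1 / 2 : ℂ)) ^ 2 / 2 := by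
    rw [sqrtBranch]; linear_combination (-1 / 2 : ℂ) * hA - (1 / 2 : ℂ) * hB
  set A := (z - 1) ^ (1 / 2 : ℂ)
  set B := (z + 1) ^ (1 / 2 : ℂ)
  have hlt : ‖zetaMap z‖ < ‖z + sqrtBranch z‖ := by
    rw [e1, e2, norm_div, norm_div, norm_pow, norm_pow, Complex.sq_norm, Complex.sq_norm,
      Complex.normSq_apply, Complex.normSq_apply]
    simp only [Complex.sub_re, Complex.sub_im, Complex.add_re, Complex.add_im]
    norm_num
    nlinarith
  have hn : ‖zetaMap z‖ * ‖z + sqrtBranch z‖ = 1 := by rw [← norm_mul, hm, norm_one]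
  nlinarith [norm_nonneg (zetaMap z)]

theorem zetaMap_mem_puncturedDisc {z : ℂ} (hz : z ∈ cutPlane) :
    zetaMap z ∈ JacobiMatrix.puncturedDisc := by
  have h := norm_zetaMap_lt_one hz
  refine ⟨h.le, fun h1 => ?_⟩
  have h2 := congrArg norm h1
  rw [norm_pow, norm_one] at h2
  nlinarith [norm_nonneg (zetaMap z)]

/-! ### Boundary values of `ζ` on the two sides of the cut. -/

/-- The boundary values `x - i s √(1 - x²)` of `ζ`. -/
noncomputable def zetaBd (s x : ℝ) : ℂ := x - Complex.I * s * (√(1 - x ^ 2) : ℝ)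

/-- Squaring loses the sign; the lower bound on `w + v` keeps `w` away from `-v`, so in `w² - v² =
(w - v)(w + v)` the first factor must vanish in the limit. -/
theorem tendsto_of_sq_eq {w : ℂ → ℂ} {v : ℂ} {l : Filter ℂ} (hv : v ≠ 0)
    (hw : Tendsto (fun z => w z ^ 2) l (𝓝 (v ^ 2))) (hb : ∀ᶠ z in l, ‖v‖ ≤ ‖w z + v‖) :
    Tendsto w l (𝓝 v) := by
  have hv' : 0 < ‖v‖ := norm_pos_iff.2 hv
  refine tendsto_iff_norm_sub_tendsto_zero.2 ?_
  have h0 : Tendsto (fun z => ‖w z ^ 2 - v ^ 2‖ / ‖v‖) l (𝓝 0) := by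
    simpa using (tendsto_iff_norm_sub_tendsto_zero.1 hw).div_const ‖v‖
  refine squeeze_zero' (Eventually.of_forall fun _ => norm_nonneg _) ?_ h0
  filter_upwards [hb] with z hz
  rw [le_div_iff₀ hv']
  have : w z ^ 2 - v ^ 2 = (w z - v) * (w z + v) := by ring
  rw [this, norm_mul]
  exact mul_le_mul_of_nonneg_left hz (norm_nonneg _)

theorem sqrt_pos_of_mem {x : ℝ} (hx : x ∈ Set.Ioo (-1 : ℝ) 1) : 0 < √(1 - x ^ 2) := by
  have h1 := hx.1
  have h2 := hx.2
  exact Real.sqrt_pos.2 (by nlinarith)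

theorem sq_sqrt_of_mem {x : ℝ} (hx : x ∈ Set.Ioo (-1 : ℝ) 1) : √(1 - x ^ 2) ^ 2 = 1 - x ^ 2 := by
  have h1 := hx.1
  have h2 := hx.2
  exact Real.sq_sqrt (by nlinarith)

/-- The sign `s` treats both sides of the cut at once. The imaginary part of the root has the sign
of `Im z`, which selects the limit `i s √(1 - x²)`. -/
theorem tendsto_zetaMap {s x : ℝ} (hs : s = 1 ∨ s = -1) (hx : x ∈ Set.Ioo (-1 : ℝ) 1) :
    Tendsto zetaMap (𝓝[{z : ℂ | 0 < s * z.im}] (x : ℂ)) (𝓝 (zetaBd s x)) := by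
  have hv := sqrt_pos_of_mem hx
  have hv2 := sq_sqrt_of_mem hx
  set v := √(1 - x ^ 2)
  have hs2 : s ^ 2 = 1 := by rcases hs with h | h <;> simp [h]
  have hid : Tendsto (fun z : ℂ => z) (𝓝[{z : ℂ | 0 < s * z.im}] (x : ℂ)) (𝓝 (x : ℂ)) :=
    tendsto_id.mono_left nhdsWithin_le_nhds
  refine hid.sub (tendsto_of_sq_eq ?_ ?_ ?_)
  · have : (s : ℂ) ≠ 0 := by rcases hs with h | h <;> simp [h]
    exact mul_ne_zero (mul_ne_zero Complex.I_ne_zero this) (by exact_mod_cast hv.ne')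
  · simp only [sqrtBranch_sq]
    have e : (Complex.I * s * (v : ℝ)) ^ 2 = (x : ℂ) ^ 2 - 1 := by
      have e1 : ((v : ℝ) : ℂ) ^ 2 = 1 - (x : ℂ) ^ 2 := by exact_mod_cast hv2
      have e2 : (s : ℂ) ^ 2 = 1 := by exact_mod_cast hs2
      rw [mul_pow, mul_pow, Complex.I_sq, e1, e2]; ring
    rw [e]
    exact (hid.pow 2).sub_const 1
  · filter_upwards [self_mem_nhdsWithin] with z hz
    have hn : ‖Complex.I * s * (v : ℝ)‖ = v := by
      rw [norm_mul, norm_mul, Complex.norm_I, Complex.norm_real, Complex.norm_real,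
        Real.norm_of_nonneg hv.le]
      rcases hs with h | h <;> simp [h]
    rw [hn]
    refine le_trans ?_ (Complex.abs_im_le_norm _)
    have him : (sqrtBranch z + Complex.I * s * (v : ℝ)).im = (sqrtBranch z).im + s * v := by
      simp
    rw [him]
    rcases hs with h | h
    · subst h
      have hz' : 0 < z.im := by simpa using hz
      have := sqrtBranch_im_pos hz'
      rw [abs_of_nonneg (by linarith)]
      linarith
    · subst h
      have hz' : z.im < 0 := by simpa using hz
      have := sqrtBranch_im_neg hz'
      rw [abs_of_nonpos (by linarith)]
      linarith

theorem zetaBd_normSq {s x : ℝ} (hs : s = 1 ∨ s = -1) (hx : x ∈ Set.Ioo (-1 : ℝ) 1) :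
    zetaBd s x * starRingEnd ℂ (zetaBd s x) = 1 := by
  have hv2 := sq_sqrt_of_mem hx
  have hs2 : s ^ 2 = 1 := by rcases hs with h | h <;> simp [h]
  have e1 : ((√(1 - x ^ 2) : ℝ) : ℂ) ^ 2 = 1 - (x : ℂ) ^ 2 := by exact_mod_cast hv2
  have e2 : (s : ℂ) ^ 2 = 1 := by exact_mod_cast hs2
  simp only [zetaBd, map_sub, map_mul, Complex.conj_ofReal, Complex.conj_I]
  linear_combination (-(s : ℂ) ^ 2 * ((√(1 - x ^ 2) : ℝ) : ℂ) ^ 2) * Complex.I_sq + e1 +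
    ((√(1 - x ^ 2) : ℝ) : ℂ) ^ 2 * e2

theorem norm_zetaBd {s x : ℝ} (hs : s = 1 ∨ s = -1) (hx : x ∈ Set.Ioo (-1 : ℝ) 1) :
    ‖zetaBd s x‖ = 1 := by
  have h := zetaBd_normSq hs hx
  have h2 := congrArg norm h
  rw [norm_mul, RCLike.norm_conj, norm_one] at h2
  nlinarith [norm_nonneg (zetaBd s x)]

theorem conj_zetaBd (s x : ℝ) : starRingEnd ℂ (zetaBd s x) = zetaBd (-s) x := by
  simp only [zetaBd, map_sub, map_mul, Complex.conj_ofReal, Complex.conj_I]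
  push_cast; ring

theorem zetaBd_sub_conj (s x : ℝ) : zetaBd s x - starRingEnd ℂ (zetaBd s x) =
    -(2 * Complex.I * s * (√(1 - x ^ 2) : ℝ)) := by
  simp only [zetaBd, map_sub, map_mul, Complex.conj_ofReal, Complex.conj_I]
  ring

theorem zetaBd_add_conj (s x : ℝ) : zetaBd s x + starRingEnd ℂ (zetaBd s x) = 2 * x := by
  simp only [zetaBd, map_sub, map_mul, Complex.conj_ofReal, Complex.conj_I]
  ring

theorem zetaBd_sub_conj_ne_zero {s x : ℝ} (hs : s = 1 ∨ s = -1) (hx : x ∈ Set.Ioo (-1 : ℝ) 1) :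
    zetaBd s x - starRingEnd ℂ (zetaBd s x) ≠ 0 := by
  rw [zetaBd_sub_conj]
  have h1 : ((√(1 - x ^ 2) : ℝ) : ℂ) ≠ 0 := by exact_mod_cast (sqrt_pos_of_mem hx).ne'
  have h2 : (s : ℂ) ≠ 0 := by rcases hs with h | h <;> simp [h]
  simp [h2, h1]

theorem one_sub_zetaBd_sq {s x : ℝ} (hs : s = 1 ∨ s = -1) (hx : x ∈ Set.Ioo (-1 : ℝ) 1) :
    1 - zetaBd s x ^ 2 = -(zetaBd s x * (zetaBd s x - starRingEnd ℂ (zetaBd s x))) := by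
  linear_combination -zetaBd_normSq hs hx

theorem zetaBd_mem_puncturedDisc {s x : ℝ} (hs : s = 1 ∨ s = -1) (hx : x ∈ Set.Ioo (-1 : ℝ) 1) :
    zetaBd s x ∈ JacobiMatrix.puncturedDisc := by
  refine ⟨(norm_zetaBd hs hx).le, fun h => ?_⟩
  have h1 := one_sub_zetaBd_sq hs hx
  have h2 : zetaBd s x ≠ 0 := norm_pos_iff.1 (by rw [norm_zetaBd hs hx]; norm_num)
  rw [h, sub_self, eq_comm, neg_eq_zero] at h1
  exact mul_ne_zero h2 (zetaBd_sub_conj_ne_zero hs hx) h1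

theorem mem_cutPlane_of_im_ne_zero {z : ℂ} (hz : z.im ≠ 0) : z ∈ cutPlane := by
  rintro ⟨x, -, rfl⟩
  simp at hz

/-! ### The Jost function on the cut, Wronskians, and the polynomials in terms of Jost solutions. -/

namespace JacobiMatrix

variable (J : JacobiMatrix)

/-- The Jost solution expressed through the normalized one. -/
noncomputable def jostSeq (ζ : ℂ) : ℕ → ℂ
  -- Slot `0` holds the term of index `-1`, and `Ω = ω/ω₀ = ζ f₋₁`.
  | 0 => J.jostOmega ζ / ζ
  | n + 1 => ζ ^ n * J.jostP ζ n

theorem isJostSolution_jostSeq (hTr : J.TraceCondition) {z : ℂ} (hz : z ∈ cutPlane) :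
    J.IsJostSolution z (J.jostSeq (zetaMap z)) := by
  have hd := zetaMap_mem_puncturedDisc hz
  have h0 := zetaMap_ne_zero z
  have h2 := two_mul_zetaMap z
  set ζ := zetaMap z with hζ
  refine ⟨?_, fun n => ?_, ?_⟩
  · have e : J.jostSeq ζ 0 * ζ = J.jostOmega ζ := by
      simp only [jostSeq]; field_simp
    rw [jostOmega] at e
    refine mul_right_cancel₀ h0 ?_
    simp only [jostSeq, pow_zero, pow_one] at e ⊢
    linear_combination (1 / 2 : ℂ) * e - (1 / 2 : ℂ) * (J.jostP ζ 0) * h2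
  · have e := J.jostP_rec hTr hd.1 hd.2 n
    simp only [jostSeq]
    refine mul_right_cancel₀ h0 ?_
    rw [pow_succ ζ (n + 1), pow_succ ζ n]
    linear_combination (ζ ^ n * ζ / 2) * e - (1 / 2 : ℂ) * (ζ ^ n * ζ * J.jostP ζ (n + 1)) * h2
  · obtain ⟨C, hC, h⟩ := J.exists_norm_jostP_sub_one_le hTr ‖(1 - ζ ^ 2)⁻¹‖
    refine Asymptotics.IsBigO.of_bound C (Eventually.of_forall fun n => ?_)
    have e : J.jostSeq ζ (n + 1) / ζ ^ n = J.jostP ζ n := by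
      simp only [jostSeq]
      rw [mul_div_cancel_left₀ _ (pow_ne_zero n h0)]
    rw [← hζ, e, Real.norm_of_nonneg (J.rho_nonneg n)]
    exact (h ζ (mem_jostRegion hd.1 hd.2) n).2

/-- Since `ρₙ → 0`, the asymptotic condition forces `ζ⁻ⁿ fₙ → 1`, which fixes all terms of index `≥
0`; the equation at `n = 0` then determines `f₋₁`. -/
theorem eq_jostSeq (hTr : J.TraceCondition) {z : ℂ} (hz : z ∈ cutPlane) {f : ℕ → ℂ}
    (hf : J.IsJostSolution z f) : f = J.jostSeq (zetaMap z) := by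
  have hd := zetaMap_mem_puncturedDisc hz
  have h0 := zetaMap_ne_zero z
  have h2 := two_mul_zetaMap z
  obtain ⟨hf0, hf1, hf2⟩ := hf
  set ζ := zetaMap z with hζ
  have hlim : Tendsto (fun n => f (n + 1) / ζ ^ n) atTop (𝓝 1) := by
    have := (hf2.trans_tendsto J.tendsto_rho).add_const 1
    simpa using this
  have hp : ∀ n, f (n + 1) = ζ ^ n * (f (n + 1) / ζ ^ n) := fun n => by
    rw [mul_div_cancel₀ _ (pow_ne_zero n h0)]
  have hrec := J.eq_jostP hTr hd.1 hd.2 (p := fun n => f (n + 1) / ζ ^ n) (fun n => ?_) hlim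
  · have hsucc : ∀ n, f (n + 1) = J.jostSeq ζ (n + 1) := fun n => by
      rw [hp n, jostSeq, ← hrec]
    funext n
    cases n with
    | zero =>
      have e := (J.isJostSolution_jostSeq hTr hz).1
      rw [← hζ, ← hsucc 0, ← hsucc 1] at e
      have : (1 / 2 : ℂ) * f 0 = 1 / 2 * J.jostSeq ζ 0 := by linear_combination hf0 - e
      simpa using this
    | succ n => exact hsucc n
  · have e := hf1 n
    rw [hp n, hp (n + 1), hp (n + 2)] at e
    set p : ℕ → ℂ := fun n => f (n + 1) / ζ ^ n
    change (J.a n : ℂ) * (ζ ^ n * p n) + (J.b (n + 1) : ℂ) * (ζ ^ (n + 1) * p (n + 1))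
      + (J.a (n + 1) : ℂ) * (ζ ^ (n + 2) * p (n + 2)) = z * (ζ ^ (n + 1) * p (n + 1)) at e
    change 2 * J.a n * p n = (1 + ζ ^ 2 - 2 * J.b (n + 1) * ζ) * p (n + 1)
      - 2 * J.a (n + 1) * ζ ^ 2 * p (n + 2)
    refine mul_left_cancel₀ (pow_ne_zero n h0) ?_
    rw [pow_succ ζ (n + 1), pow_succ ζ n] at e
    linear_combination 2 * e + (ζ ^ n * p (n + 1)) * h2

theorem existsUnique_jostSolution (hTr : J.TraceCondition) {z : ℂ} (hz : z ∈ cutPlane) :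
    ∃! f : ℕ → ℂ, J.IsJostSolution z f :=
  ⟨_, J.isJostSolution_jostSeq hTr hz, fun _ hf => J.eq_jostSeq hTr hz hf⟩

theorem jostFunction_eq (hTr : J.TraceCondition) {z : ℂ} (hz : z ∈ cutPlane) :
    J.jostFunction z = J.jostOmega (zetaMap z) := by
  have hex : ∃ f, J.IsJostSolution z f := ⟨_, J.isJostSolution_jostSeq hTr hz⟩
  have h : J.jostSolution z = J.jostSeq (zetaMap z) := by
    rw [jostSolution, dif_pos hex]
    exact J.eq_jostSeq hTr hz hex.choose_spec
  have h0 := zetaMap_ne_zero z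
  rw [jostFunction, omega, h, jostSeq]
  field_simp
  ring

theorem tendsto_jostFunction (hTr : J.TraceCondition) {s x : ℝ} (hs : s = 1 ∨ s = -1)
    (hx : x ∈ Set.Ioo (-1 : ℝ) 1) : Tendsto J.jostFunction (𝓝[{z : ℂ | 0 < s * z.im}] (x : ℂ))
      (𝓝 (J.jostOmega (zetaBd s x))) := by
  have hmem : ∀ᶠ z in 𝓝[{z : ℂ | 0 < s * z.im}] (x : ℂ), z ∈ cutPlane := by
    filter_upwards [self_mem_nhdsWithin] with z hz
    exact mem_cutPlane_of_im_ne_zero fun h => by simp [h] at hz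
  have h1 : Tendsto zetaMap (𝓝[{z : ℂ | 0 < s * z.im}] (x : ℂ))
      (𝓝[puncturedDisc] (zetaBd s x)) :=
    tendsto_nhdsWithin_iff.2 ⟨tendsto_zetaMap hs hx,
      hmem.mono fun z hz => zetaMap_mem_puncturedDisc hz⟩
  have h2 := (J.continuousOn_jostOmega hTr _ (zetaBd_mem_puncturedDisc hs hx)).tendsto.comp h1
  refine h2.congr' (hmem.mono fun z hz => ?_)
  exact (J.jostFunction_eq hTr hz).symm

theorem halfPlane_neBot {s : ℝ} (hs : s = 1 ∨ s = -1) (x : ℝ) :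
    (𝓝[{z : ℂ | 0 < s * z.im}] (x : ℂ)).NeBot := by
  rw [← mem_closure_iff_nhdsWithin_neBot, Metric.mem_closure_iff]
  intro ε hε
  refine ⟨x + Complex.I * (s * (ε / 2) : ℝ), ?_, ?_⟩
  · rcases hs with h | h <;> simp [h, hε]
  · rw [dist_eq_norm, sub_add_cancel_left, norm_neg, norm_mul, Complex.norm_I, one_mul,
      Complex.norm_real, norm_mul, Real.norm_eq_abs, Real.norm_of_nonneg (by linarith)]
    rcases hs with h | h <;> simp [h, hε]

theorem setOf_one_mul_im : {z : ℂ | 0 < (1 : ℝ) * z.im} = {z : ℂ | 0 < z.im} := by simp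

theorem setOf_neg_one_mul_im : {z : ℂ | 0 < (-1 : ℝ) * z.im} = {z : ℂ | z.im < 0} := by simp

theorem jostPlus_eq (hTr : J.TraceCondition) {x : ℝ} (hx : x ∈ Set.Ioo (-1 : ℝ) 1) :
    J.jostPlus x = J.jostOmega (zetaBd 1 x) := by
  have h := J.tendsto_jostFunction hTr (Or.inl rfl) hx
  have := halfPlane_neBot (Or.inl rfl) x
  rw [setOf_one_mul_im] at h this
  exact h.limUnder_eq

theorem jostMinus_eq (hTr : J.TraceCondition) {x : ℝ} (hx : x ∈ Set.Ioo (-1 : ℝ) 1) :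
    J.jostMinus x = J.jostOmega (zetaBd (-1) x) := by
  have h := J.tendsto_jostFunction hTr (Or.inr rfl) hx
  have := halfPlane_neBot (Or.inr rfl) x
  rw [setOf_neg_one_mul_im] at h this
  exact h.limUnder_eq

/-- The Jost solution of unit modulus `ζ`, in terms of `ζ ^ n p n`. -/
theorem jost_wronskian (hTr : J.TraceCondition) {s x : ℝ} (hs : s = 1 ∨ s = -1)
    (hx : x ∈ Set.Ioo (-1 : ℝ) 1) (n : ℕ) :
    2 * J.a n * (zetaBd s x * J.jostP (zetaBd s x) (n + 1) * starRingEnd ℂ (J.jostP (zetaBd s x) n)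
      - starRingEnd ℂ (zetaBd s x) * starRingEnd ℂ (J.jostP (zetaBd s x) (n + 1))
        * J.jostP (zetaBd s x) n) = zetaBd s x - starRingEnd ℂ (zetaBd s x) := by
  have hd := zetaBd_mem_puncturedDisc hs hx
  have hn := zetaBd_normSq hs hx
  set ζ := zetaBd s x
  set p := J.jostP ζ
  set w := starRingEnd ℂ ζ
  set W : ℕ → ℂ := fun n => 2 * J.a n * (ζ * p (n + 1) * starRingEnd ℂ (p n)
      - w * starRingEnd ℂ (p (n + 1)) * p n) with hW
  -- `W` is twice the Wronskian of `ζⁿ pₙ` and its conjugate. On the unit circle both solve the same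
  -- real equation, so `W` is constant, and its value is read off at infinity.
  have hconst : ∀ n, W n = W (n + 1) := by
    intro n
    have e1 := J.jostP_rec hTr hd.1 hd.2 n
    have e2 := congrArg (starRingEnd ℂ) e1
    simp only [map_mul, map_sub, map_add, map_one, map_pow, Complex.conj_ofNat,
      Complex.conj_ofReal] at e2
    change 2 * J.a n * p n = (1 + ζ ^ 2 - 2 * J.b (n + 1) * ζ) * p (n + 1)
      - 2 * J.a (n + 1) * ζ ^ 2 * p (n + 2) at e1
    change 2 * J.a n * starRingEnd ℂ (p n) = (1 + w ^ 2 - 2 * J.b (n + 1) * w)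
      * starRingEnd ℂ (p (n + 1)) - 2 * J.a (n + 1) * w ^ 2 * starRingEnd ℂ (p (n + 2)) at e2
    simp only [hW]
    set q := starRingEnd ℂ (p (n + 1))
    set r := starRingEnd ℂ (p (n + 2))
    set α := (J.a (n + 1) : ℂ)
    linear_combination (ζ * p (n + 1)) * e2 - (w * q) * e1 +
      (p (n + 1) * q * (w - ζ) + 2 * α * ζ * p (n + 2) * q - 2 * α * w * r * p (n + 1)) * hn
  have hlim : Tendsto W atTop (𝓝 (ζ - w)) := by
    have hp := J.tendsto_jostP hTr hd.1 hd.2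
    have hp1 := hp.comp (tendsto_add_atTop_nat 1)
    have hc : Tendsto (fun n => starRingEnd ℂ (p n)) atTop (𝓝 (starRingEnd ℂ 1)) :=
      (Complex.continuous_conj.tendsto _).comp hp
    have hc1 := hc.comp (tendsto_add_atTop_nat 1)
    have ha : Tendsto (fun n => (J.a n : ℂ)) atTop (𝓝 ((1 / 2 : ℝ) : ℂ)) :=
      (Complex.continuous_ofReal.tendsto _).comp (J.tendsto_a hTr)
    have h := (ha.const_mul 2).mul
      (((hp1.const_mul ζ).mul hc).sub ((hc1.const_mul w).mul hp))
    have e : ζ - w = 2 * ((1 / 2 : ℝ) : ℂ) * (ζ * 1 * starRingEnd ℂ 1 - w * starRingEnd ℂ 1 * 1) := by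
      simp
    rw [e]
    exact h
  have hall : ∀ k, W (n + k) = W n := by
    intro k
    induction k with
    | zero => rfl
    | succ k ih => rw [← ih]; exact (hconst (n + k)).symm
  have hlim2 : Tendsto (fun k => W (n + k)) atTop (𝓝 (ζ - w)) := by
    simpa [Function.comp_def, add_comm] using hlim.comp (tendsto_add_atTop_nat n)
  exact tendsto_nhds_unique (tendsto_const_nhds.congr fun k => (hall k).symm) hlim2

/-- The same Wronskian moved to the step from `-1` to `0`, where `ζ f₋₁ = Ω`. It cannot hold with `Ω
= 0`, because `ζ - ζ̄ ≠ 0` on the open interval. -/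
theorem jost_wronskian_zero (hTr : J.TraceCondition) {s x : ℝ} (hs : s = 1 ∨ s = -1)
    (hx : x ∈ Set.Ioo (-1 : ℝ) 1) :
    zetaBd s x * starRingEnd ℂ (J.jostOmega (zetaBd s x)) * J.jostP (zetaBd s x) 0
      - starRingEnd ℂ (zetaBd s x) * J.jostOmega (zetaBd s x)
        * starRingEnd ℂ (J.jostP (zetaBd s x) 0) = zetaBd s x - starRingEnd ℂ (zetaBd s x) := by
  have hn := zetaBd_normSq hs hx
  rw [← J.jost_wronskian hTr hs hx 0]
  simp only [jostOmega, map_mul, map_sub, map_add, map_one, map_pow, Complex.conj_ofNat,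
      Complex.conj_ofReal]
  set ζ := zetaBd s x
  set w := starRingEnd ℂ ζ
  set q := starRingEnd ℂ (J.jostP ζ 0)
  set r := starRingEnd ℂ (J.jostP ζ (0 + 1))
  simp only [zero_add] at *
  linear_combination (J.jostP ζ 0 * q * (w - ζ) + 2 * J.a 0 * ζ * J.jostP ζ 1 * q
    - 2 * J.a 0 * w * r * J.jostP ζ 0) * hn

theorem jostOmega_ne_zero (hTr : J.TraceCondition) {s x : ℝ} (hs : s = 1 ∨ s = -1)
    (hx : x ∈ Set.Ioo (-1 : ℝ) 1) : J.jostOmega (zetaBd s x) ≠ 0 := by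
  intro h
  have h1 := J.jost_wronskian_zero hTr hs hx
  rw [h] at h1
  simp only [map_zero, mul_zero, zero_mul, sub_zero] at h1
  exact zetaBd_sub_conj_ne_zero hs hx h1.symm

/-- A sequence solving the Jacobi equation with the initial condition at `-1` is a multiple of
`P n`. -/
theorem eq_P_mul {x : ℝ} {u : ℕ → ℂ} (h0 : (J.b 0 : ℂ) * u 0 + J.a 0 * u 1 = x * u 0)
    (h1 : ∀ n, (J.a n : ℂ) * u n + J.b (n + 1) * u (n + 1) + J.a (n + 1) * u (n + 2)
      = x * u (n + 1)) (n : ℕ) : u n = J.P n x * u 0 := by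
  have ha : ∀ n, (J.a n : ℂ) ≠ 0 := fun n => by exact_mod_cast (J.a_pos n).ne'
  have key : ∀ n, u n = J.P n x * u 0 ∧ u (n + 1) = J.P (n + 1) x * u 0 := by
    intro n
    induction n with
    | zero =>
      refine ⟨by simp [P], ?_⟩
      simp only [zero_add, P]
      have := ha 0
      push_cast
      field_simp
      linear_combination h0
    | succ n ih =>
      refine ⟨ih.2, ?_⟩
      have := ha (n + 1)
      have e := h1 n
      rw [ih.1, ih.2] at e
      simp only [P]
      push_cast
      field_simp
      linear_combination e
  exact (key n).1

/-- The right side is `ζ Ω̄ fₙ` minus its conjugate, hence a solution. At index `-1` it vanishes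
because `ζ Ω̄ f₋₁ = |Ω|²` is real, and at index `0` it is the Wronskian `ζ - ζ̄`. -/
theorem P_eq_jost (hTr : J.TraceCondition) {s x : ℝ} (hs : s = 1 ∨ s = -1)
    (hx : x ∈ Set.Ioo (-1 : ℝ) 1) (n : ℕ) :
    (J.P n x : ℂ) * (zetaBd s x - starRingEnd ℂ (zetaBd s x)) =
    zetaBd s x ^ (n + 1) * starRingEnd ℂ (J.jostOmega (zetaBd s x)) * J.jostP (zetaBd s x) n
      - starRingEnd ℂ (zetaBd s x) ^ (n + 1) * J.jostOmega (zetaBd s x)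
        * starRingEnd ℂ (J.jostP (zetaBd s x) n) := by
  have hn := zetaBd_normSq hs hx
  have hadd := zetaBd_add_conj s x
  have hd := zetaBd_mem_puncturedDisc hs hx
  have hw := J.jost_wronskian_zero hTr hs hx
  set ζ := zetaBd s x
  set w := starRingEnd ℂ ζ
  set Ω := J.jostOmega ζ with hΩ
  have hΩ' : starRingEnd ℂ Ω = (1 + w ^ 2 - 2 * J.b 0 * w) * starRingEnd ℂ (J.jostP ζ 0)
      - 2 * J.a 0 * w ^ 2 * starRingEnd ℂ (J.jostP ζ 1) := by
    simp [hΩ, jostOmega, Complex.conj_ofNat, w]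
  have hrec := J.jostP_rec hTr hd.1 hd.2
  have hrec' : ∀ n, 2 * J.a n * starRingEnd ℂ (J.jostP ζ n) =
      (1 + w ^ 2 - 2 * J.b (n + 1) * w) * starRingEnd ℂ (J.jostP ζ (n + 1))
      - 2 * J.a (n + 1) * w ^ 2 * starRingEnd ℂ (J.jostP ζ (n + 2)) := fun n => by
    have e2 := congrArg (starRingEnd ℂ) (hrec n)
    simpa only [map_mul, map_sub, map_add, map_one, map_pow, Complex.conj_ofNat,
      Complex.conj_ofReal] using e2
  have h := J.eq_P_mul (x := x) (u := fun n => ζ ^ (n + 1) * starRingEnd ℂ Ω * J.jostP ζ n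
      - w ^ (n + 1) * Ω * starRingEnd ℂ (J.jostP ζ n)) ?_ ?_ n
  · rw [h]
    simp only [zero_add, pow_one]
    rw [hw]
  · have e1 : Ω = (1 + ζ ^ 2 - 2 * J.b 0 * ζ) * J.jostP ζ 0 - 2 * J.a 0 * ζ ^ 2 * J.jostP ζ 1 := rfl
    generalize starRingEnd ℂ Ω = Ω' at *
    generalize Ω = Ω₁ at *
    generalize starRingEnd ℂ (J.jostP ζ 0) = q0 at *
    generalize starRingEnd ℂ (J.jostP ζ 1) = q1 at *
    simp only [zero_add, pow_one]
    linear_combination ((1 / 2 : ℂ) * Ω') * e1 - (1 / 2 : ℂ) * Ω₁ * hΩ' +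
      (1 / 2 : ℂ) * (Ω' * ζ * J.jostP ζ 0 - Ω₁ * w * q0) * hadd
      - (1 / 2 : ℂ) * (Ω' * J.jostP ζ 0 - Ω₁ * q0) * hn
  · intro n
    have e1 := hrec n
    have e2 := hrec' n
    generalize starRingEnd ℂ Ω = Ω' at *
    generalize Ω = Ω₁ at *
    generalize starRingEnd ℂ (J.jostP ζ n) = q0 at *
    generalize starRingEnd ℂ (J.jostP ζ (n + 1)) = q1 at *
    generalize starRingEnd ℂ (J.jostP ζ (n + 2)) = q2 at *
    have hp1 : ζ ^ (n + 1 + 1) = ζ ^ n * ζ ^ 2 := by ring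
    have hp2 : ζ ^ (n + 2 + 1) = ζ ^ n * ζ ^ 3 := by ring
    have hp3 : w ^ (n + 1 + 1) = w ^ n * w ^ 2 := by ring
    have hp4 : w ^ (n + 2 + 1) = w ^ n * w ^ 3 := by ring
    have hp5 : ζ ^ (n + 1) = ζ ^ n * ζ := by ring
    have hp6 : w ^ (n + 1) = w ^ n * w := by ring
    simp only [hp1, hp2, hp3, hp4, hp5, hp6]
    linear_combination ((1 / 2 : ℂ) * Ω' * ζ ^ n * ζ) * e1 - (1 / 2 : ℂ) * Ω₁ * w ^ n * w * e2 +
      (1 / 2 : ℂ) * (Ω' * ζ ^ n * ζ ^ 2 * J.jostP ζ (n + 1) - Ω₁ * w ^ n * w ^ 2 * q1) * hadd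
      - (1 / 2 : ℂ) * (Ω' * ζ ^ n * ζ * J.jostP ζ (n + 1) - Ω₁ * w ^ n * w * q1) * hn

theorem free_P_eq {s x : ℝ} (hs : s = 1 ∨ s = -1) (hx : x ∈ Set.Ioo (-1 : ℝ) 1) (n : ℕ) :
    (free.P n x : ℂ) * (zetaBd s x - starRingEnd ℂ (zetaBd s x)) =
      zetaBd s x ^ (n + 1) - starRingEnd ℂ (zetaBd s x) ^ (n + 1) := by
  have hn := zetaBd_normSq hs hx
  have hadd := zetaBd_add_conj s x
  set ζ := zetaBd s x
  set w := starRingEnd ℂ ζ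
  have h := free.eq_P_mul (x := x) (u := fun n => ζ ^ (n + 1) - w ^ (n + 1)) ?_ ?_ n
  · rw [h]; simp
  · simp only [free, zero_add, pow_one]
    push_cast
    linear_combination (1 / 2 : ℂ) * (ζ - w) * hadd
  · intro n
    simp only [free]
    push_cast
    have hp1 : ζ ^ (n + 1 + 1) = ζ ^ n * ζ ^ 2 := by ring
    have hp2 : ζ ^ (n + 2 + 1) = ζ ^ n * ζ ^ 3 := by ring
    have hp3 : w ^ (n + 1 + 1) = w ^ n * w ^ 2 := by ring
    have hp4 : w ^ (n + 2 + 1) = w ^ n * w ^ 3 := by ring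
    have hp5 : ζ ^ (n + 1) = ζ ^ n * ζ := by ring
    have hp6 : w ^ (n + 1) = w ^ n * w := by ring
    simp only [hp1, hp2, hp3, hp4, hp5, hp6]
    linear_combination (1 / 2 : ℂ) * (ζ ^ n * ζ ^ 2 - w ^ n * w ^ 2) * hadd
      - (1 / 2 : ℂ) * (ζ ^ n * ζ - w ^ n * w) * hn

end JacobiMatrix

/-! ### Dominated convergence in `ℓ²` and multiplication operators in `L²(-1,1)`. -/

section Ell2Tools

theorem ell2_norm_sq (f : Ell2) : ‖f‖ ^ 2 = ∑' n, ‖f n‖ ^ 2 := by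
  have h := lp.norm_rpow_eq_tsum (p := 2) (by norm_num) f
  simpa using h

theorem ell2_summable (f : Ell2) : Summable fun n => ‖f n‖ ^ 2 := by
  have h := (lp.memℓp f).summable (by norm_num)
  simpa using h

theorem memlp_two_of_summable {u : ℕ → ℂ} (h : Summable fun n => ‖u n‖ ^ 2) :
    Memℓp (E := fun _ : ℕ => ℂ) u 2 := by
  refine memℓp_gen ?_
  simpa using h

/-- Dominated convergence to zero in `ℓ²`. -/
theorem tendsto_ell2_zero_of_dominated {ι : Type*} {l : Filter ι} {y : ι → Ell2} {B : ℕ → ℝ}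
    (hB : Summable fun n => B n ^ 2) (hb : ∀ᶠ t in l, ∀ n, ‖y t n‖ ≤ B n)
    (hy : ∀ n, Tendsto (fun t => y t n) l (𝓝 0)) : Tendsto y l (𝓝 0) := by
  have h := tendsto_tsum_of_dominated_convergence (𝓕 := l) (f := fun t n => ‖y t n‖ ^ 2)
    (g := fun _ => (0 : ℝ)) hB (fun n => by simpa using (hy n).norm.pow 2)
    (hb.mono fun t ht n => by
      rw [Real.norm_of_nonneg (by positivity)]
      exact pow_le_pow_left₀ (norm_nonneg _) (ht n) 2)
  simp only [tsum_zero, ← ell2_norm_sq] at h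
  have h2 := (Real.continuous_sqrt.tendsto _).comp h
  simp only [Function.comp_def, Real.sqrt_sq (norm_nonneg _), Real.sqrt_zero] at h2
  exact tendsto_zero_iff_norm_tendsto_zero.2 h2

theorem ell2_ext_of_single {F : Type*} [NormedAddCommGroup F] [NormedSpace ℂ F]
    {S T : Ell2 →L[ℂ] F} (h : ∀ n, S (lp.single 2 n 1) = T (lp.single 2 n 1)) : S = T := by
  refine lp.ext_continuousLinearMap (by norm_num) fun n => ?_
  ext
  exact h n

end Ell2Tools

/-- Lebesgue measure on `(-1,1)`. -/
noncomputable abbrev muI : Measure ℝ := volume.restrict (Set.Ioo (-1 : ℝ) 1)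

theorem ae_muI_mem : ∀ᵐ x ∂muI, x ∈ Set.Ioo (-1 : ℝ) 1 := ae_restrict_mem measurableSet_Ioo

section Multiplication

theorem exists_isMultiplicationBy {σ : ℝ → ℂ} (hσ : AEStronglyMeasurable σ muI) {C : ℝ}
    (hC : ∀ x ∈ Set.Ioo (-1 : ℝ) 1, ‖σ x‖ ≤ C) :
    ∃ S : L2Interval →L[ℂ] L2Interval, IsMultiplicationBy σ S ∧ ∀ g, ‖S g‖ ≤ C * ‖g‖ := by
  have hC' : ∀ᵐ x ∂muI, ‖σ x‖ ≤ C := ae_muI_mem.mono hC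
  have hmem : ∀ g : L2Interval, MemLp (fun x => σ x * g x) 2 muI := fun g =>
    (Lp.memLp g).of_le_mul (c := C) (hσ.mul (Lp.aestronglyMeasurable g))
      (hC'.mono fun x hx => by
        rw [norm_mul]; exact mul_le_mul_of_nonneg_right hx (norm_nonneg _))
  let S₀ : L2Interval →ₗ[ℂ] L2Interval :=
    { toFun := fun g => MemLp.toLp _ (hmem g)
      map_add' := fun g h => by
        refine Lp.ext ?_
        filter_upwards [(hmem (g + h)).coeFn_toLp, (hmem g).coeFn_toLp, (hmem h).coeFn_toLp,
          Lp.coeFn_add (hmem g).toLp (hmem h).toLp, Lp.coeFn_add g h] with x h1 h2 h3 h4 h5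
        rw [h1, h4, Pi.add_apply, h2, h3, h5, Pi.add_apply, mul_add]
      map_smul' := fun c g => by
        refine Lp.ext ?_
        filter_upwards [(hmem (c • g)).coeFn_toLp, (hmem g).coeFn_toLp,
          Lp.coeFn_smul c (hmem g).toLp, Lp.coeFn_smul c g] with x h1 h2 h3 h4
        rw [h1, RingHom.id_apply, h3, Pi.smul_apply, h2, h4, Pi.smul_apply, smul_eq_mul,
          smul_eq_mul]
        ring }
  have hS : ∀ g, ‖S₀ g‖ ≤ C * ‖g‖ := fun g => by
    refine Lp.norm_le_mul_norm_of_ae_le_mul ?_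
    filter_upwards [(hmem g).coeFn_toLp, hC'] with x h1 h2
    change ‖(MemLp.toLp _ (hmem g) : L2Interval) x‖ ≤ _
    rw [h1, norm_mul]
    exact mul_le_mul_of_nonneg_right h2 (norm_nonneg _)
  exact ⟨S₀.mkContinuous C hS, fun g => (hmem g).coeFn_toLp, hS⟩

theorem IsMultiplicationBy.ext {σ τ : ℝ → ℂ} {S T : L2Interval →L[ℂ] L2Interval}
    (hS : IsMultiplicationBy σ S) (hT : IsMultiplicationBy τ T)
    (h : ∀ x ∈ Set.Ioo (-1 : ℝ) 1, σ x = τ x) : S = T := by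
  refine ContinuousLinearMap.ext fun g => Lp.ext ?_
  filter_upwards [hS g, hT g, ae_muI_mem] with x h1 h2 h3
  rw [h1, h2, h x h3]

theorem IsMultiplicationBy.congr {σ τ : ℝ → ℂ} {S : L2Interval →L[ℂ] L2Interval}
    (hS : IsMultiplicationBy σ S) (h : ∀ x ∈ Set.Ioo (-1 : ℝ) 1, σ x = τ x) :
    IsMultiplicationBy τ S := by
  intro g
  filter_upwards [hS g, ae_muI_mem] with x h1 h2
  rw [h1, h x h2]

theorem IsMultiplicationBy.comp {σ τ : ℝ → ℂ} {S T : L2Interval →L[ℂ] L2Interval}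
    (hS : IsMultiplicationBy σ S) (hT : IsMultiplicationBy τ T) :
    IsMultiplicationBy (fun x => σ x * τ x) (S ∘L T) := by
  intro g
  filter_upwards [hS (T g), hT g] with x h1 h2
  rw [ContinuousLinearMap.comp_apply, h1, h2, mul_assoc]

theorem IsMultiplicationBy.comm {σ τ : ℝ → ℂ} {S T : L2Interval →L[ℂ] L2Interval}
    (hS : IsMultiplicationBy σ S) (hT : IsMultiplicationBy τ T) (g : L2Interval) :
    S (T g) = T (S g) :=
  DFunLike.congr_fun ((hS.comp hT).ext (hT.comp hS) fun _ _ => mul_comm _ _) g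

theorem IsMultiplicationBy.id : IsMultiplicationBy (fun _ => 1) (ContinuousLinearMap.id ℂ _) :=
  fun g => by simp

theorem IsMultiplicationBy.one : IsMultiplicationBy (fun _ => 1) 1 :=
  fun g => by simp

theorem IsMultiplicationBy.pow {σ : ℝ → ℂ} {S : L2Interval →L[ℂ] L2Interval}
    (hS : IsMultiplicationBy σ S) (n : ℕ) : IsMultiplicationBy (fun x => σ x ^ n) (S ^ n) := by
  induction n with
  | zero => simpa using IsMultiplicationBy.one
  | succ n ih =>
    rw [pow_succ]
    exact (ih.comp hS).congr fun x _ => (pow_succ _ _).symm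

theorem IsMultiplicationBy.smul {σ : ℝ → ℂ} {S : L2Interval →L[ℂ] L2Interval}
    (hS : IsMultiplicationBy σ S) (c : ℂ) : IsMultiplicationBy (fun x => c * σ x) (c • S) := by
  intro g
  filter_upwards [hS g, Lp.coeFn_smul c (S g)] with x h1 h2
  rw [_root_.smul_apply, h2, Pi.smul_apply, h1, smul_eq_mul, mul_assoc]

theorem IsMultiplicationBy.add {σ τ : ℝ → ℂ} {S T : L2Interval →L[ℂ] L2Interval}
    (hS : IsMultiplicationBy σ S) (hT : IsMultiplicationBy τ T) :
    IsMultiplicationBy (fun x => σ x + τ x) (S + T) := by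
  intro g
  filter_upwards [hS g, hT g, Lp.coeFn_add (S g) (T g)] with x h1 h2 h3
  rw [_root_.add_apply, h3, Pi.add_apply, h1, h2, add_mul]

theorem IsMultiplicationBy.zero : IsMultiplicationBy (fun _ => 0) 0 := by
  intro g
  filter_upwards [Lp.coeFn_zero ℂ 2 muI] with x h
  rw [_root_.zero_apply, h]
  simp

theorem IsMultiplicationBy.sum {σ : ℕ → ℝ → ℂ} {S : ℕ → L2Interval →L[ℂ] L2Interval}
    (hS : ∀ n, IsMultiplicationBy (σ n) (S n)) (N : ℕ) :
    IsMultiplicationBy (fun x => ∑ n ∈ Finset.range N, σ n x) (∑ n ∈ Finset.range N, S n) := by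
  induction N with
  | zero => simpa using IsMultiplicationBy.zero
  | succ N ih => simpa only [Finset.sum_range_succ] using ih.add (hS N)

/-- The partial sums of the operator exponential converge in `L²`, so a subsequence converges almost
everywhere; pointwise these are partial sums of the scalar exponential. -/
theorem IsMultiplicationBy.exp {σ : ℝ → ℂ} {S : L2Interval →L[ℂ] L2Interval}
    (hS : IsMultiplicationBy σ S) :
    IsMultiplicationBy (fun x => Complex.exp (σ x)) (NormedSpace.exp S) := by
  intro g
  have h1 := (NormedSpace.exp_series_hasSum_exp' (𝕂 := ℂ) S).tendsto_sum_nat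
  have h2 : Tendsto (fun N => (∑ n ∈ Finset.range N, ((n.factorial : ℂ)⁻¹ • S ^ n)) g) atTop
      (𝓝 (NormedSpace.exp S g)) :=
    ((ContinuousLinearMap.apply ℂ L2Interval g).continuous.tendsto _).comp h1
  obtain ⟨ns, hns, hae⟩ := (tendstoInMeasure_of_tendsto_Lp h2).exists_seq_tendsto_ae
  have h3 : ∀ N, IsMultiplicationBy (fun x => ∑ n ∈ Finset.range N, (n.factorial : ℂ)⁻¹ * σ x ^ n)
      (∑ n ∈ Finset.range N, ((n.factorial : ℂ)⁻¹ • S ^ n)) := fun N =>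
    IsMultiplicationBy.sum (fun n => (hS.pow n).smul _) N
  have h4 : ∀ᵐ x ∂muI, ∀ N, (∑ n ∈ Finset.range N, ((n.factorial : ℂ)⁻¹ • S ^ n)) g x =
      (∑ n ∈ Finset.range N, (n.factorial : ℂ)⁻¹ * σ x ^ n) * g x :=
    ae_all_iff.2 fun N => h3 N g
  filter_upwards [hae, h4] with x hx1 hx2
  refine tendsto_nhds_unique hx1 ?_
  simp only [hx2]
  have h5 := (NormedSpace.exp_series_hasSum_exp' (𝕂 := ℂ) (σ x)).tendsto_sum_nat
  rw [← Complex.exp_eq_exp_ℂ] at h5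
  simp only [smul_eq_mul] at h5
  exact (h5.mul_const (g x)).comp hns.tendsto_atTop

theorem IsMultiplicationBy.norm_le {σ : ℝ → ℂ} {S : L2Interval →L[ℂ] L2Interval}
    (hS : IsMultiplicationBy σ S) {C : ℝ} (hC : ∀ x ∈ Set.Ioo (-1 : ℝ) 1, ‖σ x‖ ≤ C)
    (g : L2Interval) : ‖S g‖ ≤ C * ‖g‖ := by
  refine Lp.norm_le_mul_norm_of_ae_le_mul ?_
  filter_upwards [hS g, ae_muI_mem] with x h1 h2
  rw [h1, norm_mul]
  exact mul_le_mul_of_nonneg_right (hC x h2) (norm_nonneg _)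

end Multiplication

/-! ### Analysis operators `g ↦ (∫ φ n g)ₙ` and their adjoints. -/

section Analysis

/-- `A` is the operator `g ↦ (∫ φ n g)ₙ` from `L²(-1,1)` to `ℓ²`. -/
def IsAnalysis (φ : ℕ → ℝ → ℂ) (A : L2Interval →L[ℂ] Ell2) : Prop :=
  ∀ g n, A g n = ∫ x, φ n x * g x ∂muI

theorem integrable_mul_l2 {f : ℝ → ℂ} (hf : MemLp f 2 muI) (g : L2Interval) :
    Integrable (fun x => f x * g x) muI :=
  MemLp.integrable_mul hf (Lp.memLp g)

theorem exists_isAnalysis {φ : ℕ → ℝ → ℂ} (hφ : ∀ n, MemLp (φ n) 2 muI) {C : ℝ} (hC : 0 ≤ C)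
    (hB : ∀ (g : L2Interval) N,
      ∑ n ∈ Finset.range N, ‖∫ x, φ n x * g x ∂muI‖ ^ 2 ≤ (C * ‖g‖) ^ 2) :
    ∃ A, IsAnalysis φ A ∧ ∀ g, ‖A g‖ ≤ C * ‖g‖ := by
  have hsum : ∀ g : L2Interval, Summable fun n => ‖∫ x, φ n x * g x ∂muI‖ ^ 2 := fun g =>
    summable_of_sum_range_le (fun _ => by positivity) (hB g)
  let A₀ : L2Interval →ₗ[ℂ] Ell2 :=
    { toFun := fun g => ⟨fun n => ∫ x, φ n x * g x ∂muI, memlp_two_of_summable (hsum g)⟩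
      map_add' := fun g h => by
        ext n
        change ∫ x, φ n x * (g + h) x ∂muI = (∫ x, φ n x * g x ∂muI) + ∫ x, φ n x * h x ∂muI
        rw [← integral_add (integrable_mul_l2 (hφ n) g) (integrable_mul_l2 (hφ n) h)]
        refine integral_congr_ae ?_
        filter_upwards [Lp.coeFn_add g h] with x hx
        rw [hx, Pi.add_apply, mul_add]
      map_smul' := fun c g => by
        ext n
        change ∫ x, φ n x * (c • g) x ∂muI = c * ∫ x, φ n x * g x ∂muI
        rw [← integral_const_mul]
        refine integral_congr_ae ?_
        filter_upwards [Lp.coeFn_smul c g] with x hx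
        rw [hx, Pi.smul_apply, smul_eq_mul]
        ring }
  have hA : ∀ g, ‖A₀ g‖ ≤ C * ‖g‖ := fun g => by
    refine le_of_sq_le_sq ?_ (by positivity)
    rw [ell2_norm_sq]
    exact (hsum g).tsum_le_of_sum_range_le (hB g)
  exact ⟨A₀.mkContinuous C hA, fun g n => rfl, hA⟩

theorem IsAnalysis.ext {φ χ : ℕ → ℝ → ℂ} {A B : L2Interval →L[ℂ] Ell2} (hA : IsAnalysis φ A)
    (hB : IsAnalysis χ B) (h : ∀ n, ∀ x ∈ Set.Ioo (-1 : ℝ) 1, φ n x = χ n x) : A = B := by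
  refine ContinuousLinearMap.ext fun g => ?_
  ext n
  rw [hA g n, hB g n]
  refine integral_congr_ae ?_
  filter_upwards [ae_muI_mem] with x hx
  rw [h n x hx]

theorem IsAnalysis.congr {φ χ : ℕ → ℝ → ℂ} {A : L2Interval →L[ℂ] Ell2} (hA : IsAnalysis φ A)
    (h : ∀ n, ∀ x ∈ Set.Ioo (-1 : ℝ) 1, φ n x = χ n x) : IsAnalysis χ A := by
  intro g n
  rw [hA g n]
  refine integral_congr_ae ?_
  filter_upwards [ae_muI_mem] with x hx
  rw [h n x hx]

theorem IsAnalysis.comp {φ : ℕ → ℝ → ℂ} {A : L2Interval →L[ℂ] Ell2} (hA : IsAnalysis φ A)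
    {σ : ℝ → ℂ} {S : L2Interval →L[ℂ] L2Interval} (hS : IsMultiplicationBy σ S) :
    IsAnalysis (fun n x => φ n x * σ x) (A ∘L S) := by
  intro g n
  rw [ContinuousLinearMap.comp_apply, hA]
  refine integral_congr_ae ?_
  filter_upwards [hS g] with x hx
  rw [hx, mul_assoc]

theorem IsAnalysis.add {φ χ : ℕ → ℝ → ℂ} {A B : L2Interval →L[ℂ] Ell2}
    (hA : IsAnalysis φ A) (hB : IsAnalysis χ B) (hφ : ∀ n, MemLp (φ n) 2 muI)
    (hχ : ∀ n, MemLp (χ n) 2 muI) : IsAnalysis (fun n x => φ n x + χ n x) (A + B) := by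
  intro g n
  have e : (A + B) g n = A g n + B g n := rfl
  rw [e, hA, hB, ← integral_add (integrable_mul_l2 (hφ n) g) (integrable_mul_l2 (hχ n) g)]
  simp only [add_mul]

theorem IsAnalysis.smul {φ : ℕ → ℝ → ℂ} {A : L2Interval →L[ℂ] Ell2}
    (hA : IsAnalysis φ A) (c : ℂ) : IsAnalysis (fun n x => c * φ n x) (c • A) := by
  intro g n
  have e : (c • A) g n = c * A g n := rfl
  rw [e, hA, ← integral_const_mul]
  simp only [mul_assoc]

theorem norm_integral_mul_le {f : ℝ → ℂ} (hf : MemLp f 2 muI) (g : L2Interval) :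
    ‖∫ x, f x * g x ∂muI‖ ≤ (eLpNorm f 2 muI).toReal * ‖g‖ := by
  have hc : MemLp (fun x => starRingEnd ℂ (f x)) 2 muI := hf.star
  have h1 : inner ℂ hc.toLp g = ∫ x, f x * g x ∂muI := by
    rw [L2.inner_def]
    refine integral_congr_ae ?_
    filter_upwards [hc.coeFn_toLp] with x hx
    rw [hx]
    simp [mul_comm]
  rw [← h1]
  refine (norm_inner_le_norm _ _).trans_eq ?_
  rw [Lp.norm_toLp]
  congr 2
  exact eLpNorm_congr_norm_ae (Eventually.of_forall fun x => by simp)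

/-- A Hilbert–Schmidt family. -/
theorem exists_isAnalysis_of_summable {φ : ℕ → ℝ → ℂ} (hφ : ∀ n, MemLp (φ n) 2 muI) {B : ℕ → ℝ}
    (hB : ∀ n, (eLpNorm (φ n) 2 muI).toReal ≤ B n)
    (hs : Summable fun n => B n ^ 2) :
    ∃ A, IsAnalysis φ A ∧ ∀ g n, ‖A g n‖ ≤ B n * ‖g‖ := by
  have hle : ∀ (g : L2Interval) n, ‖∫ x, φ n x * g x ∂muI‖ ≤ B n * ‖g‖ := fun g n =>
    (norm_integral_mul_le (hφ n) g).trans (mul_le_mul_of_nonneg_right (hB n) (norm_nonneg _))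
  obtain ⟨A, hA, -⟩ := exists_isAnalysis hφ (C := √(∑' n, B n ^ 2)) (Real.sqrt_nonneg _)
    fun g N => by
      calc ∑ n ∈ Finset.range N, ‖∫ x, φ n x * g x ∂muI‖ ^ 2
          ≤ ∑ n ∈ Finset.range N, B n ^ 2 * ‖g‖ ^ 2 := Finset.sum_le_sum fun n _ => by
            rw [← mul_pow]; exact pow_le_pow_left₀ (norm_nonneg _) (hle g n) 2
        _ = (∑ n ∈ Finset.range N, B n ^ 2) * ‖g‖ ^ 2 := (Finset.sum_mul _ _ _).symm
        _ ≤ (∑' n, B n ^ 2) * ‖g‖ ^ 2 := mul_le_mul_of_nonneg_right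
            (hs.sum_le_tsum _ fun n _ => by positivity) (by positivity)
        _ = (√(∑' n, B n ^ 2) * ‖g‖) ^ 2 := by
            rw [mul_pow, Real.sq_sqrt (tsum_nonneg fun n => by positivity)]
  exact ⟨A, hA, fun g n => by rw [hA]; exact hle g n⟩

/-- Bessel's inequality for an orthonormal family of real functions. -/
theorem exists_isAnalysis_of_orthonormal {φ : ℕ → ℝ → ℝ}
    (hφ : ∀ n, MemLp (fun x => (φ n x : ℂ)) 2 muI)
    (ho : ∀ n m, ∫ x, φ n x * φ m x ∂muI = if n = m then 1 else 0) :
    ∃ A, IsAnalysis (fun n x => (φ n x : ℂ)) A ∧ ∀ g, ‖A g‖ ≤ ‖g‖ := by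
  have hinner : ∀ n (g : L2Interval), inner ℂ (hφ n).toLp g = ∫ x, (φ n x : ℂ) * g x ∂muI := by
    intro n g
    rw [L2.inner_def]
    refine integral_congr_ae ?_
    filter_upwards [(hφ n).coeFn_toLp] with x hx
    rw [hx]
    simp [mul_comm]
  have hon : Orthonormal ℂ fun n => (hφ n).toLp := by
    rw [orthonormal_iff_ite]
    intro n m
    rw [hinner]
    have : ∫ x, (φ n x : ℂ) * (MemLp.toLp _ (hφ m) : L2Interval) x ∂muI = ∫ x, ((φ n x * φ m x : ℝ) : ℂ) ∂muI := by
      refine integral_congr_ae ?_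
      filter_upwards [(hφ m).coeFn_toLp] with x hx
      rw [hx]; push_cast; rfl
    rw [this, integral_complex_ofReal, ho]
    split_ifs <;> simp
  obtain ⟨A, hA, hA'⟩ := exists_isAnalysis hφ zero_le_one fun g N => by
    rw [one_mul]
    simp only [← hinner]
    exact hon.sum_inner_products_le g
  exact ⟨A, hA, fun g => by simpa using hA' g⟩

/-- The adjoint of the analysis operator of a real family maps the basis to the family. -/
theorem IsAnalysis.isExpansionMap {φ : ℕ → ℝ → ℝ} {A : L2Interval →L[ℂ] Ell2}
    (hA : IsAnalysis (fun n x => (φ n x : ℂ)) A) (hφ : ∀ n, MemLp (fun x => (φ n x : ℂ)) 2 muI) :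
    IsExpansionMap φ (ContinuousLinearMap.adjoint A) := by
  intro n
  have h : ContinuousLinearMap.adjoint A (lp.single 2 n (1 : ℂ)) = (hφ n).toLp := by
    refine ext_inner_right ℂ fun g => ?_
    rw [ContinuousLinearMap.adjoint_inner_left, lp.inner_single_left, hA, L2.inner_def]
    simp only [RCLike.inner_apply, map_one, mul_one]
    refine integral_congr_ae ?_
    filter_upwards [(hφ n).coeFn_toLp] with x hx
    rw [hx]
    simp [mul_comm]
  rw [h]
  exact (hφ n).coeFn_toLp

end Analysis

section Intertwining

theorem exp_intertwine {E F : Type*} [NormedAddCommGroup E] [NormedSpace ℂ E] [CompleteSpace E]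
    [NormedAddCommGroup F] [NormedSpace ℂ F] [CompleteSpace F] {A : E →L[ℂ] F} {X : E →L[ℂ] E}
    {Y : F →L[ℂ] F} (h : ∀ g, Y (A g) = A (X g)) (c : ℂ) (g : E) :
    NormedSpace.exp (c • Y) (A g) = A (NormedSpace.exp (c • X) g) := by
  have h1 := (NormedSpace.exp_series_hasSum_exp' (𝕂 := ℂ) (c • Y))
  have h2 := (NormedSpace.exp_series_hasSum_exp' (𝕂 := ℂ) (c • X))
  have h1' := h1.mapL (ContinuousLinearMap.apply ℂ F (A g))
  have h2' := (h2.mapL (ContinuousLinearMap.apply ℂ E g)).mapL A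
  have hpow : ∀ n : ℕ, (Y ^ n) (A g) = A ((X ^ n) g) := fun n => by
    induction n with
    | zero => rfl
    | succ n ih =>
      have e1 : (Y ^ (n + 1)) (A g) = Y ((Y ^ n) (A g)) := by rw [pow_succ']; rfl
      have e2 : (X ^ (n + 1)) g = X ((X ^ n) g) := by rw [pow_succ']; rfl
      rw [e1, e2, ih, h]
  have h3 : (fun n : ℕ => ContinuousLinearMap.apply ℂ F (A g) ((n.factorial : ℂ)⁻¹ • (c • Y) ^ n)) =
      fun n => A (ContinuousLinearMap.apply ℂ E g ((n.factorial : ℂ)⁻¹ • (c • X) ^ n)) := by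
    funext n
    simp [smul_pow, hpow]
  rw [h3] at h1'
  exact h1'.unique h2'

end Intertwining

/-! ### The free expansion: Chebyshev polynomials of both kinds and free waves. -/

theorem JacobiMatrix.continuous_P (J : JacobiMatrix) (n : ℕ) : Continuous (J.P n) := by
  have key : ∀ n, Continuous (J.P n) ∧ Continuous (J.P (n + 1)) := by
    intro n
    induction n with
    | zero =>
      refine ⟨continuous_const, ?_⟩
      change Continuous fun x => (x - J.b 0) / J.a 0
      fun_prop
    | succ n ih =>
      obtain ⟨h1, h2⟩ := ih
      refine ⟨h2, ?_⟩
      change Continuous fun x => ((x - J.b (n + 1)) * J.P (n + 1) x - J.a n * J.P n x) / J.a (n + 1)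
      fun_prop
  exact (key n).1

theorem free_P_eq_U (n : ℕ) (x : ℝ) :
    JacobiMatrix.free.P n x = (Polynomial.Chebyshev.U ℝ n).eval x := by
  have key : ∀ n : ℕ, JacobiMatrix.free.P n x = (Polynomial.Chebyshev.U ℝ n).eval x ∧
      JacobiMatrix.free.P (n + 1) x = (Polynomial.Chebyshev.U ℝ (n + 1 : ℕ)).eval x := by
    intro n
    induction n with
    | zero => constructor <;> simp [JacobiMatrix.P, JacobiMatrix.free, mul_comm]
    | succ n ih =>
      refine ⟨ih.2, ?_⟩
      have e : ((n + 1 + 1 : ℕ) : ℤ) = (n : ℤ) + 2 := by push_cast; ring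
      rw [e, Polynomial.Chebyshev.U_add_two]
      simp only [JacobiMatrix.P]
      rw [ih.1, ih.2]
      simp only [JacobiMatrix.free, Polynomial.eval_sub, Polynomial.eval_mul, Polynomial.eval_X,
        Polynomial.eval_ofNat]
      push_cast
      ring
  exact (key n).1

theorem zetaBd_pow_add_conj {s x : ℝ} (hs : s = 1 ∨ s = -1) (hx : x ∈ Set.Ioo (-1 : ℝ) 1)
    (n : ℕ) : zetaBd s x ^ n + starRingEnd ℂ (zetaBd s x) ^ n =
      2 * ((Polynomial.Chebyshev.T ℝ n).eval x : ℝ) := by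
  have hn := zetaBd_normSq hs hx
  have hadd := zetaBd_add_conj s x
  set ζ := zetaBd s x
  set w := starRingEnd ℂ ζ
  have key : ∀ n : ℕ, ζ ^ n + w ^ n = 2 * ((Polynomial.Chebyshev.T ℝ n).eval x : ℝ) ∧
      ζ ^ (n + 1) + w ^ (n + 1) = 2 * ((Polynomial.Chebyshev.T ℝ (n + 1 : ℕ)).eval x : ℝ) := by
    intro n
    induction n with
    | zero => constructor <;> norm_num [hadd]
    | succ n ih =>
      refine ⟨ih.2, ?_⟩
      have e : ((n + 1 + 1 : ℕ) : ℤ) = (n : ℤ) + 2 := by push_cast; ring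
      have e' : ((n + 1 : ℕ) : ℤ) = (n : ℤ) + 1 := by push_cast; ring
      have h2 := ih.2
      rw [e'] at h2
      rw [e, Polynomial.Chebyshev.T_add_two]
      simp only [Polynomial.eval_sub, Polynomial.eval_mul, Polynomial.eval_X,
        Polynomial.eval_ofNat, Complex.ofReal_sub, Complex.ofReal_mul, Complex.ofReal_ofNat]
      have hp1 : ζ ^ (n + 1 + 1) = ζ ^ n * ζ ^ 2 := by ring
      have hp3 : w ^ (n + 1 + 1) = w ^ n * w ^ 2 := by ring
      have hp5 : ζ ^ (n + 1) = ζ ^ n * ζ := by ring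
      have hp6 : w ^ (n + 1) = w ^ n * w := by ring
      rw [hp5, hp6] at h2
      rw [hp1, hp3]
      linear_combination 2 * x * h2 - ih.1 + (ζ ^ n * ζ + w ^ n * w) * hadd
        - (ζ ^ n + w ^ n) * hn
  exact (key n).1

/-- The amplitude `√w₀ = √(2 π⁻¹ √(1 - x²))`. -/
noncomputable def ampFree (x : ℝ) : ℝ := √(2 / Real.pi * √(1 - x ^ 2))

/-- The orthonormal family of Chebyshev polynomials of the first kind (without the constant). -/
noncomputable def cosFree (n : ℕ) (x : ℝ) : ℝ :=
  ampFree x / √(1 - x ^ 2) * (Polynomial.Chebyshev.T ℝ (n + 1 : ℕ)).eval x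

theorem ampFree_sq (x : ℝ) : ampFree x ^ 2 = 2 / Real.pi * √(1 - x ^ 2) :=
  Real.sq_sqrt (by positivity)

theorem ampFree_pos {x : ℝ} (hx : x ∈ Set.Ioo (-1 : ℝ) 1) : 0 < ampFree x := by
  have := sqrt_pos_of_mem hx
  have := Real.pi_pos
  exact Real.sqrt_pos.2 (by positivity)

theorem continuous_ampFree : Continuous ampFree := by unfold ampFree; fun_prop

theorem integral_muI_measureT (f : ℝ → ℝ) :
    ∫ x, f x * (√(1 - x ^ 2))⁻¹ ∂muI = ∫ x, f x ∂Polynomial.Chebyshev.measureT := by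
  rw [Polynomial.Chebyshev.integral_measureT, intervalIntegral.integral_of_le (by norm_num),
    integral_Ioc_eq_integral_Ioo]
  simp only [Real.sqrt_inv]

theorem integrable_muI_mul_inv_sqrt {h : ℝ → ℝ} (hh : Continuous h) :
    Integrable (fun x => h x * (√(1 - x ^ 2))⁻¹) muI := by
  have h1 := Polynomial.Chebyshev.intervalIntegrable_sqrt_one_sub_sq_inv.continuousOn_mul
    hh.continuousOn
  rw [intervalIntegrable_iff, Set.uIoc_of_le (by norm_num)] at h1
  have h2 := h1.mono_set Set.Ioo_subset_Ioc_self
  simpa only [IntegrableOn, Real.sqrt_inv] using h2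

theorem memLp_of_sq_eq {f h : ℝ → ℝ} (hf : Measurable f) (hh : Continuous h)
    (he : ∀ x ∈ Set.Ioo (-1 : ℝ) 1, f x ^ 2 = h x * (√(1 - x ^ 2))⁻¹) :
    MemLp (fun x => (f x : ℂ)) 2 muI := by
  have h1 : MemLp f 2 muI := by
    rw [memLp_two_iff_integrable_sq hf.aestronglyMeasurable]
    refine (integrable_muI_mul_inv_sqrt hh).congr ?_
    filter_upwards [ae_muI_mem] with x hx
    rw [he x hx]
  exact h1.ofReal

/-- With `x = cos θ` this is the product formula for two sines. The factor `1/√(1 - x²)` turns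
orthonormality into integrals of single polynomials `T` against the Chebyshev measure; the index `n
- m` may be negative. -/
theorem psiFree_mul {n m : ℕ} {x : ℝ} (hx : x ∈ Set.Ioo (-1 : ℝ) 1) :
    psiFree n x * psiFree m x = (1 / Real.pi *
      ((Polynomial.Chebyshev.T ℝ ((n : ℤ) - m)).eval x -
        (Polynomial.Chebyshev.T ℝ ((n : ℤ) + m + 2)).eval x)) * (√(1 - x ^ 2))⁻¹ := by
  have hv := sqrt_pos_of_mem hx
  have hv2 := sq_sqrt_of_mem hx
  have hsin : Real.sin (Real.arccos x) = √(1 - x ^ 2) := Real.sin_arccos x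
  have hcos : Real.cos (Real.arccos x) = x := Real.cos_arccos hx.1.le hx.2.le
  have hn : JacobiMatrix.free.P n x * √(1 - x ^ 2) = Real.sin ((n + 1) * Real.arccos x) := by
    have := Polynomial.Chebyshev.U_real_cos (Real.arccos x) n
    rw [hcos, hsin] at this
    rw [free_P_eq_U]; exact_mod_cast this
  have hm : JacobiMatrix.free.P m x * √(1 - x ^ 2) = Real.sin ((m + 1) * Real.arccos x) := by
    have := Polynomial.Chebyshev.U_real_cos (Real.arccos x) m
    rw [hcos, hsin] at this
    rw [free_P_eq_U]; exact_mod_cast this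
  have hT1 : (Polynomial.Chebyshev.T ℝ ((n : ℤ) - m)).eval x =
      Real.cos ((n + 1) * Real.arccos x - (m + 1) * Real.arccos x) := by
    have := Polynomial.Chebyshev.T_real_cos (Real.arccos x) ((n : ℤ) - m)
    rw [hcos] at this
    rw [this]; congr 1; push_cast; ring
  have hT2 : (Polynomial.Chebyshev.T ℝ ((n : ℤ) + m + 2)).eval x =
      Real.cos ((n + 1) * Real.arccos x + (m + 1) * Real.arccos x) := by
    have := Polynomial.Chebyshev.T_real_cos (Real.arccos x) ((n : ℤ) + m + 2)
    rw [hcos] at this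
    rw [this]; congr 1; push_cast; ring
  rw [hT1, hT2, Real.cos_sub, Real.cos_add, ← hn, ← hm]
  have h0 : psiFree n x * psiFree m x = ampFree x ^ 2 * (JacobiMatrix.free.P n x *
      JacobiMatrix.free.P m x) := by
    simp only [psiFree, ampFree]; ring
  rw [h0, ampFree_sq]
  have := Real.pi_pos
  field_simp
  ring

theorem cosFree_mul {n m : ℕ} {x : ℝ} (hx : x ∈ Set.Ioo (-1 : ℝ) 1) :
    cosFree n x * cosFree m x = (2 / Real.pi *
      ((Polynomial.Chebyshev.T ℝ (n + 1 : ℕ)).eval x *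
        (Polynomial.Chebyshev.T ℝ (m + 1 : ℕ)).eval x)) * (√(1 - x ^ 2))⁻¹ := by
  have hv := sqrt_pos_of_mem hx
  have h0 : cosFree n x * cosFree m x = ampFree x ^ 2 / √(1 - x ^ 2) ^ 2 *
      ((Polynomial.Chebyshev.T ℝ (n + 1 : ℕ)).eval x *
        (Polynomial.Chebyshev.T ℝ (m + 1 : ℕ)).eval x) := by
    simp only [cosFree]; ring
  rw [h0, ampFree_sq]
  have := Real.pi_pos
  field_simp

theorem memLp_psiFree (n : ℕ) : MemLp (fun x => (psiFree n x : ℂ)) 2 muI := by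
  refine memLp_of_sq_eq (h := fun x => 1 / Real.pi *
      ((Polynomial.Chebyshev.T ℝ ((n : ℤ) - n)).eval x -
        (Polynomial.Chebyshev.T ℝ ((n : ℤ) + n + 2)).eval x)) ?_ (by fun_prop) fun x hx => ?_
  · have h1 := JacobiMatrix.free.continuous_P n
    have h2 : Continuous (psiFree n) := continuous_ampFree.mul h1
    exact h2.measurable
  · rw [pow_two, psiFree_mul hx]

theorem measurable_cosFree (n : ℕ) : Measurable (cosFree n) := by
  have h1 := continuous_ampFree.measurable
  have h2 : Measurable fun x => (Polynomial.Chebyshev.T ℝ (n + 1 : ℕ)).eval x :=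
    (by fun_prop : Continuous _).measurable
  have h3 : Measurable fun x : ℝ => √(1 - x ^ 2) := (by fun_prop : Continuous _).measurable
  exact (h1.div h3).mul h2

theorem memLp_cosFree (n : ℕ) : MemLp (fun x => (cosFree n x : ℂ)) 2 muI := by
  refine memLp_of_sq_eq (h := fun x => 2 / Real.pi *
      ((Polynomial.Chebyshev.T ℝ (n + 1 : ℕ)).eval x *
        (Polynomial.Chebyshev.T ℝ (n + 1 : ℕ)).eval x)) (measurable_cosFree n) (by fun_prop)
    fun x hx => ?_
  rw [pow_two, cosFree_mul hx]

theorem integral_psiFree_mul (n m : ℕ) :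
    ∫ x, psiFree n x * psiFree m x ∂muI = if n = m then 1 else 0 := by
  have h1 : ∫ x, psiFree n x * psiFree m x ∂muI = ∫ x, (1 / Real.pi *
      ((Polynomial.Chebyshev.T ℝ ((n : ℤ) - m)).eval x -
        (Polynomial.Chebyshev.T ℝ ((n : ℤ) + m + 2)).eval x)) * (√(1 - x ^ 2))⁻¹ ∂muI := by
    refine integral_congr_ae ?_
    filter_upwards [ae_muI_mem] with x hx
    rw [psiFree_mul hx]
  rw [h1, integral_muI_measureT, integral_const_mul,
    integral_sub (Polynomial.Chebyshev.integrable_measureT (by fun_prop))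
      (Polynomial.Chebyshev.integrable_measureT (by fun_prop)),
    Polynomial.Chebyshev.integral_eval_T_real_measureT_of_ne_zero
      (n := (n : ℤ) + m + 2) (by positivity)]
  split_ifs with h
  · subst h
    rw [sub_self, Polynomial.Chebyshev.integral_eval_T_real_measureT_zero]
    have := Real.pi_pos
    field_simp
    ring
  · rw [Polynomial.Chebyshev.integral_eval_T_real_measureT_of_ne_zero (by omega)]
    ring

theorem integral_cosFree_mul (n m : ℕ) :
    ∫ x, cosFree n x * cosFree m x ∂muI = if n = m then 1 else 0 := by
  have h1 : ∫ x, cosFree n x * cosFree m x ∂muI = ∫ x, (2 / Real.pi *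
      ((Polynomial.Chebyshev.T ℝ (n + 1 : ℕ)).eval x *
        (Polynomial.Chebyshev.T ℝ (m + 1 : ℕ)).eval x)) * (√(1 - x ^ 2))⁻¹ ∂muI := by
    refine integral_congr_ae ?_
    filter_upwards [ae_muI_mem] with x hx
    rw [cosFree_mul hx]
  rw [h1, integral_muI_measureT, integral_const_mul]
  split_ifs with h
  · subst h
    rw [Polynomial.Chebyshev.integral_eval_T_real_mul_eval_T_real_measureT, sub_self,
      Polynomial.Chebyshev.integral_eval_T_real_measureT_zero,
      Polynomial.Chebyshev.integral_eval_T_real_measureT_of_ne_zero (by positivity)]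
    have := Real.pi_pos
    field_simp
    ring
  · rw [Polynomial.Chebyshev.integral_eval_T_real_mul_eval_T_real_measureT_of_ne (by omega)]
    ring

theorem exists_isAnalysis_psiFree :
    ∃ A, IsAnalysis (fun n x => (psiFree n x : ℂ)) A ∧ ∀ g, ‖A g‖ ≤ ‖g‖ :=
  exists_isAnalysis_of_orthonormal memLp_psiFree integral_psiFree_mul

/-- The amplitude of the outgoing and incoming free waves. -/
noncomputable def kappa (s x : ℝ) : ℂ :=
  ampFree x / (zetaBd s x - starRingEnd ℂ (zetaBd s x))

/-- This is `e^{±i(n+1)θ} = cos ± i sin`: a wave is half of one orthonormal family plus half of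
another, up to unimodular constants. Hence its analysis operator is a contraction, although `κ` is
unbounded near `±1`. -/
theorem kappa_mul_pow_eq {s x : ℝ} (hs : s = 1 ∨ s = -1) (hx : x ∈ Set.Ioo (-1 : ℝ) 1) (n : ℕ) :
    (Complex.I * s / 2) * (cosFree n x : ℂ) + (-1 / 2) * (psiFree n x : ℂ) =
      kappa s x * starRingEnd ℂ (zetaBd s x) ^ (n + 1) := by
  have h1 := zetaBd_pow_add_conj hs hx (n + 1)
  have h2 := JacobiMatrix.free_P_eq hs hx n
  have hne := zetaBd_sub_conj_ne_zero hs hx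
  have h3 := zetaBd_sub_conj s x
  have hs2 : (s : ℂ) * s = 1 := by rcases hs with h | h <;> simp [h]
  have hs0 : (s : ℂ) ≠ 0 := left_ne_zero_of_mul_eq_one hs2
  have hv : ((√(1 - x ^ 2) : ℝ) : ℂ) ≠ 0 := by exact_mod_cast (sqrt_pos_of_mem hx).ne'
  have hw : starRingEnd ℂ (zetaBd s x) ^ (n + 1) =
      ((Polynomial.Chebyshev.T ℝ (n + 1 : ℕ)).eval x : ℝ) -
      (JacobiMatrix.free.P n x : ℂ) * (zetaBd s x - starRingEnd ℂ (zetaBd s x)) / 2 := by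
    linear_combination (1 / 2 : ℂ) * h1 + (1 / 2 : ℂ) * h2
  have hp : (psiFree n x : ℂ) = ampFree x * JacobiMatrix.free.P n x := by
    simp only [psiFree, ampFree]; push_cast; rfl
  rw [hw, kappa, hp, cosFree, h3]
  generalize (Polynomial.Chebyshev.T ℝ (n + 1 : ℕ)).eval x = T
  push_cast
  field_simp
  linear_combination (ampFree x * T : ℂ) * Complex.I_sq + (ampFree x * T * Complex.I ^ 2 : ℂ) * hs2

theorem memLp_kappa_mul_pow {s : ℝ} (hs : s = 1 ∨ s = -1) (n : ℕ) :
    MemLp (fun x => kappa s x * starRingEnd ℂ (zetaBd s x) ^ (n + 1)) 2 muI := by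
  have h1 : MemLp (fun x => (Complex.I * s / 2) * (cosFree n x : ℂ)
      + (-1 / 2) * (psiFree n x : ℂ)) 2 muI :=
    ((memLp_cosFree n).const_mul _).add ((memLp_psiFree n).const_mul _)
  refine h1.ae_eq ?_
  filter_upwards [ae_muI_mem] with x hx
  exact kappa_mul_pow_eq hs hx n

theorem exists_isAnalysis_wave {s : ℝ} (hs : s = 1 ∨ s = -1) :
    ∃ A, IsAnalysis (fun n x => kappa s x * starRingEnd ℂ (zetaBd s x) ^ (n + 1)) A ∧
      ∀ g, ‖A g‖ ≤ ‖g‖ := by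
  obtain ⟨A, hA, hA1⟩ := exists_isAnalysis_psiFree
  obtain ⟨B, hB, hB1⟩ := exists_isAnalysis_of_orthonormal memLp_cosFree integral_cosFree_mul
  refine ⟨(Complex.I * s / 2) • B + (-1 / 2 : ℂ) • A, ?_, fun g => ?_⟩
  · exact ((hB.smul _).add (hA.smul _) (fun n => (memLp_cosFree n).const_mul _)
      (fun n => (memLp_psiFree n).const_mul _)).congr fun n x hx => kappa_mul_pow_eq hs hx n
  · have e : ((Complex.I * s / 2) • B + (-1 / 2 : ℂ) • A) g =
      (Complex.I * s / 2) • B g + (-1 / 2 : ℂ) • A g := rfl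
    rw [e]
    refine (norm_add_le _ _).trans ?_
    rw [norm_smul, norm_smul]
    have h1 : ‖Complex.I * (s : ℂ) / 2‖ = 1 / 2 := by
      rcases hs with h | h <;> simp [h]
    have h2 : ‖(-1 / 2 : ℂ)‖ = 1 / 2 := by norm_num
    rw [h1, h2]
    linarith [hA1 g, hB1 g]

/-! ### Reduction to test functions, Riemann–Lebesgue, and non-stationary phase. -/

section Closure

/-- A bound uniform in `t` makes the set of vectors sent to zero closed, so convergence need only be
checked on a dense family. -/
theorem tendsto_zero_of_submodule {E F ι : Type*} [NormedAddCommGroup E] [NormedSpace ℂ E]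
    [NormedAddCommGroup F] [NormedSpace ℂ F] {l : Filter ι} (B : ι → E →L[ℂ] F) {C : ℝ}
    (hB : ∀ t g, ‖B t g‖ ≤ C * ‖g‖) :
    ∃ V : Submodule ℂ E, IsClosed (V : Set E) ∧ ∀ g, g ∈ V ↔ Tendsto (fun t => B t g) l (𝓝 0) := by
  refine ⟨{ carrier := {g | Tendsto (fun t => B t g) l (𝓝 0)}
            zero_mem' := by simpa using tendsto_const_nhds
            add_mem' := fun {g h} hg hh => by simpa using Tendsto.add hg hh
            smul_mem' := fun c g hg => by simpa using Tendsto.const_smul hg c }, ?_, fun g => Iff.rfl⟩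
  refine isClosed_of_closure_subset fun g hg => ?_
  rw [Metric.mem_closure_iff] at hg
  change Tendsto (fun t => B t g) l (𝓝 0)
  rw [Metric.tendsto_nhds]
  intro ε hε
  have hC : 0 < |C| + 1 := by positivity
  obtain ⟨h, hh, hd⟩ := hg (ε / 2 / (|C| + 1)) (by positivity)
  have hh' : Tendsto (fun t => B t h) l (𝓝 0) := hh
  filter_upwards [(Metric.tendsto_nhds.1 hh') (ε / 2) (by positivity)] with t ht
  rw [dist_zero_right] at ht ⊢
  have h1 : B t g = B t (g - h) + B t h := by rw [map_sub]; abel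
  rw [h1]
  have h2 : ‖B t (g - h)‖ ≤ ε / 2 := by
    refine (hB t _).trans ?_
    rw [← dist_eq_norm]
    have h3 : C * dist g h ≤ (|C| + 1) * dist g h :=
      mul_le_mul_of_nonneg_right (by linarith [le_abs_self C]) dist_nonneg
    have h4 := (lt_div_iff₀ hC).1 hd
    linarith
  linarith [norm_add_le (B t (g - h)) (B t h)]

/-- Smooth functions compactly supported in `(-1,1)`. -/
def IsTest (m : ℝ → ℝ) : Prop :=
  ContDiff ℝ (↑(⊤ : ℕ∞)) m ∧ HasCompactSupport m ∧ tsupport m ⊆ Set.Ioo (-1 : ℝ) 1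

theorem IsTest.exists_radius {m : ℝ → ℝ} (hm : IsTest m) :
    ∃ c, 0 < c ∧ c < 1 ∧ ∀ x, c ≤ |x| → m x = 0 := by
  have hK : IsCompact (tsupport m) := hm.2.1
  rcases (tsupport m).eq_empty_or_nonempty with h | h
  · refine ⟨1 / 2, by norm_num, by norm_num, fun x _ => ?_⟩
    exact image_eq_zero_of_notMem_tsupport (by simp [h])
  · obtain ⟨x₀, hx₀, hmax⟩ := hK.exists_isMaxOn h continuous_abs.continuousOn
    have h1 := abs_lt.2 (hm.2.2 hx₀)
    refine ⟨(|x₀| + 1) / 2, by positivity, by linarith, fun x hx => ?_⟩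
    refine image_eq_zero_of_notMem_tsupport fun hmem => ?_
    have := hmax hmem
    simp only [Set.mem_ofPred_eq] at this
    linarith

theorem memLp_mul_test {ρ : ℝ → ℂ} (hρ : AEStronglyMeasurable ρ muI) {C : ℝ}
    (hC : ∀ x ∈ Set.Ioo (-1 : ℝ) 1, ‖ρ x‖ ≤ C) {m : ℝ → ℝ} (hm : IsTest m) :
    MemLp (fun x => ρ x * (m x : ℂ)) 2 muI := by
  obtain ⟨M, hM⟩ := hm.1.continuous.bounded_above_of_compact_support hm.2.1
  refine MemLp.of_bound (C := C * M) (hρ.mul ?_) ?_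
  · exact (Complex.continuous_ofReal.comp hm.1.continuous).aestronglyMeasurable
  · filter_upwards [ae_muI_mem] with x hx
    rw [norm_mul, Complex.norm_real]
    exact mul_le_mul (hC x hx) (hM x) (norm_nonneg _) ((norm_nonneg _).trans (hC x hx))

/-- If `f` is orthogonal to `V`, then `ρ̄ f` integrates to zero against every test function, so it
vanishes almost everywhere, and `ρ` has no zeros. The free profile `ρ` allows an inconvenient
amplitude to be cancelled. -/
theorem submodule_eq_top_of_test {ρ : ℝ → ℂ} (hρ : AEStronglyMeasurable ρ muI) {C : ℝ}
    (hC : ∀ x ∈ Set.Ioo (-1 : ℝ) 1, ‖ρ x‖ ≤ C) (h0 : ∀ x ∈ Set.Ioo (-1 : ℝ) 1, ρ x ≠ 0)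
    {V : Submodule ℂ L2Interval} (hV : IsClosed (V : Set L2Interval))
    (h : ∀ m, IsTest m → ∀ g : L2Interval, g =ᵐ[muI] (fun x => ρ x * (m x : ℂ)) → g ∈ V) :
    V = ⊤ := by
  have : CompleteSpace V := hV.completeSpace_coe
  rw [← Submodule.orthogonal_eq_bot_iff, Submodule.eq_bot_iff]
  intro f hf
  rw [Submodule.mem_orthogonal] at hf
  have hρc : MemLp (fun x => starRingEnd ℂ (ρ x)) 2 muI := by
    refine MemLp.of_bound (C := C) (Complex.continuous_conj.comp_aestronglyMeasurable hρ) ?_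
    filter_upwards [ae_muI_mem] with x hx
    simpa using hC x hx
  have hint : IntegrableOn (fun x => starRingEnd ℂ (ρ x) * f x) (Set.Ioo (-1 : ℝ) 1) :=
    integrable_mul_l2 hρc f
  have key := isOpen_Ioo.ae_eq_zero_of_integral_contDiff_smul_eq_zero (μ := volume)
    hint.locallyIntegrableOn fun m hm1 hm2 hm3 => by
      have hm : IsTest m := ⟨hm1, hm2, hm3⟩
      have hL := memLp_mul_test hρ hC hm
      have h1 := hf _ (h m hm (MemLp.toLp _ hL) hL.coeFn_toLp)
      rw [L2.inner_def] at h1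
      have h2 : ∫ x in Set.Ioo (-1 : ℝ) 1, m x • (starRingEnd ℂ (ρ x) * f x) =
          ∫ x, m x • (starRingEnd ℂ (ρ x) * f x) :=
        setIntegral_eq_integral_of_forall_compl_eq_zero fun x hx => by
          rw [image_eq_zero_of_notMem_tsupport fun hmem => hx (hm3 hmem), zero_smul]
      rw [← h2, ← h1]
      refine integral_congr_ae ?_
      filter_upwards [hL.coeFn_toLp] with x hx
      rw [hx]
      simp [mul_comm, mul_left_comm]
  refine Lp.ext ?_
  have key' : ∀ᵐ x ∂muI, starRingEnd ℂ (ρ x) * f x = 0 :=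
    (ae_restrict_iff' measurableSet_Ioo).2 key
  filter_upwards [key', ae_muI_mem, Lp.coeFn_zero ℂ 2 muI] with x h1 h2 h3
  rw [h3]
  rcases mul_eq_zero.1 h1 with h4 | h4
  · exact absurd ((map_eq_zero _).1 h4) (h0 x h2)
  · exact h4

end Closure

section Evolution

/-- The evolution `exp (-i t X)`. -/
noncomputable def evol {E : Type*} [NormedAddCommGroup E] [NormedSpace ℂ E] (X : E →L[ℂ] E)
    (t : ℝ) : E →L[ℂ] E := NormedSpace.exp ((-(Complex.I * (t : ℂ))) • X)

theorem isMultiplicationBy_evol {X : L2Interval →L[ℂ] L2Interval}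
    (hX : IsMultiplicationBy (fun x => (x : ℂ)) X) (t : ℝ) :
    IsMultiplicationBy (fun x => Complex.exp (-(Complex.I * t) * x)) (evol X t) :=
  (hX.smul _).exp

theorem norm_exp_evol (t x : ℝ) : ‖Complex.exp (-(Complex.I * t) * x)‖ = 1 := by
  have : -(Complex.I * (t : ℂ)) * (x : ℂ) = ((-(t * x) : ℝ) : ℂ) * Complex.I := by
    push_cast; ring
  rw [this, Complex.norm_exp_ofReal_mul_I]

theorem norm_evol_le {X : L2Interval →L[ℂ] L2Interval}
    (hX : IsMultiplicationBy (fun x => (x : ℂ)) X) (t : ℝ) (g : L2Interval) :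
    ‖evol X t g‖ ≤ ‖g‖ := by
  simpa using (isMultiplicationBy_evol hX t).norm_le (C := 1) (fun x _ => (norm_exp_evol t x).le) g

/-- Riemann–Lebesgue lemma at frequency `t/(2π)`. If `f g` is not integrable, both the integral and
its limit are the default value `0`. -/
theorem tendsto_integral_evol {X : L2Interval →L[ℂ] L2Interval}
    (hX : IsMultiplicationBy (fun x => (x : ℂ)) X) {l : Filter ℝ} (hl : l ≤ cocompact ℝ)
    {f : ℝ → ℂ} (g : L2Interval) :
    Tendsto (fun t => ∫ x, f x * evol X t g x ∂muI) l (𝓝 0) := by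
  have h1 := Real.tendsto_integral_exp_smul_cocompact
    ((Set.Ioo (-1 : ℝ) 1).indicator fun x => f x * g x)
  have h2 : Tendsto (fun t : ℝ => t * (2 * Real.pi)⁻¹) (cocompact ℝ) (cocompact ℝ) :=
    (Homeomorph.mulRight₀ (2 * Real.pi)⁻¹ (by positivity)).isClosedEmbedding.tendsto_cocompact
  refine ((h1.comp h2).mono_left hl).congr fun t => ?_
  simp only [Function.comp_def]
  rw [muI, ← integral_indicator measurableSet_Ioo]
  have h3 : ∫ x in Set.Ioo (-1 : ℝ) 1, f x * evol X t g x =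
      ∫ x in Set.Ioo (-1 : ℝ) 1, Real.fourierChar (-(x * (t * (2 * Real.pi)⁻¹))) • (f x * g x) := by
    refine integral_congr_ae ?_
    filter_upwards [isMultiplicationBy_evol hX t g] with x hx
    rw [hx, Circle.smul_def, Real.fourierChar_apply, smul_eq_mul]
    have : ((2 * Real.pi * -(x * (t * (2 * Real.pi)⁻¹)) : ℝ) : ℂ) * Complex.I =
        -(Complex.I * t) * x := by
      have hpi : (Real.pi : ℂ) ≠ 0 := by exact_mod_cast Real.pi_ne_zero
      push_cast
      field_simp
    rw [this]
    ring
  rw [integral_indicator measurableSet_Ioo, h3, ← integral_indicator measurableSet_Ioo]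
  congr 1
  funext x
  by_cases hx : x ∈ Set.Ioo (-1 : ℝ) 1 <;> simp [hx]

end Evolution

section StationaryPhase

theorem hasDerivAt_sqrt_one_sub_sq {x : ℝ} (hx : x ∈ Set.Ioo (-1 : ℝ) 1) :
    HasDerivAt (fun x : ℝ => √(1 - x ^ 2)) (-x * (√(1 - x ^ 2))⁻¹) x := by
  have hv := sqrt_pos_of_mem hx
  have h1 : HasDerivAt (fun x : ℝ => 1 - x ^ 2) (-(2 * x)) x := by
    simpa using (hasDerivAt_pow 2 x).const_sub 1
  have h2 := h1.sqrt (Real.sqrt_ne_zero'.1 hv.ne' |>.ne')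
  convert h2 using 1
  field_simp

/-- The point is the phase derivative `N/√(1 - x²) + s t`: for `s t ≥ 0` its two terms cannot
cancel. -/
theorem hasDerivAt_wave {s x : ℝ} (hs : s = 1 ∨ s = -1) (hx : x ∈ Set.Ioo (-1 : ℝ) 1) (t : ℝ)
    (N : ℕ) : HasDerivAt
      (fun x : ℝ => starRingEnd ℂ (zetaBd s x) ^ N * Complex.exp (-(Complex.I * t) * x))
      (-(Complex.I * s) * ((N * (√(1 - x ^ 2))⁻¹ + s * t : ℝ) : ℂ) *
        (starRingEnd ℂ (zetaBd s x) ^ N * Complex.exp (-(Complex.I * t) * x))) x := by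
  have hv := sqrt_pos_of_mem hx
  have hs2 : (s : ℂ) * s = 1 := by rcases hs with h | h <;> simp [h]
  have hvC : ((√(1 - x ^ 2) : ℝ) : ℂ) ≠ 0 := by exact_mod_cast hv.ne'
  have hw : HasDerivAt (fun x : ℝ => starRingEnd ℂ (zetaBd s x))
      (-(Complex.I * s) * ((√(1 - x ^ 2) : ℝ) : ℂ)⁻¹ * starRingEnd ℂ (zetaBd s x)) x := by
    simp only [conj_zetaBd]
    simp only [zetaBd]
    have h1 : HasDerivAt (fun x : ℝ => (x : ℂ)) 1 x := Complex.ofRealCLM.hasDerivAt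
    have h2 := (hasDerivAt_sqrt_one_sub_sq hx).ofReal_comp
    refine HasDerivAt.congr_deriv (h1.sub (h2.const_mul (Complex.I * ((-s : ℝ) : ℂ)))) ?_
    push_cast
    field_simp
    linear_combination ((√(1 - x ^ 2) : ℝ) : ℂ) * Complex.I_sq +
      ((√(1 - x ^ 2) : ℝ) : ℂ) * Complex.I ^ 2 * hs2
  have he : HasDerivAt (fun x : ℝ => Complex.exp (-(Complex.I * t) * x))
      (Complex.exp (-(Complex.I * t) * x) * (-(Complex.I * t) * 1)) x :=
    ((Complex.ofRealCLM.hasDerivAt (x := x)).const_mul (-(Complex.I * t))).cexp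
  refine HasDerivAt.congr_deriv ((hw.pow N).mul he) ?_
  simp only [Pi.pow_apply]
  push_cast
  rcases N with _ | N
  · simp only [pow_zero, Nat.cast_zero]
    linear_combination (Complex.I * t * Complex.exp (-(Complex.I * t) * x)) * hs2
  · simp only [Nat.add_sub_cancel]
    rw [pow_succ]
    linear_combination (Complex.I * t * (starRingEnd ℂ (zetaBd s x) ^ N *
      starRingEnd ℂ (zetaBd s x)) * Complex.exp (-(Complex.I * t) * x)) * hs2

theorem norm_wave {s x : ℝ} (hs : s = 1 ∨ s = -1) (hx : x ∈ Set.Ioo (-1 : ℝ) 1) (t : ℝ) (N : ℕ) :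
    ‖starRingEnd ℂ (zetaBd s x) ^ N * Complex.exp (-(Complex.I * t) * x)‖ = 1 := by
  rw [norm_mul, norm_exp_evol, norm_pow, RCLike.norm_conj, norm_zetaBd hs hx]
  simp

/-- One integration by parts against a phase whose derivative `q` satisfies `q ≥ N`. The constant
does not depend on `t`, which is what makes domination in `ℓ²` possible. -/
theorem exists_bound_test_integral {s : ℝ} (hs : s = 1 ∨ s = -1) {m : ℝ → ℝ} (hm : IsTest m) :
    ∃ C, ∀ (N : ℕ) (t : ℝ), 0 < N → 0 ≤ s * t →
      ‖∫ x, starRingEnd ℂ (zetaBd s x) ^ N * Complex.exp (-(Complex.I * t) * x) * (m x : ℂ) ∂muI‖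
        ≤ C / N := by
  obtain ⟨c, hc0, hc1, hcm⟩ := hm.exists_radius
  obtain ⟨M₀, hM₀⟩ := hm.1.continuous.bounded_above_of_compact_support hm.2.1
  have hm' : Continuous (deriv m) := hm.1.continuous_deriv (by norm_num)
  obtain ⟨M₁, hM₁⟩ := hm'.bounded_above_of_compact_support hm.2.1.deriv
  have hmd : ∀ x, HasDerivAt m (deriv m x) x := fun x =>
    (hm.1.differentiable (by norm_num) x).hasDerivAt
  have hsub : ∀ x ∈ Set.uIcc (-c) c, x ∈ Set.Ioo (-1 : ℝ) 1 := fun x hx => by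
    rw [Set.uIcc_of_le (by linarith)] at hx
    exact ⟨by linarith [hx.1], by linarith [hx.2]⟩
  have hM00 : 0 ≤ M₀ := (norm_nonneg _).trans (hM₀ 0)
  have hM10 : 0 ≤ M₁ := (norm_nonneg _).trans (hM₁ 0)
  set vc := √(1 - c ^ 2) with hvc
  have hvc0 : 0 < vc := sqrt_pos_of_mem ⟨by linarith, hc1⟩
  -- `M₁` bounds the term `m'/q`, `M₀/vc` bounds `m q'/q²`, both up to `1/N`; `2 c` is the length of
  -- the interval.
  refine ⟨(M₁ + M₀ / vc) * (2 * c), fun N t hN hst => ?_⟩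
  have hNR : (0 : ℝ) < N := by exact_mod_cast hN
  set τ := s * t with hτ
  set r : ℝ → ℝ := fun x => (√(1 - x ^ 2))⁻¹ with hr
  set q : ℝ → ℝ := fun x => N * r x + τ with hq
  set y : ℝ → ℂ := fun x => starRingEnd ℂ (zetaBd s x) ^ N * Complex.exp (-(Complex.I * t) * x)
    with hy
  set U' : ℝ → ℝ := fun x => (deriv m x * q x - m x * (N * (x * r x ^ 3))) / q x ^ 2 with hU'
  have hrpos : ∀ x ∈ Set.Ioo (-1 : ℝ) 1, 0 < r x := fun x hx => inv_pos.2 (sqrt_pos_of_mem hx)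
  have hr1 : ∀ x ∈ Set.Ioo (-1 : ℝ) 1, 1 ≤ r x := fun x hx => by
    refine (one_le_inv₀ (sqrt_pos_of_mem hx)).2 ?_
    exact Real.sqrt_le_iff.2 ⟨zero_le_one, by nlinarith [sq_nonneg x]⟩
  have hqpos : ∀ x ∈ Set.Ioo (-1 : ℝ) 1, 0 < q x := fun x hx => by
    have := mul_pos hNR (hrpos x hx)
    simp only [hq]; linarith
  have hrd : ∀ x ∈ Set.Ioo (-1 : ℝ) 1, HasDerivAt r (x * r x ^ 3) x := fun x hx => by
    refine ((hasDerivAt_sqrt_one_sub_sq hx).inv (sqrt_pos_of_mem hx).ne').congr_deriv ?_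
    have := sqrt_pos_of_mem hx
    simp only [hr]
    field_simp
  have hqd : ∀ x ∈ Set.Ioo (-1 : ℝ) 1, HasDerivAt q (N * (x * r x ^ 3)) x := fun x hx =>
    ((hrd x hx).const_mul (N : ℝ)).add_const τ
  -- The function `U = i s m / q` is chosen so that `U y' = m y`, since `y' = -i s q y`.
  have hUd : ∀ x ∈ Set.uIcc (-c) c, HasDerivAt (fun x => Complex.I * s * ((m x / q x : ℝ) : ℂ))
      (Complex.I * s * (U' x : ℂ)) x := fun x hx =>
    (((hmd x).div (hqd x (hsub x hx)) (hqpos x (hsub x hx)).ne').ofReal_comp).const_mul _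
  have hyd : ∀ x ∈ Set.uIcc (-c) c, HasDerivAt y (-(Complex.I * s) * (q x : ℂ) * y x) x :=
    fun x hx => hasDerivAt_wave hs (hsub x hx) t N
  have hrc : ContinuousOn r (Set.uIcc (-c) c) := fun x hx =>
    (hrd x (hsub x hx)).continuousAt.continuousWithinAt
  have hqc : ContinuousOn q (Set.uIcc (-c) c) := fun x hx =>
    (hqd x (hsub x hx)).continuousAt.continuousWithinAt
  have hyc : ContinuousOn y (Set.uIcc (-c) c) := fun x hx =>
    (hyd x hx).continuousAt.continuousWithinAt
  have hmc : Continuous m := hm.1.continuous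
  have hU'c : ContinuousOn U' (Set.uIcc (-c) c) := by
    refine ContinuousOn.div (by fun_prop) (hqc.pow 2) fun x hx => ?_
    exact pow_ne_zero 2 (hqpos x (hsub x hx)).ne'
  have hparts := intervalIntegral.integral_mul_deriv_eq_deriv_mul hUd hyd
    (ContinuousOn.intervalIntegrable (by fun_prop)) (ContinuousOn.intervalIntegrable (by fun_prop))
  have hmc1 : m c = 0 := hcm c (le_abs_self c)
  have hmc2 : m (-c) = 0 := hcm (-c) (by rw [abs_neg]; exact le_abs_self c)
  rw [hmc1, hmc2] at hparts
  simp only [zero_div, Complex.ofReal_zero, mul_zero, zero_mul, sub_zero, zero_sub] at hparts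
  have hI1 : ∫ x, y x * (m x : ℂ) ∂muI = ∫ x in (-c)..c, y x * (m x : ℂ) := by
    rw [intervalIntegral.integral_of_le (by linarith)]
    refine setIntegral_eq_of_subset_of_forall_sdiff_eq_zero measurableSet_Ioo
      (fun x hx => ⟨by linarith [hx.1], by linarith [hx.2]⟩) fun x hx => ?_
    have : m x = 0 := hcm x (by
      by_contra hcon
      push Not at hcon
      have := abs_lt.1 hcon
      exact hx.2 ⟨this.1, this.2.le⟩)
    rw [this]; simp
  have hI2 : ∫ x in (-c)..c, y x * (m x : ℂ) = ∫ x in (-c)..c,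
      Complex.I * s * ((m x / q x : ℝ) : ℂ) * (-(Complex.I * s) * (q x : ℂ) * y x) := by
    refine intervalIntegral.integral_congr fun x hx => ?_
    have hqC : (q x : ℂ) ≠ 0 := by exact_mod_cast (hqpos x (hsub x hx)).ne'
    have hs2 : (s : ℂ) * s = 1 := by rcases hs with h | h <;> simp [h]
    push_cast
    field_simp
    linear_combination (y x * m x) * Complex.I_sq + (y x * m x * Complex.I ^ 2) * hs2
  have hmain : ‖∫ x in (-c)..c, Complex.I * s * (U' x : ℂ) * y x‖ ≤
      (M₁ / N + M₀ / (vc * N)) * |c - -c| := by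
    refine intervalIntegral.norm_integral_le_of_norm_le_const fun x hx => ?_
    have hx' : x ∈ Set.uIcc (-c) c := Set.uIoc_subset_uIcc hx
    have hxI := hsub x hx'
    have hn : ‖y x‖ = 1 := norm_wave hs hxI t N
    have hs1 : ‖Complex.I * (s : ℂ)‖ = 1 := by rcases hs with h | h <;> simp [h]
    rw [norm_mul, norm_mul, hn, hs1, one_mul, mul_one, Complex.norm_real]
    have hq0 := hqpos x hxI
    have hr0 := hrpos x hxI
    have e1 : U' x = deriv m x / q x - m x * (x * (N * r x ^ 3 / q x ^ 2)) := by
      simp only [hU']; field_simp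
    have hqN : N * r x ≤ q x := by simp only [hq]; linarith
    have hqN1 : (N : ℝ) ≤ q x := (le_mul_of_one_le_right hNR.le (hr1 x hxI)).trans hqN
    have hrvc : r x ≤ vc⁻¹ := by
      refine inv_anti₀ hvc0 (Real.sqrt_le_sqrt ?_)
      rw [Set.uIcc_of_le (by linarith)] at hx'
      nlinarith [hx'.1, hx'.2]
    have e2 : N * r x ^ 3 / q x ^ 2 ≤ vc⁻¹ / N := by
      have h1 : (N * r x) ^ 2 ≤ q x ^ 2 := pow_le_pow_left₀ (by positivity) hqN 2
      rw [div_le_div_iff₀ (by positivity) hNR]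
      calc N * r x ^ 3 * N = r x * (N * r x) ^ 2 := by ring
        _ ≤ vc⁻¹ * q x ^ 2 := mul_le_mul hrvc h1 (by positivity) (by positivity)
    have e3 : 0 ≤ N * r x ^ 3 / q x ^ 2 := by positivity
    rw [e1]
    refine (norm_sub_le _ _).trans (add_le_add ?_ ?_)
    · rw [norm_div, Real.norm_of_nonneg hq0.le]
      exact div_le_div₀ hM10 (hM₁ x) hNR hqN1
    · rw [norm_mul, norm_mul, Real.norm_of_nonneg e3]
      have hx1 : ‖x‖ ≤ 1 := abs_le.2 ⟨hxI.1.le, hxI.2.le⟩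
      have e4 : ‖x‖ * (N * r x ^ 3 / q x ^ 2) ≤ vc⁻¹ / N :=
        (mul_le_of_le_one_left e3 hx1).trans e2
      refine (mul_le_mul (hM₀ x) e4 (by positivity) hM00).trans_eq ?_
      field_simp
  rw [hI1, hI2, hparts, norm_neg]
  refine hmain.trans_eq ?_
  rw [abs_of_pos (by linarith)]
  field_simp
  ring

theorem kappa_ne_zero {s x : ℝ} (hs : s = 1 ∨ s = -1) (hx : x ∈ Set.Ioo (-1 : ℝ) 1) :
    kappa s x ≠ 0 :=
  div_ne_zero (by exact_mod_cast (ampFree_pos hx).ne') (zetaBd_sub_conj_ne_zero hs hx)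

theorem continuous_zetaBd (s : ℝ) : Continuous (zetaBd s) := by unfold zetaBd; fun_prop

theorem measurable_kappa (s : ℝ) : Measurable (kappa s) := by
  have h1 := continuous_zetaBd s
  have h2 : Continuous fun x => (ampFree x : ℂ) := Complex.continuous_ofReal.comp continuous_ampFree
  have h3 : Continuous fun x => starRingEnd ℂ (zetaBd s x) := Complex.continuous_conj.comp h1
  exact h2.measurable.div (h1.sub h3).measurable

/-- `|κ|⁻² = 2π √(1 - x²) < 9`. -/
theorem norm_kappa_inv_le {s x : ℝ} (hs : s = 1 ∨ s = -1) (hx : x ∈ Set.Ioo (-1 : ℝ) 1) :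
    ‖(kappa s x)⁻¹‖ ≤ 3 := by
  have hv := sqrt_pos_of_mem hx
  have ha := ampFree_pos hx
  have ha2 := ampFree_sq x
  have hv1 : √(1 - x ^ 2) ≤ 1 := by
    exact Real.sqrt_le_iff.2 ⟨zero_le_one, by nlinarith [sq_nonneg x]⟩
  have hs1 : ‖(s : ℂ)‖ = 1 := by rcases hs with h | h <;> simp [h]
  rw [kappa, inv_div, norm_div, zetaBd_sub_conj, norm_neg, norm_mul, norm_mul, norm_mul, hs1,
    Complex.norm_I, Complex.norm_real, Complex.norm_real, Real.norm_of_nonneg hv.le,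
    Real.norm_of_nonneg ha.le, div_le_iff₀ ha]
  norm_num
  have hpi := Real.pi_lt_d2
  have hpi0 := Real.pi_pos
  have h1 : (2 * √(1 - x ^ 2)) ^ 2 ≤ (3 * ampFree x) ^ 2 := by
    rw [mul_pow 3, ha2]
    have h2 : (5 : ℝ) / 9 ≤ 2 / Real.pi := by
      rw [div_le_div_iff₀ (by norm_num) hpi0]; linarith
    nlinarith
  exact le_of_sq_le_sq h1 (by positivity)

/-- Free outgoing waves leave the half-line `ℤ₊`. -/
theorem tendsto_wave_evol {s : ℝ} (hs : s = 1 ∨ s = -1) {A : L2Interval →L[ℂ] Ell2}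
    (hA : IsAnalysis (fun n x => kappa s x * starRingEnd ℂ (zetaBd s x) ^ (n + 1)) A)
    (hA1 : ∀ g, ‖A g‖ ≤ ‖g‖) {X : L2Interval →L[ℂ] L2Interval}
    (hX : IsMultiplicationBy (fun x => (x : ℂ)) X) {l : Filter ℝ} (hl : l ≤ cocompact ℝ)
    (hls : ∀ᶠ t in l, 0 ≤ s * t) (k : L2Interval) :
    Tendsto (fun t => A (evol X t k)) l (𝓝 0) := by
  obtain ⟨V, hV, hVm⟩ := tendsto_zero_of_submodule (l := l) (fun t => A ∘L evol X t) (C := 1)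
    fun t g => by simpa using (hA1 _).trans (norm_evol_le hX t g)
  have htop : V = ⊤ := by
    -- On vectors `κ⁻¹ m` the amplitude cancels and the coefficients become the test integrals with
    -- `N = n + 1`.
    refine submodule_eq_top_of_test (ρ := fun x => (kappa s x)⁻¹)
      (measurable_kappa s).inv.aestronglyMeasurable (fun x hx => norm_kappa_inv_le hs hx)
      (fun x hx => inv_ne_zero (kappa_ne_zero hs hx)) hV fun m hm g hg => ?_
    rw [hVm]
    obtain ⟨C, hC⟩ := exists_bound_test_integral hs hm
    -- Non-stationary phase supplies the square-summable majorant, Riemann–Lebesgue the convergence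
    -- of each coefficient.
    refine tendsto_ell2_zero_of_dominated (B := fun n => C / (n + 1 : ℕ)) ?_ ?_ fun n => ?_
    · simp only [div_pow]
      simp only [div_eq_mul_inv]
      refine Summable.mul_left _ ?_
      have := (summable_nat_add_iff 1).2 (Real.summable_nat_pow_inv.2 (one_lt_two))
      simpa using this
    · filter_upwards [hls] with t ht n
      rw [ContinuousLinearMap.comp_apply, hA]
      refine le_trans (le_of_eq ?_) (hC (n + 1) t n.succ_pos ht)
      congr 1
      refine integral_congr_ae ?_
      filter_upwards [isMultiplicationBy_evol hX t g, hg, ae_muI_mem] with x h1 h2 h3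
      rw [h1, h2]
      have := kappa_ne_zero hs h3
      field_simp
    · simp only [ContinuousLinearMap.comp_apply, hA _ n]
      exact tendsto_integral_evol hX hl g
  exact (hVm k).1 (htop ▸ Submodule.mem_top)

end StationaryPhase

/-! ### Unitarity of the evolution, intertwining, and the phase of the Jost function. -/

namespace JacobiMatrix

variable (J : JacobiMatrix)

theorem op_single (k n : ℕ) : J.op (lp.single 2 k (1 : ℂ)) n =
    (if n = k then (J.b n : ℂ) else 0) + (if n + 1 = k then (J.a n : ℂ) else 0) +
      (if n = k + 1 then (J.a k : ℂ) else 0) := by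
  rw [op_apply]
  cases n with
  | zero =>
    simp only [act, lp.single_apply, Pi.single_apply]
    split_ifs <;> first | omega | contradiction | simp
  | succ n =>
    simp only [act, lp.single_apply, Pi.single_apply]
    split_ifs <;> first | omega | (subst_vars; simp)

theorem isSelfAdjoint_op : IsSelfAdjoint J.op := by
  rw [ContinuousLinearMap.isSelfAdjoint_iff']
  refine ell2_ext_of_single fun n => ?_
  ext k
  have h1 : ContinuousLinearMap.adjoint J.op (lp.single 2 n (1 : ℂ)) k =
      inner ℂ (lp.single 2 k (1 : ℂ)) (ContinuousLinearMap.adjoint J.op (lp.single 2 n (1 : ℂ))) := by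
    rw [lp.inner_single_left]; simp
  rw [h1, ContinuousLinearMap.adjoint_inner_right, lp.inner_single_right, op_single, op_single]
  simp only [RCLike.inner_apply, map_add, apply_ite (starRingEnd ℂ), Complex.conj_ofReal, map_zero,
    one_mul]
  split_ifs <;> first | omega | (subst_vars; simp)

theorem exp_smul_op_mem_unitary (t : ℝ) :
    NormedSpace.exp ((Complex.I * (t : ℂ)) • J.op) ∈ unitary (Ell2 →L[ℂ] Ell2) := by
  let _ := NormedAlgebra.restrictScalars ℚ ℂ (Ell2 →L[ℂ] Ell2)
  refine NormedSpace.exp_mem_unitary_of_mem_skewAdjoint ?_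
  rw [skewAdjoint.mem_iff, star_smul, J.isSelfAdjoint_op.star_eq]
  simp

theorem norm_exp_op (t : ℝ) (u : Ell2) :
    ‖NormedSpace.exp ((Complex.I * (t : ℂ)) • J.op) u‖ = ‖u‖ := by
  have h := Unitary.star_mul_self_of_mem (J.exp_smul_op_mem_unitary t)
  rw [ContinuousLinearMap.star_eq_adjoint] at h
  exact (ContinuousLinearMap.norm_map_iff_adjoint_comp_self _).2 h u

theorem norm_evol_op (t : ℝ) (u : Ell2) : ‖evol J.op t u‖ = ‖u‖ := by
  have e : -(Complex.I * (t : ℂ)) = Complex.I * ((-t : ℝ) : ℂ) := by push_cast; ring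
  rw [evol, e, J.norm_exp_op]

theorem exp_mul_evol_op (t : ℝ) (u : Ell2) :
    NormedSpace.exp ((Complex.I * (t : ℂ)) • J.op) (evol J.op t u) = u := by
  let _ := NormedAlgebra.restrictScalars ℚ ℂ (Ell2 →L[ℂ] Ell2)
  have h : NormedSpace.exp ((Complex.I * (t : ℂ)) • J.op) * evol J.op t = 1 := by
    rw [evol, neg_smul, ← NormedSpace.exp_add_of_commute (Commute.refl _).neg_right, add_neg_cancel,
      NormedSpace.exp_zero]
  exact DFunLike.congr_fun h u

/-- The Jacobi operator becomes multiplication by `x` in the representation by the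
polynomials `P n`. -/
theorem op_analysis {r : ℝ → ℂ} (hr : ∀ n, MemLp (fun x => r x * (J.P n x : ℂ)) 2 muI)
    {A : L2Interval →L[ℂ] Ell2} (hA : IsAnalysis (fun n x => r x * (J.P n x : ℂ)) A)
    {X : L2Interval →L[ℂ] L2Interval} (hX : IsMultiplicationBy (fun x => (x : ℂ)) X)
    (g : L2Interval) : J.op (A g) = A (X g) := by
  ext n
  rw [op_apply]
  have hi := fun n => integrable_mul_l2 (hr n) g
  have ha : ∀ n, (J.a n : ℂ) ≠ 0 := fun n => by exact_mod_cast (J.a_pos n).ne'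
  cases n with
  | zero =>
    simp only [act, hA _ _]
    rw [← integral_const_mul, ← integral_const_mul,
      ← integral_add ((hi 0).const_mul _) ((hi 1).const_mul _)]
    refine integral_congr_ae ?_
    filter_upwards [hX g] with x hx
    rw [hx]
    have := ha 0
    simp only [P]
    push_cast
    field_simp
    ring
  | succ n =>
    simp only [act, hA _ _]
    have h1 : Integrable (fun x => (J.a n : ℂ) * (r x * (J.P n x : ℂ) * g x) +
        (J.b (n + 1) : ℂ) * (r x * (J.P (n + 1) x : ℂ) * g x)) muI :=
      ((hi n).const_mul _).add ((hi (n + 1)).const_mul _)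
    rw [← integral_const_mul, ← integral_const_mul, ← integral_const_mul,
      ← integral_add ((hi n).const_mul _) ((hi (n + 1)).const_mul _),
      ← integral_add h1 ((hi (n + 2)).const_mul _)]
    refine integral_congr_ae ?_
    filter_upwards [hX g] with x hx
    rw [hx]
    have := ha (n + 1)
    simp only [P]
    push_cast
    field_simp
    ring

theorem evol_analysis {r : ℝ → ℂ} (hr : ∀ n, MemLp (fun x => r x * (J.P n x : ℂ)) 2 muI)
    {A : L2Interval →L[ℂ] Ell2} (hA : IsAnalysis (fun n x => r x * (J.P n x : ℂ)) A)
    {X : L2Interval →L[ℂ] L2Interval} (hX : IsMultiplicationBy (fun x => (x : ℂ)) X)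
    (t : ℝ) (g : L2Interval) : evol J.op t (A g) = A (evol X t g) :=
  exp_intertwine (J.op_analysis hr hA hX) _ g

/-- The boundary values of the Jost function. -/
noncomputable def omegaBd (s x : ℝ) : ℂ := J.jostOmega (zetaBd s x)

/-- The phase of the Jost function. -/
noncomputable def phase (s x : ℝ) : ℂ := J.omegaBd s x / (‖J.omegaBd s x‖ : ℂ)

variable {J}

theorem continuousOn_omegaBd (hTr : J.TraceCondition) {s : ℝ} (hs : s = 1 ∨ s = -1) :
    ContinuousOn (J.omegaBd s) (Set.Ioo (-1) 1) :=
  (J.continuousOn_jostOmega hTr).comp (continuous_zetaBd s).continuousOn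
    fun _ hx => zetaBd_mem_puncturedDisc hs hx

theorem omegaBd_ne_zero (hTr : J.TraceCondition) {s x : ℝ} (hs : s = 1 ∨ s = -1)
    (hx : x ∈ Set.Ioo (-1 : ℝ) 1) : J.omegaBd s x ≠ 0 := J.jostOmega_ne_zero hTr hs hx

/-- The weight is defined from the upper side only; conjugation symmetry of `Ω` makes it serve both
signs. -/
theorem norm_jostPlus (hTr : J.TraceCondition) {s x : ℝ} (hs : s = 1 ∨ s = -1)
    (hx : x ∈ Set.Ioo (-1 : ℝ) 1) : ‖J.jostPlus x‖ = ‖J.omegaBd s x‖ := by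
  rw [J.jostPlus_eq hTr hx]
  rcases hs with h | h
  · rw [h]; rfl
  · subst h
    have hd := zetaBd_mem_puncturedDisc (Or.inl rfl) hx
    rw [omegaBd, ← conj_zetaBd, J.jostOmega_conj hTr hd.1 hd.2, RCLike.norm_conj]

theorem norm_phase (hTr : J.TraceCondition) {s x : ℝ} (hs : s = 1 ∨ s = -1)
    (hx : x ∈ Set.Ioo (-1 : ℝ) 1) : ‖J.phase s x‖ = 1 := by
  have := omegaBd_ne_zero hTr hs hx
  rw [phase, norm_div, Complex.norm_real, norm_norm, div_self (norm_ne_zero_iff.2 this)]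

theorem phase_mul_conj (hTr : J.TraceCondition) {s x : ℝ} (hs : s = 1 ∨ s = -1)
    (hx : x ∈ Set.Ioo (-1 : ℝ) 1) : J.phase s x * starRingEnd ℂ (J.phase s x) = 1 := by
  rw [Complex.mul_conj, Complex.normSq_eq_norm_sq, norm_phase hTr hs hx]; simp

theorem continuousOn_phase (hTr : J.TraceCondition) {s : ℝ} (hs : s = 1 ∨ s = -1) :
    ContinuousOn (J.phase s) (Set.Ioo (-1) 1) := by
  have h := continuousOn_omegaBd hTr hs
  refine h.div (Complex.continuous_ofReal.comp_continuousOn h.norm) fun x hx => ?_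
  simpa using omegaBd_ne_zero hTr hs hx

theorem sqrt_weight (hTr : J.TraceCondition) {s x : ℝ} (hs : s = 1 ∨ s = -1)
    (hx : x ∈ Set.Ioo (-1 : ℝ) 1) : √(J.weight x) = ampFree x / ‖J.omegaBd s x‖ := by
  rw [weight, norm_jostPlus hTr hs hx, Real.sqrt_mul (by positivity), Real.sqrt_inv,
    Real.sqrt_sq (norm_nonneg _)]
  rfl

theorem continuousOn_sqrt_weight (hTr : J.TraceCondition) :
    ContinuousOn (fun x => √(J.weight x)) (Set.Ioo (-1) 1) := by
  have h := continuousOn_omegaBd hTr (Or.inl rfl)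
  refine (continuous_ampFree.continuousOn.div h.norm fun x hx => ?_).congr
    fun x hx => sqrt_weight hTr (Or.inl rfl) hx
  exact norm_ne_zero_iff.2 (omegaBd_ne_zero hTr (Or.inl rfl) hx)

theorem continuousOn_psi (hTr : J.TraceCondition) (n : ℕ) :
    ContinuousOn (J.psi n) (Set.Ioo (-1) 1) :=
  (continuousOn_sqrt_weight hTr).mul (J.continuous_P n).continuousOn

/-- Multiply `P_eq_jost` by `κ Ω/|Ω|²`. The factor `σ` is exactly what makes the coefficient of
`ζⁿ⁺¹` equal to the free one, so that all scattering data sit on the wave `ζ̄ⁿ⁺¹` that disappears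
for `s t → +∞`. -/
theorem phase_mul_psi (hTr : J.TraceCondition) {s x : ℝ} (hs : s = 1 ∨ s = -1)
    (hx : x ∈ Set.Ioo (-1 : ℝ) 1) (n : ℕ) : J.phase s x * (J.psi n x : ℂ) =
      kappa s x * (zetaBd s x ^ (n + 1) * J.jostP (zetaBd s x) n -
        starRingEnd ℂ (zetaBd s x) ^ (n + 1) * J.phase s x ^ 2 *
          starRingEnd ℂ (J.jostP (zetaBd s x) n)) := by
  have hΩ := omegaBd_ne_zero hTr hs hx
  have hP := J.P_eq_jost hTr hs hx n
  have hne := zetaBd_sub_conj_ne_zero hs hx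
  have hN : (‖J.omegaBd s x‖ : ℂ) ≠ 0 := by exact_mod_cast norm_ne_zero_iff.2 hΩ
  have hNN : J.omegaBd s x * starRingEnd ℂ (J.omegaBd s x) = (‖J.omegaBd s x‖ : ℂ) ^ 2 := by
    rw [Complex.mul_conj, Complex.normSq_eq_norm_sq]; push_cast; rfl
  change (J.P n x : ℂ) * (zetaBd s x - starRingEnd ℂ (zetaBd s x)) =
    zetaBd s x ^ (n + 1) * starRingEnd ℂ (J.omegaBd s x) * J.jostP (zetaBd s x) n
      - starRingEnd ℂ (zetaBd s x) ^ (n + 1) * J.omegaBd s x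
        * starRingEnd ℂ (J.jostP (zetaBd s x) n) at hP
  rw [psi, sqrt_weight hTr hs hx, kappa, phase]
  generalize starRingEnd ℂ (J.jostP (zetaBd s x) n) = q at *
  generalize J.jostP (zetaBd s x) n = p at *
  generalize starRingEnd ℂ (J.omegaBd s x) = Ω' at *
  push_cast
  generalize (‖J.omegaBd s x‖ : ℂ) = N at *
  generalize J.omegaBd s x = Ω at *
  generalize (J.P n x : ℂ) = Pn at *
  generalize starRingEnd ℂ (zetaBd s x) = w at *
  generalize zetaBd s x = ζ at *
  field_simp
  linear_combination (ampFree x * Ω : ℂ) * hP + (ampFree x * ζ ^ (n + 1) * p : ℂ) * hNN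

theorem psiFree_eq_kappa {s x : ℝ} (hs : s = 1 ∨ s = -1) (hx : x ∈ Set.Ioo (-1 : ℝ) 1) (n : ℕ) :
    (psiFree n x : ℂ) = kappa s x * (zetaBd s x ^ (n + 1) -
      starRingEnd ℂ (zetaBd s x) ^ (n + 1)) := by
  have h := free_P_eq hs hx n
  have hne := zetaBd_sub_conj_ne_zero hs hx
  have hp : (psiFree n x : ℂ) = ampFree x * JacobiMatrix.free.P n x := by
    simp only [psiFree, ampFree]; push_cast; rfl
  rw [hp, ← h, kappa]
  field_simp

end JacobiMatrix

/-! ### The expansion cut off to `[-c, c]`. -/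

/-- The indicator function of `[-c, c]`. -/
noncomputable def cutoff (c x : ℝ) : ℂ := (Set.Icc (-c) c).indicator (fun _ => 1) x

theorem cutoff_of_mem {c x : ℝ} (h : x ∈ Set.Icc (-c) c) : cutoff c x = 1 := by simp [cutoff, h]

theorem cutoff_of_notMem {c x : ℝ} (h : x ∉ Set.Icc (-c) c) : cutoff c x = 0 := by
  rw [cutoff, Set.indicator_of_notMem h]

theorem measurable_cutoff (c : ℝ) : Measurable (cutoff c) :=
  measurable_const.indicator measurableSet_Icc

theorem norm_cutoff_le (c x : ℝ) : ‖cutoff c x‖ ≤ 1 := by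
  by_cases h : x ∈ Set.Icc (-c) c
  · simp [cutoff_of_mem h]
  · simp [cutoff_of_notMem h]

theorem conj_cutoff (c x : ℝ) : starRingEnd ℂ (cutoff c x) = cutoff c x := by
  by_cases h : x ∈ Set.Icc (-c) c
  · simp [cutoff_of_mem h]
  · simp [cutoff_of_notMem h]

/-- Both come from `|1 - ζ²| = |ζ - ζ̄| = 2√(1 - x²)`. The second bound puts the boundary values
over `[-c,c]` into one region `jostRegion L`. -/
theorem norm_kappa_le {s c x : ℝ} (hs : s = 1 ∨ s = -1) (hc : c < 1)
    (hx : x ∈ Set.Icc (-c) c) : ‖kappa s x‖ ≤ (√(1 - c ^ 2))⁻¹ ∧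
      ‖(1 - zetaBd s x ^ 2)⁻¹‖ ≤ (√(1 - c ^ 2))⁻¹ := by
  have hxI : x ∈ Set.Ioo (-1 : ℝ) 1 := ⟨by linarith [hx.1], by linarith [hx.2]⟩
  have hc0 : 0 ≤ c := by linarith [hx.1, hx.2]
  have hvc := sqrt_pos_of_mem (x := c) ⟨by linarith, hc⟩
  have hv := sqrt_pos_of_mem hxI
  have hvv : √(1 - c ^ 2) ≤ √(1 - x ^ 2) := Real.sqrt_le_sqrt (by nlinarith [hx.1, hx.2])
  have hs1 : ‖(s : ℂ)‖ = 1 := by rcases hs with h | h <;> simp [h]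
  have hn : ‖zetaBd s x - starRingEnd ℂ (zetaBd s x)‖ = 2 * √(1 - x ^ 2) := by
    rw [zetaBd_sub_conj, norm_neg, norm_mul, norm_mul, norm_mul, hs1,
      Complex.norm_I, Complex.norm_real, Real.norm_of_nonneg hv.le]
    norm_num
  have hle : √(1 - c ^ 2) ≤ 2 * √(1 - x ^ 2) := by linarith
  constructor
  · have ha : ampFree x ≤ 1 := by
      have hv1 : √(1 - x ^ 2) ≤ 1 := Real.sqrt_le_iff.2 ⟨zero_le_one, by nlinarith [sq_nonneg x]⟩
      refine Real.sqrt_le_iff.2 ⟨zero_le_one, ?_⟩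
      have : 2 / Real.pi ≤ 1 := by
        rw [div_le_one Real.pi_pos]; exact Real.two_le_pi
      nlinarith [Real.pi_pos]
    rw [kappa, norm_div, hn, Complex.norm_real, Real.norm_of_nonneg (ampFree_pos hxI).le,
      ← one_div]
    exact div_le_div₀ zero_le_one ha hvc hle
  · rw [one_sub_zetaBd_sq hs hxI, norm_inv, norm_neg, norm_mul, norm_zetaBd hs hxI, one_mul, hn]
    exact inv_anti₀ hvc hle

theorem eLpNorm_muI_toReal_le {f : ℝ → ℂ} {C : ℝ} (hC : 0 ≤ C)
    (hf : ∀ x ∈ Set.Ioo (-1 : ℝ) 1, ‖f x‖ ≤ C) :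
    (eLpNorm f 2 muI).toReal ≤ (muI Set.univ ^ ((2 : ENNReal).toReal)⁻¹).toReal * C := by
  have h := eLpNorm_le_of_ae_bound (p := 2) (μ := muI) (f := f) (ae_muI_mem.mono hf)
  have hfin : muI Set.univ ^ ((2 : ENNReal).toReal)⁻¹ ≠ ⊤ :=
    ENNReal.rpow_ne_top_of_nonneg (by positivity) (measure_ne_top _ _)
  have h2 := ENNReal.toReal_mono (ENNReal.mul_ne_top hfin ENNReal.ofReal_ne_top) h
  rwa [ENNReal.toReal_mul, ENNReal.toReal_ofReal hC] at h2

theorem aestronglyMeasurable_muI {f : ℝ → ℂ} (hf : ContinuousOn f (Set.Ioo (-1) 1)) :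
    AEStronglyMeasurable f muI := hf.aestronglyMeasurable measurableSet_Ioo

namespace JacobiMatrix

variable {J : JacobiMatrix}

theorem continuousOn_psi_ofReal (hTr : J.TraceCondition) (n : ℕ) :
    ContinuousOn (fun x => (J.psi n x : ℂ)) (Set.Ioo (-1) 1) :=
  Complex.continuous_ofReal.comp_continuousOn (continuousOn_psi hTr n)

theorem memLp_cutoff_psi (hTr : J.TraceCondition) {c : ℝ} (hc : c < 1) (n : ℕ) :
    MemLp (fun x => cutoff c x * (J.psi n x : ℂ)) 2 muI := by
  have hsub : Set.Icc (-c) c ⊆ Set.Ioo (-1 : ℝ) 1 := fun x hx =>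
    ⟨by linarith [hx.1], by linarith [hx.2]⟩
  obtain ⟨C, hC⟩ := isCompact_Icc.exists_bound_of_continuousOn
    ((continuousOn_psi_ofReal hTr n).mono hsub)
  refine MemLp.of_bound (C := |C|) ((measurable_cutoff c).aestronglyMeasurable.mul
    (aestronglyMeasurable_muI (continuousOn_psi_ofReal hTr n))) (Eventually.of_forall fun x => ?_)
  by_cases h : x ∈ Set.Icc (-c) c
  · rw [cutoff_of_mem h, one_mul]
    exact (hC x h).trans (le_abs_self C)
  · rw [cutoff_of_notMem h]; simp

/-- The part of `σ ψ n` that is neither the free wave nor the departing wave. -/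
noncomputable def remainder (J : JacobiMatrix) (s c : ℝ) (n : ℕ) (x : ℝ) : ℂ :=
  cutoff c x * (J.phase s x * (J.psi n x : ℂ) - (psiFree n x : ℂ) +
    (J.phase s x ^ 2 - 1) * (kappa s x * starRingEnd ℂ (zetaBd s x) ^ (n + 1)))

/-- The leading terms of both waves cancel, leaving `κ (ζⁿ⁺¹ (pₙ - 1) - ζ̄ⁿ⁺¹ σ² (p̄ₙ - 1))`. -/
theorem exists_remainder_bound (hTr : J.TraceCondition) {s c : ℝ} (hs : s = 1 ∨ s = -1)
    (hc : c < 1) : ∃ C, 0 ≤ C ∧ ∀ n, ∀ x ∈ Set.Ioo (-1 : ℝ) 1,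
      ‖J.remainder s c n x‖ ≤ C * J.rho n := by
  obtain ⟨C, hC0, hC⟩ := J.exists_norm_jostP_sub_one_le hTr (√(1 - c ^ 2))⁻¹
  refine ⟨(√(1 - c ^ 2))⁻¹ * (2 * C), by positivity, fun n x hxI => ?_⟩
  have hρ := J.rho_nonneg n
  by_cases h : x ∈ Set.Icc (-c) c
  swap
  · rw [remainder, cutoff_of_notMem h, zero_mul, norm_zero]; positivity
  obtain ⟨hk, hz⟩ := norm_kappa_le hs hc h
  have hd := zetaBd_mem_puncturedDisc hs hxI
  have hp := (hC (zetaBd s x) ⟨hd.1, hd.2, hz⟩ n).2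
  rw [remainder, cutoff_of_mem h, one_mul, phase_mul_psi hTr hs hxI, psiFree_eq_kappa hs hxI]
  have hph := norm_phase hTr hs hxI
  have hζ := norm_zetaBd hs hxI
  have hq : ‖starRingEnd ℂ (J.jostP (zetaBd s x) n) - 1‖ ≤ C * J.rho n := by
    have : starRingEnd ℂ (J.jostP (zetaBd s x) n) - 1 =
      starRingEnd ℂ (J.jostP (zetaBd s x) n - 1) := by simp
    rw [this, RCLike.norm_conj]; exact hp
  have e : kappa s x * (zetaBd s x ^ (n + 1) * J.jostP (zetaBd s x) n -
        starRingEnd ℂ (zetaBd s x) ^ (n + 1) * J.phase s x ^ 2 *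
          starRingEnd ℂ (J.jostP (zetaBd s x) n)) -
      kappa s x * (zetaBd s x ^ (n + 1) - starRingEnd ℂ (zetaBd s x) ^ (n + 1)) +
      (J.phase s x ^ 2 - 1) * (kappa s x * starRingEnd ℂ (zetaBd s x) ^ (n + 1)) =
      kappa s x * (zetaBd s x ^ (n + 1) * (J.jostP (zetaBd s x) n - 1) -
        starRingEnd ℂ (zetaBd s x) ^ (n + 1) * J.phase s x ^ 2 *
          (starRingEnd ℂ (J.jostP (zetaBd s x) n) - 1)) := by ring
  rw [e, norm_mul]
  have h2 : ‖zetaBd s x ^ (n + 1) * (J.jostP (zetaBd s x) n - 1) -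
        starRingEnd ℂ (zetaBd s x) ^ (n + 1) * J.phase s x ^ 2 *
          (starRingEnd ℂ (J.jostP (zetaBd s x) n) - 1)‖ ≤ 2 * C * J.rho n := by
    refine (norm_sub_le _ _).trans ?_
    simp only [norm_mul, norm_pow, RCLike.norm_conj, hζ, hph, one_pow, one_mul]
    linarith
  exact (mul_le_mul hk h2 (norm_nonneg _) (by positivity)).trans_eq (by ring)

theorem memLp_remainder (hTr : J.TraceCondition) {s c : ℝ} (hs : s = 1 ∨ s = -1)
    (hc : c < 1) (n : ℕ) : MemLp (J.remainder s c n) 2 muI := by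
  obtain ⟨C, hC0, hC⟩ := exists_remainder_bound hTr hs hc
  refine MemLp.of_bound (C := C * J.rho n) ?_ (ae_muI_mem.mono fun x hx => hC n x hx)
  have h1 := aestronglyMeasurable_muI (continuousOn_phase hTr hs)
  have h2 := aestronglyMeasurable_muI (continuousOn_psi_ofReal hTr n)
  have h3 := (memLp_psiFree n).1
  have h4 := (memLp_kappa_mul_pow hs n).1
  have h5 : AEStronglyMeasurable (cutoff c) muI := (measurable_cutoff c).aestronglyMeasurable
  have h6 : AEStronglyMeasurable (fun x => J.phase s x ^ 2 - 1) muI :=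
    (h1.pow 2).sub aestronglyMeasurable_const
  exact h5.mul (((h1.mul h2).sub h3).add (h6.mul h4))

theorem norm_cutoff_mul_phase_le (hTr : J.TraceCondition) {s x : ℝ} (hs : s = 1 ∨ s = -1)
    (hx : x ∈ Set.Ioo (-1 : ℝ) 1) (c : ℝ) : ‖cutoff c x * (J.phase s x ^ 2 - 1)‖ ≤ 2 := by
  have h1 : ‖J.phase s x ^ 2 - 1‖ ≤ 2 := by
    refine (norm_sub_le _ _).trans ?_
    rw [norm_pow, norm_phase hTr hs hx]
    norm_num
  rw [norm_mul]
  exact (mul_le_of_le_one_left (norm_nonneg _) (norm_cutoff_le c x)).trans h1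

theorem exists_conj_phase_op (hTr : J.TraceCondition) {s : ℝ} (hs : s = 1 ∨ s = -1)
    {S : L2Interval →L[ℂ] L2Interval} (hS : IsMultiplicationBy (J.phase s) S) :
    ∃ T : L2Interval →L[ℂ] L2Interval,
      IsMultiplicationBy (fun x => starRingEnd ℂ (J.phase s x)) T ∧ (∀ g, ‖T g‖ ≤ ‖g‖) ∧
      (∀ g, T (S g) = g) ∧ ∀ g, S (T g) = g := by
  obtain ⟨T, hT, hT1⟩ := exists_isMultiplicationBy (σ := fun x => starRingEnd ℂ (J.phase s x))
    (Complex.continuous_conj.comp_aestronglyMeasurable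
      (aestronglyMeasurable_muI (continuousOn_phase hTr hs))) (C := 1)
    fun x hx => by rw [RCLike.norm_conj, norm_phase hTr hs hx]
  refine ⟨T, hT, fun g => by simpa using hT1 g, fun g => ?_, fun g => ?_⟩
  · exact DFunLike.congr_fun ((hT.comp hS).ext IsMultiplicationBy.id
      fun x hx => by rw [mul_comm, phase_mul_conj hTr hs hx]) g
  · exact DFunLike.congr_fun ((hS.comp hT).ext IsMultiplicationBy.id
      fun x hx => phase_mul_conj hTr hs hx) g

/-- On `[-c,c]` the perturbed expansion converges to the free one as `t → ±∞`. -/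
theorem exists_local_analysis (hTr : J.TraceCondition) (hrho : Summable fun n => J.rho n ^ 2)
    {s c : ℝ} (hs : s = 1 ∨ s = -1) (hc : c < 1) {A₀ : L2Interval →L[ℂ] Ell2}
    (hA₀ : IsAnalysis (fun n x => (psiFree n x : ℂ)) A₀)
    {S X M : L2Interval →L[ℂ] L2Interval} (hS : IsMultiplicationBy (J.phase s) S)
    (hX : IsMultiplicationBy (fun x => (x : ℂ)) X) (hM : IsMultiplicationBy (cutoff c) M)
    {l : Filter ℝ} (hl : l ≤ cocompact ℝ) (hls : ∀ᶠ t in l, 0 ≤ s * t) :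
    ∃ A, IsAnalysis (fun n x => cutoff c x * (J.psi n x : ℂ)) A ∧
      ∀ g, Tendsto (fun t => A (S (evol X t g)) - A₀ (M (evol X t g))) l (𝓝 0) := by
  obtain ⟨AE, hAE, hAE1⟩ := exists_isAnalysis_wave hs
  obtain ⟨C, hC0, hC⟩ := exists_remainder_bound hTr hs hc
  -- The condition `∑ ρₙ² < ∞` enters here: the remainder is Hilbert–Schmidt.
  obtain ⟨AR, hAR, hAR1⟩ := exists_isAnalysis_of_summable (memLp_remainder hTr hs hc)
    (B := fun n => (muI Set.univ ^ ((2 : ENNReal).toReal)⁻¹).toReal * (C * J.rho n))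
    (fun n => eLpNorm_muI_toReal_le (mul_nonneg hC0 (J.rho_nonneg n)) (hC n))
    (by
      simp only [mul_pow, ← mul_assoc]
      exact hrho.mul_left _)
  obtain ⟨Sb, hSb, hSb1, hSbS, hSSb⟩ := exists_conj_phase_op hTr hs hS
  have hcm : AEStronglyMeasurable (cutoff c) muI := (measurable_cutoff c).aestronglyMeasurable
  have hph := aestronglyMeasurable_muI (continuousOn_phase hTr hs)
  obtain ⟨T, hT, -⟩ := exists_isMultiplicationBy
    (σ := fun x => cutoff c x * (J.phase s x ^ 2 - 1))
    (hcm.mul ((hph.pow 2).sub aestronglyMeasurable_const)) (C := 2)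
    fun x hx => norm_cutoff_mul_phase_le hTr hs hx c
  have hm0 : ∀ n, MemLp (fun x => (psiFree n x : ℂ) * cutoff c x) 2 muI := fun n =>
    (memLp_psiFree n).of_le ((memLp_psiFree n).1.mul hcm) (Eventually.of_forall fun x => by
      rw [norm_mul]
      exact mul_le_of_le_one_right (norm_nonneg _) (norm_cutoff_le c x))
  have hm1 : ∀ n, MemLp (fun x => (-1 : ℂ) * (kappa s x * starRingEnd ℂ (zetaBd s x) ^ (n + 1) *
      (cutoff c x * (J.phase s x ^ 2 - 1)))) 2 muI := fun n => by
    have h := memLp_kappa_mul_pow hs n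
    refine MemLp.const_mul (h.of_le_mul (c := 2) (h.1.mul
      (hcm.mul ((hph.pow 2).sub aestronglyMeasurable_const))) ?_) _
    filter_upwards [ae_muI_mem] with x hx
    have hk := mul_le_mul_of_nonneg_left (norm_cutoff_mul_phase_le hTr hs hx c)
      (norm_nonneg (kappa s x * starRingEnd ℂ (zetaBd s x) ^ (n + 1)))
    rw [Pi.mul_apply, norm_mul, mul_comm (2 : ℝ)]
    exact hk
  -- On `[-c,c]`, `σ ψₙ` is the free function plus the remainder minus the wave times `σ² - 1`. The
  -- cutoff expansion itself is then obtained by composing with multiplication by `σ̄ = σ⁻¹`.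
  have hB : IsAnalysis (fun n x => J.phase s x * (cutoff c x * (J.psi n x : ℂ)))
      (A₀ ∘L M + AR + (-1 : ℂ) • (AE ∘L T)) := by
    refine (((hA₀.comp hM).add hAR hm0 (memLp_remainder hTr hs hc)).add ((hAE.comp hT).smul (-1))
      (fun n => (hm0 n).add (memLp_remainder hTr hs hc n)) hm1).congr fun n x _ => ?_
    simp only [remainder]
    ring
  refine ⟨(A₀ ∘L M + AR + (-1 : ℂ) • (AE ∘L T)) ∘L Sb, ?_, fun g => ?_⟩
  · refine (hB.comp hSb).congr fun n x hx => ?_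
    linear_combination (cutoff c x * (J.psi n x : ℂ)) * phase_mul_conj hTr hs hx
  · have h1 : Tendsto (fun t => AR (evol X t g)) l (𝓝 0) := by
      refine tendsto_ell2_zero_of_dominated (B := fun n =>
        (muI Set.univ ^ ((2 : ENNReal).toReal)⁻¹).toReal * (C * J.rho n) * ‖g‖) ?_ ?_ fun n => ?_
      · simp only [mul_pow, ← mul_assoc]
        exact (hrho.mul_left _).mul_right _
      · refine Eventually.of_forall fun t n => (hAR1 _ n).trans ?_
        refine mul_le_mul_of_nonneg_left (norm_evol_le hX t g) ?_
        have := J.rho_nonneg n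
        positivity
      · simp only [hAR _ n]
        exact tendsto_integral_evol hX hl g
    have h2 := tendsto_wave_evol hs hAE hAE1 hX hl hls (T g)
    have h3 := h1.sub h2
    rw [sub_zero] at h3
    refine h3.congr fun t => ?_
    -- The factor `cutoff · (σ² - 1)` commutes with the evolution, so the wave term is the evolution
    -- of the fixed vector `T g`.
    rw [ContinuousLinearMap.comp_apply, hSbS]
    have h4 : T (evol X t g) = evol X t (T g) := hT.comm (isMultiplicationBy_evol hX t) g
    change _ = A₀ (M (evol X t g)) + AR (evol X t g) + (-1 : ℂ) • AE (T (evol X t g))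
      - A₀ (M (evol X t g))
    rw [h4]
    module

end JacobiMatrix

/-! ### Removing the cutoff and passing to the wave operators. -/

theorem exists_mul_x : ∃ X : L2Interval →L[ℂ] L2Interval,
    IsMultiplicationBy (fun x => (x : ℂ)) X := by
  obtain ⟨X, hX, -⟩ := exists_isMultiplicationBy (σ := fun x => (x : ℂ))
    Complex.continuous_ofReal.aestronglyMeasurable (C := 1) fun x hx => by
      rw [Complex.norm_real]; exact abs_le.2 ⟨hx.1.le, hx.2.le⟩
  exact ⟨X, hX⟩

theorem exists_mul_cutoff (c : ℝ) : ∃ M : L2Interval →L[ℂ] L2Interval,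
    IsMultiplicationBy (cutoff c) M ∧ ∀ g, ‖M g‖ ≤ ‖g‖ := by
  obtain ⟨M, hM, hM1⟩ := exists_isMultiplicationBy (σ := cutoff c)
    (measurable_cutoff c).aestronglyMeasurable (C := 1) fun x _ => norm_cutoff_le c x
  exact ⟨M, hM, fun g => by simpa using hM1 g⟩

namespace JacobiMatrix

variable {J : JacobiMatrix}

theorem exists_mul_phase (hTr : J.TraceCondition) {s : ℝ} (hs : s = 1 ∨ s = -1) :
    ∃ S : L2Interval →L[ℂ] L2Interval, IsMultiplicationBy (J.phase s) S ∧ ∀ g, ‖S g‖ ≤ ‖g‖ := by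
  obtain ⟨S, hS, hS1⟩ := exists_isMultiplicationBy (σ := J.phase s)
    (aestronglyMeasurable_muI (continuousOn_phase hTr hs)) (C := 1)
    fun x hx => (norm_phase hTr hs hx).le
  exact ⟨S, hS, fun g => by simpa using hS1 g⟩

/-- The expansion restricted to `[-c,c]` is a contraction. -/
theorem norm_local_analysis_le (hTr : J.TraceCondition) (hrho : Summable fun n => J.rho n ^ 2)
    {c : ℝ} (hc : c < 1) {A : L2Interval →L[ℂ] Ell2}
    (hA : IsAnalysis (fun n x => cutoff c x * (J.psi n x : ℂ)) A) (h : L2Interval) :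
    ‖A h‖ ≤ ‖h‖ := by
  have hs : (1 : ℝ) = 1 ∨ (1 : ℝ) = -1 := Or.inl rfl
  obtain ⟨A₀, hA₀, hA₀1⟩ := exists_isAnalysis_psiFree
  obtain ⟨X, hX⟩ := exists_mul_x
  obtain ⟨S, hS, -⟩ := exists_mul_phase hTr hs
  obtain ⟨M, hM, hM1⟩ := exists_mul_cutoff c
  obtain ⟨T, -, hT1, -, hST⟩ := exists_conj_phase_op hTr hs hS
  obtain ⟨A', hA', hlim⟩ := exists_local_analysis hTr hrho hs hc hA₀ hS hX hM
    atTop_le_cocompact (by filter_upwards [eventually_ge_atTop 0] with t ht; linarith)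
  obtain rfl : A' = A := hA'.ext hA fun _ _ _ => rfl
  have hA2 : IsAnalysis (fun n x => (cutoff c x * (√(J.weight x) : ℂ)) * (J.P n x : ℂ)) A' :=
    hA'.congr fun n x _ => by simp only [psi]; push_cast; ring
  have hL2 : ∀ n, MemLp (fun x => (cutoff c x * (√(J.weight x) : ℂ)) * (J.P n x : ℂ)) 2 muI :=
    fun n => by
      have := memLp_cutoff_psi hTr hc n
      simpa only [psi, Complex.ofReal_mul, mul_assoc] using this
  -- Since `T` inverts `S`, the vector `A' (S (evol X t (T h)))` is the evolution of `A' h` and has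
  -- the same norm for every `t`. As `t → ∞` it approaches the image of a vector of norm at most
  -- `‖h‖` under the free contraction. The bound on `A'` thus improves from some constant depending
  -- on `c` to `1`.
  have hev : ∀ t, ‖A' h‖ ≤
      ‖A' (S (evol X t (T h))) - A₀ (M (evol X t (T h)))‖ + ‖h‖ := fun t => by
    have e1 : A' (S (evol X t (T h))) = evol J.op t (A' h) := by
      rw [J.evol_analysis hL2 hA2 hX, hS.comm (isMultiplicationBy_evol hX t), hST]
    have e2 : ‖A' h‖ = ‖A' (S (evol X t (T h)))‖ := by rw [e1, norm_evol_op]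
    have e3 : ‖A₀ (M (evol X t (T h)))‖ ≤ ‖h‖ :=
      (hA₀1 _).trans ((hM1 _).trans ((norm_evol_le hX t _).trans (hT1 h)))
    rw [e2]
    have := norm_sub_norm_le (A' (S (evol X t (T h)))) (A₀ (M (evol X t (T h))))
    linarith
  have hl := (hlim (T h)).norm.add_const ‖h‖
  rw [norm_zero, zero_add] at hl
  exact ge_of_tendsto' hl hev

/-- Radii increasing to `1`. -/
noncomputable def radius (j : ℕ) : ℝ := 1 - 1 / (j + 1)

theorem radius_lt_one (j : ℕ) : radius j < 1 := by
  have : (0 : ℝ) < 1 / (j + 1) := by positivity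
  simp only [radius]; linarith

theorem eventually_cutoff_radius {x : ℝ} (hx : x ∈ Set.Ioo (-1 : ℝ) 1) :
    ∀ᶠ j in atTop, cutoff (radius j) x = 1 := by
  have h1 : Tendsto radius atTop (𝓝 1) := by
    have := (tendsto_one_div_add_atTop_nhds_zero_nat (𝕜 := ℝ)).const_sub 1
    rwa [sub_zero] at this
  have hx' : |x| < 1 := abs_lt.2 hx
  filter_upwards [h1.eventually (lt_mem_nhds hx')] with j hj
  have := abs_lt.1 hj
  exact cutoff_of_mem ⟨this.1.le, this.2.le⟩

theorem exists_local_analysis' (hTr : J.TraceCondition) (hrho : Summable fun n => J.rho n ^ 2)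
    {c : ℝ} (hc : c < 1) : ∃ A, IsAnalysis (fun n x => cutoff c x * (J.psi n x : ℂ)) A ∧
      ∀ g, ‖A g‖ ≤ ‖g‖ := by
  have hs : (1 : ℝ) = 1 ∨ (1 : ℝ) = -1 := Or.inl rfl
  obtain ⟨A₀, hA₀, -⟩ := exists_isAnalysis_psiFree
  obtain ⟨X, hX⟩ := exists_mul_x
  obtain ⟨S, hS, -⟩ := exists_mul_phase hTr hs
  obtain ⟨M, hM, -⟩ := exists_mul_cutoff c
  obtain ⟨A, hA, -⟩ := exists_local_analysis hTr hrho hs hc hA₀ hS hX hM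
    atTop_le_cocompact (by filter_upwards [eventually_ge_atTop 0] with t ht; linarith)
  exact ⟨A, hA, norm_local_analysis_le hTr hrho hc hA⟩

/-- Apply the contraction to `h = cutoff · ψₙ`: its `n`-th coefficient is `‖h‖²`, so `‖h‖² ≤ ‖h‖`
and `‖h‖ ≤ 1` for every radius. Fatou's lemma removes the cutoff. -/
theorem memLp_psi (hTr : J.TraceCondition) (hrho : Summable fun n => J.rho n ^ 2) (n : ℕ) :
    MemLp (fun x => (J.psi n x : ℂ)) 2 muI := by
  have hm := aestronglyMeasurable_muI (continuousOn_psi_ofReal hTr n)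
  refine ⟨hm, ?_⟩
  have hle : ∀ j, eLpNorm (fun x => cutoff (radius j) x * (J.psi n x : ℂ)) 2 muI ≤ 1 := by
    intro j
    have hL := memLp_cutoff_psi hTr (radius_lt_one j) n
    obtain ⟨A, hA, hA1⟩ := exists_local_analysis' hTr hrho (radius_lt_one j)
    set h : L2Interval := MemLp.toLp _ hL with hh
    have h1 : A h n = inner ℂ h h := by
      rw [hA, L2.inner_def]
      refine integral_congr_ae ?_
      filter_upwards [hL.coeFn_toLp] with x hx
      rw [hx, RCLike.inner_apply, map_mul, conj_cutoff, Complex.conj_ofReal]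
    have h2 : ‖h‖ ^ 2 ≤ ‖h‖ := by
      have h3 : ‖A h n‖ = ‖h‖ ^ 2 := by
        rw [h1, inner_self_eq_norm_sq_to_K]; simp
      rw [← h3]
      exact (lp.norm_apply_le_norm (by norm_num) _ n).trans (hA1 h)
    have h4 : ‖h‖ ≤ 1 := by nlinarith [norm_nonneg h]
    rw [hh, Lp.norm_toLp] at h4
    rw [← ENNReal.ofReal_toReal hL.2.ne]
    exact ENNReal.ofReal_le_one.2 h4
  have hlim := Lp.eLpNorm_lim_le_liminf_eLpNorm (p := 2) (μ := muI)
    (f := fun j x => cutoff (radius j) x * (J.psi n x : ℂ))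
    (fun j => (memLp_cutoff_psi hTr (radius_lt_one j) n).1) (fun x => (J.psi n x : ℂ))
    (by
      filter_upwards [ae_muI_mem] with x hx
      refine tendsto_const_nhds.congr' ?_
      filter_upwards [eventually_cutoff_radius hx] with j hj
      rw [hj, one_mul])
  refine lt_of_le_of_lt (hlim.trans ?_) ENNReal.one_lt_top
  exact liminf_le_of_le (by isBoundedDefault) fun b hb => by
    obtain ⟨j, hj⟩ := hb.exists
    exact hj.trans (hle j)

/-- The expansion operator of the Jacobi operator. -/
theorem exists_isAnalysis_psi (hTr : J.TraceCondition) (hrho : Summable fun n => J.rho n ^ 2) :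
    ∃ G, IsAnalysis (fun n x => (J.psi n x : ℂ)) G ∧ ∀ g, ‖G g‖ ≤ ‖g‖ := by
  have hL := memLp_psi hTr hrho
  obtain ⟨G, hG, hG1⟩ := exists_isAnalysis hL zero_le_one fun g N => by
    have hlim : Tendsto (fun j => ∑ n ∈ Finset.range N,
        ‖∫ x, cutoff (radius j) x * (J.psi n x : ℂ) * g x ∂muI‖ ^ 2) atTop
        (𝓝 (∑ n ∈ Finset.range N, ‖∫ x, (J.psi n x : ℂ) * g x ∂muI‖ ^ 2)) := by
      refine tendsto_finsetSum _ fun n _ => ?_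
      refine (Tendsto.norm ?_).pow 2
      have hi := integrable_mul_l2 (hL n) g
      refine tendsto_integral_of_dominated_convergence (fun x => ‖(J.psi n x : ℂ) * g x‖)
        (fun j => ?_) hi.norm (fun j => Eventually.of_forall fun x => ?_) ?_
      · exact (integrable_mul_l2 (memLp_cutoff_psi hTr (radius_lt_one j) n) g).1
      · rw [mul_assoc, norm_mul]
        exact mul_le_of_le_one_left (norm_nonneg _) (norm_cutoff_le _ _)
      · filter_upwards [ae_muI_mem] with x hx
        refine tendsto_const_nhds.congr' ?_
        filter_upwards [eventually_cutoff_radius hx] with j hj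
        rw [hj, one_mul]
    refine le_of_tendsto' hlim fun j => ?_
    obtain ⟨A, hA, hA1⟩ := exists_local_analysis' hTr hrho (radius_lt_one j)
    simp only [← hA g]
    refine ((ell2_summable (A g)).sum_le_tsum _ fun n _ => by positivity).trans ?_
    rw [← ell2_norm_sq, one_mul]
    exact pow_le_pow_left₀ (norm_nonneg _) (hA1 g) 2
  exact ⟨G, hG, fun g => by simpa using hG1 g⟩

/-- The difference is bounded by `2‖g‖` uniformly in `t`, so `g` may be taken to be a test function.
Then some cutoff fixes `g`, and it commutes with the evolution and the phase, which leaves the local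
statement. -/
theorem tendsto_analysis_sub (hTr : J.TraceCondition) (hrho : Summable fun n => J.rho n ^ 2)
    {s : ℝ} (hs : s = 1 ∨ s = -1) {A₀ G : L2Interval →L[ℂ] Ell2}
    (hA₀ : IsAnalysis (fun n x => (psiFree n x : ℂ)) A₀) (hA₀1 : ∀ g, ‖A₀ g‖ ≤ ‖g‖)
    (hG : IsAnalysis (fun n x => (J.psi n x : ℂ)) G) (hG1 : ∀ g, ‖G g‖ ≤ ‖g‖)
    {S X : L2Interval →L[ℂ] L2Interval} (hS : IsMultiplicationBy (J.phase s) S)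
    (hX : IsMultiplicationBy (fun x => (x : ℂ)) X) {l : Filter ℝ} (hl : l ≤ cocompact ℝ)
    (hls : ∀ᶠ t in l, 0 ≤ s * t) (g : L2Interval) :
    Tendsto (fun t => G (S (evol X t g)) - A₀ (evol X t g)) l (𝓝 0) := by
  have hS1 : ∀ g, ‖S g‖ ≤ ‖g‖ := fun g => by
    simpa using hS.norm_le (C := 1) (fun x hx => (norm_phase hTr hs hx).le) g
  obtain ⟨V, hV, hVm⟩ := tendsto_zero_of_submodule (l := l)
    (fun t => G ∘L S ∘L evol X t - A₀ ∘L evol X t) (C := 2) fun t g => by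
      change ‖G (S (evol X t g)) - A₀ (evol X t g)‖ ≤ _
      have h1 := norm_sub_le (G (S (evol X t g))) (A₀ (evol X t g))
      have h2 := (hG1 _).trans ((hS1 _).trans (norm_evol_le hX t g))
      have h3 := (hA₀1 _).trans (norm_evol_le hX t g)
      linarith
  have htop : V = ⊤ := by
    refine submodule_eq_top_of_test (ρ := fun _ => 1) aestronglyMeasurable_const (C := 1)
      (fun x _ => by simp) (fun x _ => one_ne_zero) hV fun m hm g hg => ?_
    rw [hVm]
    obtain ⟨c, hc0, hc1, hcm⟩ := hm.exists_radius
    obtain ⟨M, hM, -⟩ := exists_mul_cutoff c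
    have hMg : M g = g := by
      refine Lp.ext ?_
      filter_upwards [hM g, hg] with x h1 h2
      rw [h1, h2]
      by_cases h : x ∈ Set.Icc (-c) c
      · rw [cutoff_of_mem h, one_mul]
      · have : m x = 0 := hcm x (by
          by_contra hcon
          push Not at hcon
          have := abs_lt.1 hcon
          exact h ⟨this.1.le, this.2.le⟩)
        rw [this]; simp
    obtain ⟨A, hA, hlim⟩ := exists_local_analysis hTr hrho hs hc1 hA₀ hS hX hM hl hls
    have hGM : ∀ f, G (M f) = A f := fun f => DFunLike.congr_fun
      ((hG.comp hM).ext hA fun n x _ => mul_comm _ _) f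
    refine (hlim g).congr fun t => ?_
    change _ = G (S (evol X t g)) - A₀ (evol X t g)
    have e1 : M (evol X t g) = evol X t g := by
      rw [hM.comm (isMultiplicationBy_evol hX t), hMg]
    rw [← hGM, hM.comm hS, e1]
  exact (hVm g).1 (htop ▸ Submodule.mem_top)

/-- With `g = F₀ u` the intertwining relations give `e^{itH} e^{-itH₀} u - G S g = e^{itH} (A₀ - G
S) e^{-itx} g`. Unitarity of `e^{itH}` reduces its norm to `tendsto_analysis_sub`. -/
theorem isWaveOperator_of_analysis (hTr : J.TraceCondition)
    (hrho : Summable fun n => J.rho n ^ 2) {s : ℝ} (hs : s = 1 ∨ s = -1)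
    {A₀ G : L2Interval →L[ℂ] Ell2}
    (hA₀ : IsAnalysis (fun n x => (psiFree n x : ℂ)) A₀) (hA₀1 : ∀ g, ‖A₀ g‖ ≤ ‖g‖)
    (hG : IsAnalysis (fun n x => (J.psi n x : ℂ)) G) (hG1 : ∀ g, ‖G g‖ ≤ ‖g‖)
    {S : L2Interval →L[ℂ] L2Interval} (hS : IsMultiplicationBy (J.phase s) S)
    {l : Filter ℝ} (hl : l ≤ cocompact ℝ) (hls : ∀ᶠ t in l, 0 ≤ s * t) :
    IsWaveOperator l J.op free.op (G ∘L S ∘L ContinuousLinearMap.adjoint A₀) := by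
  obtain ⟨X, hX⟩ := exists_mul_x
  have hF₀ := hA₀.isExpansionMap memLp_psiFree
  -- Only the orthonormality of the free family is needed, not its completeness in `L²(-1,1)`.
  have hid : A₀ ∘L ContinuousLinearMap.adjoint A₀ = ContinuousLinearMap.id ℂ Ell2 := by
    refine ell2_ext_of_single fun n => ?_
    ext k
    rw [ContinuousLinearMap.comp_apply, hA₀]
    have h1 : ∫ x, (psiFree k x : ℂ) * (ContinuousLinearMap.adjoint A₀ (lp.single 2 n 1)) x ∂muI =
        ∫ x, ((psiFree k x * psiFree n x : ℝ) : ℂ) ∂muI := by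
      refine integral_congr_ae ?_
      filter_upwards [hF₀ n] with x hx
      rw [hx]; push_cast; rfl
    rw [h1, integral_complex_ofReal, integral_psiFree_mul, ContinuousLinearMap.id_apply,
      lp.single_apply, Pi.single_apply]
    split_ifs <;> simp
  have hfree : ∀ t g, evol free.op t (A₀ g) = A₀ (evol X t g) := fun t g => by
    have e : (fun (n : ℕ) x => (psiFree n x : ℂ)) =
        fun n x => (ampFree x : ℂ) * (free.P n x : ℂ) := by
      funext n x; simp only [psiFree, ampFree]; push_cast; rfl
    have h1 : ∀ n, MemLp (fun x => (ampFree x : ℂ) * (free.P n x : ℂ)) 2 muI := fun n => by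
      have := memLp_psiFree n
      rwa [show (fun x => (psiFree n x : ℂ)) = fun x => (ampFree x : ℂ) * (free.P n x : ℂ) from
        congrFun e n] at this
    rw [e] at hA₀
    exact free.evol_analysis h1 hA₀ hX t g
  have hpert : ∀ t g, evol J.op t (G g) = G (evol X t g) := fun t g => by
    have e : (fun (n : ℕ) x => (J.psi n x : ℂ)) =
        fun n x => (√(J.weight x) : ℂ) * (J.P n x : ℂ) := by
      funext n x; simp only [psi]; push_cast; rfl
    have h1 : ∀ n, MemLp (fun x => (√(J.weight x) : ℂ) * (J.P n x : ℂ)) 2 muI := fun n => by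
      have := memLp_psi hTr hrho n
      rwa [show (fun x => (J.psi n x : ℂ)) = fun x => (√(J.weight x) : ℂ) * (J.P n x : ℂ) from
        congrFun e n] at this
    rw [e] at hG
    exact J.evol_analysis h1 hG hX t g
  intro u
  set g := ContinuousLinearMap.adjoint A₀ u with hg
  have hu : A₀ g = u := DFunLike.congr_fun hid u
  have hlim := tendsto_analysis_sub hTr hrho hs hA₀ hA₀1 hG hG1 hS hX hl hls g
  rw [tendsto_iff_norm_sub_tendsto_zero]
  refine (tendsto_zero_iff_norm_tendsto_zero.1 hlim).congr fun t => ?_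
  change _ = ‖NormedSpace.exp ((Complex.I * (t : ℂ)) • J.op) (evol free.op t u) - G (S g)‖
  have e1 : G (S g) = NormedSpace.exp ((Complex.I * (t : ℂ)) • J.op)
      (G (S (evol X t g))) := by
    rw [hS.comm (isMultiplicationBy_evol hX t), ← hpert, exp_mul_evol_op]
  rw [e1, ← map_sub, norm_exp_op, norm_sub_rev, ← hfree, hu]

end JacobiMatrix

theorem theorem6p4 (J : JacobiMatrix) (hTr : J.TraceCondition)
    (hrho : Summable fun n => J.rho n ^ 2) :
    -- the Jost solution and the boundary values of the Jost function are well defined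
    (∀ z ∈ cutPlane, ∃! f : ℕ → ℂ, J.IsJostSolution z f) ∧
    (∀ x ∈ Set.Ioo (-1 : ℝ) 1,
      Tendsto J.jostFunction (𝓝[{z : ℂ | 0 < z.im}] (x : ℂ)) (𝓝 (J.jostPlus x)) ∧
      Tendsto J.jostFunction (𝓝[{z : ℂ | z.im < 0}] (x : ℂ)) (𝓝 (J.jostMinus x)) ∧
      J.jostPlus x ≠ 0 ∧ J.jostMinus x ≠ 0) ∧
    -- the operators of the stationary representation are well defined, the strong limits exist,
    -- and they are given by the representation
    ∃ (F F₀ : Ell2 →L[ℂ] L2Interval) (Sp Sm : L2Interval →L[ℂ] L2Interval),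
      IsExpansionMap J.psi F ∧ IsExpansionMap psiFree F₀ ∧
      IsMultiplicationBy J.sigmaPlus Sp ∧ IsMultiplicationBy J.sigmaMinus Sm ∧
      IsWaveOperator atTop J.op JacobiMatrix.free.op
        (ContinuousLinearMap.adjoint F ∘L Sp ∘L F₀) ∧
      IsWaveOperator atBot J.op JacobiMatrix.free.op
        (ContinuousLinearMap.adjoint F ∘L Sm ∘L F₀) := by
  refine ⟨fun z hz => J.existsUnique_jostSolution hTr hz, fun x hx => ?_, ?_⟩
  · rw [J.jostPlus_eq hTr hx, J.jostMinus_eq hTr hx]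
    refine ⟨?_, ?_, J.jostOmega_ne_zero hTr (Or.inl rfl) hx,
      J.jostOmega_ne_zero hTr (Or.inr rfl) hx⟩
    · have h := J.tendsto_jostFunction hTr (Or.inl rfl) hx
      rwa [JacobiMatrix.setOf_one_mul_im] at h
    · have h := J.tendsto_jostFunction hTr (Or.inr rfl) hx
      rwa [JacobiMatrix.setOf_neg_one_mul_im] at h
  · obtain ⟨A₀, hA₀, hA₀1⟩ := exists_isAnalysis_psiFree
    obtain ⟨G, hG, hG1⟩ := JacobiMatrix.exists_isAnalysis_psi hTr hrho
    obtain ⟨Sp, hSp, -⟩ := JacobiMatrix.exists_mul_phase hTr (Or.inl rfl)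
    obtain ⟨Sm, hSm, -⟩ := JacobiMatrix.exists_mul_phase hTr (Or.inr rfl)
    refine ⟨ContinuousLinearMap.adjoint G, ContinuousLinearMap.adjoint A₀, Sp, Sm,
      hG.isExpansionMap (JacobiMatrix.memLp_psi hTr hrho), hA₀.isExpansionMap memLp_psiFree,
      hSp.congr fun x hx => ?_, hSm.congr fun x hx => ?_, ?_, ?_⟩
    · rw [JacobiMatrix.sigmaPlus, J.jostPlus_eq hTr hx]; rfl
    · rw [JacobiMatrix.sigmaMinus, J.jostMinus_eq hTr hx]; rfl
    · rw [ContinuousLinearMap.adjoint_adjoint]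
      exact JacobiMatrix.isWaveOperator_of_analysis hTr hrho (Or.inl rfl) hA₀ hA₀1 hG hG1 hSp
        atTop_le_cocompact (by filter_upwards [eventually_ge_atTop 0] with t ht; linarith)
    · rw [ContinuousLinearMap.adjoint_adjoint]
      exact JacobiMatrix.isWaveOperator_of_analysis hTr hrho (Or.inr rfl) hA₀ hA₀1 hG hG1 hSm
        atBot_le_cocompact (by filter_upwards [eventually_le_atBot 0] with t ht; linarith)
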